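/- Let $A:\mathbb{R}^d\to 2^{\mathbb{R}^d}$ be a maximal monotone operator with graph $\mathrm{Gr}(A)=\{(z,y): y\in A(z)\}$ and domain $\mathrm{D}(A)=\{z: A(z)\neq\emptyset\}$, and assume (H$_1$) $\mathrm{Int}(\mathrm{D}(A))\neq\emptyset$; (H$_2$) $\Pi:\mathbb{R}^d\to\overline{\mathrm{D}(A)}$ is a generalized projection: $\Pi(z)=z$ for all $z\in\overline{\mathrm{D}(A)}$, and $|\Pi(z)-\Pi(z')|\le|z-z'|$ for all $z,z'\in\mathbb{R}^d$. For càdlàg functions $y,x,k:\mathbb{R}^+\to\mathbb{R}^d$ with $y_0\in\overline{\mathrm{D}(A)}$, write $(x,k)=\mathcal{SP}(A,\Pi;y)$ if (i) $x_t=y_t-k_t\in\overline{\mathrm{D}(A)}$ for all $t\in\mathbb{R}^+$; (ii) $k$ has locally bounded variation, $k_0=0$, and for every $(\alpha,\beta)\in\mathrm{Gr}(A)$ and all $0\le s<t$, $$\int_s^t\langle x_u-\alpha,\,dk^c_u-\beta\,du\rangle\ge 0,\qquad k^c_t:=k_t-\sum_{s\le t}\Delta k_s;$$ (iii) for every $t\in\mathbb{R}^+$,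 if $|\Delta k_t|>0$ then $x_t=\Pi(x_{t-}+\Delta y_t)$. Here $\Delta f_t=f_t-f_{t-}$ and $f_{0-}=f_0$. Let $(\Omega,\mathcal{F},\mathbb{P})$ be a complete probability space with a filtration $\{\mathcal{F}_t\}_{t\ge0}$ such that each $\mathcal{F}_t$ contains all $\mathbb{P}$-null sets. A process is called càdlàg if $\mathbb{P}$-almost all of its paths are càdlàg. Let $Y:\Omega\times\mathbb{R}^+\to\mathbb{R}^d$ be an $\mathcal{F}_t$-adapted càdlàg process with $Y_0\in\overline{\mathrm{D}(A)}$ $\mathbb{P}$-a.s. Then there exists a pair $(X,K)$ of $\mathcal{F}_t$-adapted càdlàg processes such that $(X(\omega),K(\omega))=\mathcal{SP}(A,\Pi;Y(\omega))$ for $\mathbb{P}$-almost every $\omega$ (in particular $X_t+K_t=Y_t$ for all $t\ge 0$ and $X_0=Y_0$, $\mathbb{P}$-a.s.). This pair is unique up to indistinguishability: if $(X',K')$ is another such pair, then $\mathbb{P}$-a.s. $X_t=X'_t$ and $K_t=K'_t$ for all $t\in\mathbb{R}^+$. -/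

import Mathlib

open Set Filter Topology MeasureTheory ProbabilityTheory
open scoped NNReal ENNReal

/-! ### Maximal monotone operators and generalized projections -/

/-- The domain `D(A) = {z : A z ≠ ∅}` of a set-valued operator. -/
def opDomain {E : Type*} (A : E → Set E) : Set E := {z | (A z).Nonempty}

/-- A set-valued operator `A` is maximal monotone: its graph `{(z, y) : y ∈ A z}` is monotone, and
every pair that is monotonically related to the whole graph belongs to the graph. -/
structure IsMaximalMonotone {E : Type*} [NormedAddCommGroup E] [InnerProductSpace ℝ E]
    (A : E → Set E) : Prop where
  monotone : ∀ z y z' y', y ∈ A z → y' ∈ A z' → 0 ≤ inner ℝ (y - y') (z - z')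
  maximal : ∀ z y, (∀ u v, v ∈ A u → 0 ≤ inner ℝ (y - v) (z - u)) → y ∈ A z

/-- `p` is a generalized projection onto `D`: it takes its values in `D`, is the identity on `D`,
and is non-expansive. -/
structure IsGeneralizedProjection {E : Type*} [NormedAddCommGroup E] (D : Set E) (p : E → E) :
    Prop where
  mem : ∀ z, p z ∈ D
  eq_self : ∀ z ∈ D, p z = z
  nonexpansive : ∀ z z', ‖p z - p z'‖ ≤ ‖z - z'‖

/-! ### Càdlàg paths, jumps, continuous part, Stieltjes integral -/

/-- `f : ℝ⁺ → E` is right continuous and has left-hand limits (no condition from the left at `0`,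
where the left neighbourhood filter is trivial). -/
def IsCadlag {E : Type*} [TopologicalSpace E] (f : ℝ≥0 → E) : Prop :=
  ∀ t, ContinuousWithinAt f (Ici t) t ∧ ∃ l, Tendsto f (𝓝[<] t) (𝓝 l)

/-- The jump `Δf_t = f_t - f_{t-}`, with the convention `f_{0-} = f_0`. -/
noncomputable def jump {E : Type*} [NormedAddCommGroup E] (f : ℝ≥0 → E) (t : ℝ≥0) : E :=
  f t - Function.leftLim f t

/-- The continuous part `k^c_t = k_t - ∑_{s ≤ t} Δk_s` of a path of locally bounded variation
(for such a path the sum converges absolutely, see `summable_norm_jump`). -/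
noncomputable def contPart {E : Type*} [NormedAddCommGroup E] (k : ℝ≥0 → E) (t : ℝ≥0) : E :=
  k t - ∑' s : Iic t, jump k s

/-- The path `g` stopped at time `t` has bounded variation if `g` has locally bounded variation. -/
theorem LocallyBoundedVariationOn.stopped {E : Type*} [NormedAddCommGroup E] {g : ℝ≥0 → E}
    (hg : LocallyBoundedVariationOn g univ) (t : ℝ≥0) :
    BoundedVariationOn (fun u => g (min u t)) univ := by
  have h := hg 0 t (mem_univ _) (mem_univ _)
  refine ne_top_of_le_ne_top h ?_
  refine eVariationOn.comp_le_of_monotoneOn g (fun u => min u t) ?_ ?_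
  · intro a _ b _ hab
    exact min_le_min_right t hab
  · intro a _
    exact ⟨mem_univ _, zero_le, min_le_right _ _⟩

theorem jump_stopped {E : Type*} [NormedAddCommGroup E] (g : ℝ≥0 → E) {s t : ℝ≥0} (hst : s ≤ t) :
    jump (fun u => g (min u t)) s = jump g s := by
  have hev : (fun u => g (min u t)) =ᶠ[𝓝[<] s] g := by
    filter_upwards [self_mem_nhdsWithin] with u hu
    rw [min_eq_left ((le_of_lt hu).trans hst)]
  have hl : Function.leftLim (fun u => g (min u t)) s = Function.leftLim g s := by
    rcases eq_or_ne (𝓝[<] s) ⊥ with hb | hb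
    · rw [leftLim_eq_of_eq_bot _ hb, leftLim_eq_of_eq_bot _ hb, min_eq_left hst]
    · have : (𝓝[<] s).NeBot := ⟨hb⟩
      by_cases hy : ∃ y, Tendsto g (𝓝[<] s) (𝓝 y)
      · obtain ⟨y, hy⟩ := hy
        rw [leftLim_eq_of_tendsto hy, leftLim_eq_of_tendsto (hy.congr' hev.symm)]
      · rw [leftLim_eq_of_not_tendsto _ hy, leftLim_eq_of_not_tendsto, min_eq_left hst]
        rintro ⟨y, hy'⟩
        exact hy ⟨y, hy'.congr' hev⟩
  simp only [jump, hl, min_eq_left hst]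

theorem sum_enorm_jump_le {E : Type*} [NormedAddCommGroup E] [CompleteSpace E] {g : ℝ≥0 → E}
    (hg : BoundedVariationOn g univ) (F : Finset ℝ≥0) :
    ∀ S : Set ℝ≥0, (∀ x ∈ F, Iic x ⊆ S) → ∑ s ∈ F, ‖jump g s‖ₑ ≤ eVariationOn g S := by
  induction F using Finset.induction_on_max with
  | empty => intro S _; simp
  | insert a F hlt ih =>
    intro S hS
    have ha : a ∉ F := fun h => lt_irrefl _ (hlt a h)
    rw [Finset.sum_insert ha, add_comm]
    calc ∑ s ∈ F, ‖jump g s‖ₑ + ‖jump g a‖ₑ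
        ≤ eVariationOn g (Iio a) + edist (g a) (Function.leftLim g a) := by
          refine add_le_add (ih _ fun x hx y hy => lt_of_le_of_lt hy (hlt x hx)) ?_
          rw [edist_eq_enorm_sub, jump]
      _ = eVariationOn g (Iic a) := hg.eVariationOn_Iic_eq_Iio_add_edist.symm
      _ ≤ eVariationOn g S := eVariationOn.mono _ (hS a (Finset.mem_insert_self _ _))

/-- The jumps of a path of locally bounded variation are absolutely summable on `[0, t]`. -/
theorem summable_norm_jump {E : Type*} [NormedAddCommGroup E] [CompleteSpace E] {k : ℝ≥0 → E}
    (hk : LocallyBoundedVariationOn k univ) (t : ℝ≥0) :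
    Summable fun s : Iic t => ‖jump k s‖ := by
  have hb := hk.stopped t
  refine summable_of_sum_le (c := (eVariationOn (fun u => k (min u t)) univ).toReal)
    (fun _ => norm_nonneg _) fun F => ?_
  have h := sum_enorm_jump_le hb (F.map (Function.Embedding.subtype _)) univ
    (fun _ _ => subset_univ _)
  rw [Finset.sum_map] at h
  have h2 : ∑ s ∈ F, ‖jump k s‖ₑ ≤ eVariationOn (fun u => k (min u t)) univ := by
    refine le_trans (le_of_eq (Finset.sum_congr rfl fun s _ => ?_)) h
    simp only [Function.Embedding.subtype_apply]
    rw [jump_stopped k s.2]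
  have h3 := ENNReal.toReal_mono hb h2
  rw [ENNReal.toReal_sum (fun _ _ => enorm_ne_top)] at h3
  simpa using h3

/-- The continuous part of a path of locally bounded variation has locally bounded variation. -/
theorem LocallyBoundedVariationOn.contPart {E : Type*} [NormedAddCommGroup E] [CompleteSpace E]
    {k : ℝ≥0 → E} (hk : LocallyBoundedVariationOn k univ) :
    LocallyBoundedVariationOn (contPart k) univ := by
  set G : ℝ≥0 → ℝ := fun t => variationOnFromTo k univ 0 t + ∑' s : Iic t, ‖jump k s‖ with hG
  have key : ∀ a b, a ≤ b → ‖_root_.contPart k b - _root_.contPart k a‖ ≤ G b - G a := by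
    intro a b hab
    have hdis : Disjoint (Iic a) (Ioc a b) := by
      rw [Set.disjoint_left]; intro x hx hx'; exact absurd hx'.1 (not_lt.mpr hx)
    have hun : Iic a ∪ Ioc a b = Iic b := Iic_union_Ioc_eq_Iic hab
    have hsb := summable_norm_jump hk b
    have hsa := summable_norm_jump hk a
    have hsab : Summable fun s : Ioc a b => ‖jump k s‖ :=
      hsb.comp_injective (i := fun s : Ioc a b => (⟨s.1, s.2.2⟩ : Iic b))
        (fun x y h => Subtype.ext (congrArg (fun z : Iic b => z.1) h))
    have e1 : ∑' s : Iic b, jump k s = ∑' s : Iic a, jump k s + ∑' s : Ioc a b, jump k s := by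
      rw [← hun]
      exact Summable.tsum_union_disjoint hdis hsa.of_norm hsab.of_norm
    have e2 : ∑' s : Iic b, ‖jump k s‖ = ∑' s : Iic a, ‖jump k s‖ + ∑' s : Ioc a b, ‖jump k s‖ := by
      rw [← hun]
      exact Summable.tsum_union_disjoint (f := fun s => ‖jump k s‖) hdis hsa hsab
    have e3 : variationOnFromTo k univ 0 b
        = variationOnFromTo k univ 0 a + variationOnFromTo k univ a b :=
      (variationOnFromTo.add hk (mem_univ _) (mem_univ _) (mem_univ _)).symm
    have h1 : ‖k b - k a‖ ≤ variationOnFromTo k univ a b := by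
      rw [← dist_eq_norm, variationOnFromTo.eq_of_le _ _ hab, dist_edist]
      refine ENNReal.toReal_mono (hk a b (mem_univ _) (mem_univ _)) ?_
      exact eVariationOn.edist_le _ ⟨mem_univ _, hab, le_rfl⟩ ⟨mem_univ _, le_rfl, hab⟩
    have h2 : ‖∑' s : Ioc a b, jump k s‖ ≤ ∑' s : Ioc a b, ‖jump k s‖ := norm_tsum_le_tsum_norm hsab
    have e4 : _root_.contPart k b - _root_.contPart k a
        = (k b - k a) - ∑' s : Ioc a b, jump k s := by
      simp only [_root_.contPart, e1]; abel
    rw [e4]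
    have h3 := norm_sub_le (k b - k a) (∑' s : Ioc a b, jump k s)
    simp only [hG]
    linarith
  have hmono : MonotoneOn G univ := fun a _ b _ hab => by
    have := (norm_nonneg _).trans (key a b hab); linarith
  intro a b ha hb
  refine ne_top_of_le_ne_top (hmono.locallyBoundedVariationOn a b ha hb) ?_
  refine iSup_mono fun p => Finset.sum_le_sum fun i _ => ?_
  have hle := p.2.2.1 (Nat.le_succ i)
  have := key _ _ hle
  rw [edist_dist, edist_dist]
  refine ENNReal.ofReal_le_ofReal ?_
  rw [dist_eq_norm, Real.dist_eq]
  exact this.trans (le_abs_self _)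

/-- The Lebesgue–Stieltjes integral `∫_{(s, t]} ⟨f_u, dg_u⟩` against a path `g` of locally bounded
variation, i.e. the integral against the vector measure on `(s, t]` that gives mass
`g_{b+} - g_{a+}` to `(a, b]` (computed from the path stopped at `t`, which has the same increments
on `[0, t]` and has finite variation). -/
noncomputable def stieltjesIntegral {E : Type*} [NormedAddCommGroup E] [InnerProductSpace ℝ E]
    [CompleteSpace E] (f g : ℝ≥0 → E) (hg : LocallyBoundedVariationOn g univ) (s t : ℝ≥0) : ℝ :=
  (((hg.stopped t).vectorMeasure).restrict (Ioc s t)).integral f (innerSL ℝ)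

/-! ### The Skorokhod problem -/

/-- `(x, k)` solves the deterministic Skorokhod problem `x + k = y` associated with the operator
`A` and the generalized projection `p`. -/
structure IsSkorokhodSolution {E : Type*} [NormedAddCommGroup E] [InnerProductSpace ℝ E]
    [CompleteSpace E] (A : E → Set E) (p : E → E) (y x k : ℝ≥0 → E) : Prop where
  cadlag_x : IsCadlag x
  cadlag_k : IsCadlag k
  add_eq : ∀ t, x t + k t = y t
  mem_closure : ∀ t, x t ∈ closure (opDomain A)
  bv : LocallyBoundedVariationOn k univ
  k_zero : k 0 = 0
  /-- `∫_s^t ⟨x_u - α, dk^c_u - β du⟩ ≥ 0` for all `(α, β)` in the graph of `A`. -/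
  integral_nonneg : ∀ α β, β ∈ A α → ∀ s t : ℝ≥0, s < t →
    0 ≤ stieltjesIntegral (fun u => x u - α) (contPart k) bv.contPart s t
      - ∫ u in (s : ℝ)..(t : ℝ), inner ℝ (x u.toNNReal - α) β
  jump_eq : ∀ t, 0 < ‖jump k t‖ → x t = p (Function.leftLim x t + jump y t)

/-- `(X, K)` is a solution of the stochastic equation `X + K = Y`, `X_0 = Y_0`, associated with `A`
and `p`: both processes are adapted and have almost surely càdlàg paths, and almost every pair of
paths solves the deterministic Skorokhod problem driven by the path of `Y`
(this contains `X_0 = Y_0`). -/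
structure IsStochasticSkorokhodSolution {Ω E : Type*} {mΩ : MeasurableSpace Ω}
    [NormedAddCommGroup E] [InnerProductSpace ℝ E] [CompleteSpace E] [MeasurableSpace E]
    (P : Measure Ω) (F : Filtration ℝ≥0 mΩ) (A : E → Set E) (p : E → E)
    (Y X K : ℝ≥0 → Ω → E) : Prop where
  adapted_X : Adapted F X
  adapted_K : Adapted F K
  cadlag_X : ∀ᵐ ω ∂P, IsCadlag fun t => X t ω
  cadlag_K : ∀ᵐ ω ∂P, IsCadlag fun t => K t ω
  solves : ∀ᵐ ω ∂P,
    IsSkorokhodSolution A p (fun t => Y t ω) (fun t => X t ω) (fun t => K t ω)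

/-! The problem is solved path by path; adaptedness then follows from uniqueness.

Uniqueness. For two solutions with the same `y`, put `κ = k - k' = x' - x`; then `‖κ‖²` cannot grow.
Between jumps, both variational inequalities are tested at one graph point `(α, β)` close to the
midpoint `m` of `x` and `x'` and such that `0 ≤ ⟨m - α, β⟩`; their sum says `⟨κ, dκ⟩ ≤ 0` up to
arbitrarily small errors. At jumps, `p` is non-expansive. Only the driver on `[0, T]` matters
(`IsSkorokhodSolution.eq_of_eq_on`).

Existence. Minty's theorem provides resolvents of `A`, and iterating them with dyadic steps
converges to a contraction semigroup `opFlow`. For a step driver, the solution follows the semigroup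
between the steps and is sent through `p` at the steps. Contractivity of both gives `‖k - k'‖² ≤ 2
sup ‖y - y'‖ (Var k + Var k')` (`IsStepSolution.norm_sub_sq_le`), so step approximations of a càdlàg
path converge locally uniformly once their variations are bounded. That bound is where the interior
of the domain enters: testing at points `a ± r e_j` around an interior point `a` controls the
increments of `k` in every direction (`IsMaximalMonotone.exists_variation_bound`,
`IsMaximalMonotone.exists_pathVar_le`). The variational inequality survives the limit in an
integrated form (`IsStepSolution.variational_ineq`).

Differential and Stieltjes inequalities are globalised by real induction,
`le_of_forall_eventually_le`: an inequality immediately to the right of each time, and no loss at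
left limits.

Adaptedness. The solution is a pointwise limit of explicit measurable functions of the whole path.
Driving the problem by the path stopped at `T` makes this limit measurable for the information at
time `T`, and uniqueness up to `T` identifies its value at `T` with that of the original solution.
-/

set_option linter.unusedSectionVars false

/-! ### Real induction on the half-line. -/

section RealInduction

/-- Real induction: a real function on `[a, b]` which does not decrease immediately to the right of
any point, and does not jump down when coming from the left, satisfies `f a ≤ f b`. -/
theorem le_of_forall_eventually_le {f : ℝ≥0 → ℝ} {a b : ℝ≥0} (hab : a ≤ b)
    (hR : ∀ t, a ≤ t → t < b → ∀ᶠ s in 𝓝[>] t, f t ≤ f s)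
    (hL : ∀ t, a < t → t ≤ b → ∀ η > 0, ∀ᶠ s in 𝓝[<] t, f s ≤ f t + η) : f a ≤ f b := by
  set S : Set ℝ≥0 := {t | a ≤ t ∧ t ≤ b ∧ ∀ u, a ≤ u → u ≤ t → f a ≤ f u} with hS
  have haS : a ∈ S := ⟨le_rfl, hab, fun u h1 h2 => (le_antisymm h1 h2) ▸ le_rfl⟩
  have hbd : BddAbove S := ⟨b, fun t ht => ht.2.1⟩
  set c := sSup S with hc
  have hac : a ≤ c := le_csSup hbd haS
  have hcb : c ≤ b := csSup_le ⟨a, haS⟩ fun t ht => ht.2.1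
  have hlt : ∀ u, a ≤ u → u < c → f a ≤ f u := fun u h1 h2 => by
    obtain ⟨t, ht, hut⟩ := exists_lt_of_lt_csSup ⟨a, haS⟩ h2
    exact ht.2.2 u h1 hut.le
  have hfc : f a ≤ f c := by
    rcases hac.eq_or_lt with h | h
    · rw [← h]
    · refine le_of_forall_pos_le_add fun η hη => ?_
      have h1 : ∀ᶠ s in 𝓝[<] c, a < s := by
        filter_upwards [Ioo_mem_nhdsLT h] with s hs using hs.1
      have : (𝓝[<] c).NeBot := nhdsLT_neBot_of_exists_lt ⟨a, h⟩
      obtain ⟨s, hs1, hs2, hs3⟩ := (h1.and ((hL c h hcb η hη).and self_mem_nhdsWithin)).exists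
      exact (hlt s hs1.le hs3).trans hs2
  rcases hcb.eq_or_lt with h | h
  · rwa [← h]
  · exfalso
    obtain ⟨d, hcd, hd⟩ := (mem_nhdsGT_iff_exists_Ioo_subset' h).1 (hR c hac h)
    set e := min ((c + d) / 2) b
    have hce : c < e := lt_min (by
      rw [← NNReal.coe_lt_coe]; push_cast
      have : (c : ℝ) < d := hcd
      linarith) h
    have hed : e < d := lt_of_le_of_lt (min_le_left _ _) (by
      rw [← NNReal.coe_lt_coe]; push_cast
      have : (c : ℝ) < d := hcd
      linarith)
    have : e ∈ S := by
      refine ⟨hac.trans hce.le, min_le_right _ _, fun u h1 h2 => ?_⟩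
      rcases lt_trichotomy u c with h3 | h3 | h3
      · exact hlt u h1 h3
      · rw [h3]; exact hfc
      · exact hfc.trans (hd ⟨h3, h2.trans_lt hed⟩)
    exact absurd (le_csSup hbd this) (not_le.mpr hce)

/-- Real induction for predicates. -/
theorem forall_of_right_of_left {P : ℝ≥0 → Prop} (h0 : P 0) (hmono : ∀ s t, s ≤ t → P t → P s)
    (hR : ∀ t, P t → ∃ s > t, P s) (hL : ∀ t > 0, (∀ s < t, P s) → P t) (t : ℝ≥0) : P t := by
  by_contra ht
  set S : Set ℝ≥0 := {s | P s}
  have hne : S.Nonempty := ⟨0, h0⟩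
  have hbd : BddAbove S := ⟨t, fun s hs => by
    by_contra h; exact ht (hmono _ _ (not_le.mp h).le hs)⟩
  have hlt : ∀ s < sSup S, P s := fun s hs => by
    obtain ⟨u, hu, hsu⟩ := exists_lt_of_lt_csSup hne hs
    exact hmono _ _ hsu.le hu
  have hc : P (sSup S) := by
    rcases eq_or_ne (sSup S) 0 with h | h
    · rw [h]; exact h0
    · exact hL _ (pos_iff_ne_zero.mpr h) hlt
  obtain ⟨s, hs, hPs⟩ := hR _ hc
  exact absurd (le_csSup hbd hPs) (not_le.mpr hs)

end RealInduction

/-! ### Variation of a path as a function of time. -/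

section PathVariation

variable {E : Type*} [NormedAddCommGroup E]

/-- The variation of the path `k` on `[0, t]`. -/
noncomputable def pathVar (k : ℝ≥0 → E) (t : ℝ≥0) : ℝ := variationOnFromTo k univ 0 t

theorem pathVar_zero (k : ℝ≥0 → E) : pathVar k 0 = 0 := variationOnFromTo.self _ _ _

theorem pathVar_nonneg (k : ℝ≥0 → E) (t : ℝ≥0) : 0 ≤ pathVar k t :=
  variationOnFromTo.nonneg_of_le _ _ zero_le

theorem pathVar_sub {k : ℝ≥0 → E} (hk : LocallyBoundedVariationOn k univ) {s t : ℝ≥0}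
    (hst : s ≤ t) : pathVar k t - pathVar k s = (eVariationOn k (Icc s t)).toReal := by
  rw [pathVar, pathVar, variationOnFromTo.sub_right hk (mem_univ _) (mem_univ _) (mem_univ _),
    variationOnFromTo.eq_of_le _ _ hst, univ_inter]

theorem pathVar_mono {k : ℝ≥0 → E} (hk : LocallyBoundedVariationOn k univ) :
    Monotone (pathVar k) := fun s t hst => by
  have := pathVar_sub hk hst
  have := ENNReal.toReal_nonneg (a := eVariationOn k (Icc s t))
  linarith

theorem LocallyBoundedVariationOn.ne_top_Icc {k : ℝ≥0 → E}
    (hk : LocallyBoundedVariationOn k univ) (s t : ℝ≥0) : eVariationOn k (Icc s t) ≠ ⊤ := by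
  have := hk s t (mem_univ _) (mem_univ _)
  rwa [univ_inter] at this

theorem norm_sub_le_pathVar {k : ℝ≥0 → E} (hk : LocallyBoundedVariationOn k univ) {s t : ℝ≥0}
    (hst : s ≤ t) : ‖k t - k s‖ ≤ pathVar k t - pathVar k s := by
  rw [pathVar_sub hk hst, ← dist_eq_norm, dist_edist]
  exact ENNReal.toReal_mono (hk.ne_top_Icc s t)
    (eVariationOn.edist_le _ ⟨hst, le_rfl⟩ ⟨le_rfl, hst⟩)

/-- Variation bounds for solutions and for the semigroup are obtained in this way, by finding one
real function whose increments dominate those of the path. -/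
theorem eVariationOn_le_of_norm_sub_le {k : ℝ≥0 → E} {H : ℝ≥0 → ℝ} {s t : ℝ≥0} (hst : s ≤ t)
    (h : ∀ u v, s ≤ u → u ≤ v → v ≤ t → ‖k v - k u‖ ≤ H v - H u) :
    eVariationOn k (Icc s t) ≤ ENNReal.ofReal (H t - H s) := by
  have hmono : MonotoneOn H (Icc s t) := fun a ha b hb hab => by
    have := (norm_nonneg _).trans (h a b ha.1 hab hb.2); linarith
  have h1 := (hmono.eVariationOn_eq (a := s) (b := t) ⟨le_rfl, hst⟩ ⟨hst, le_rfl⟩).le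
  rw [inter_self] at h1
  refine le_trans (iSup_mono fun p => Finset.sum_le_sum fun i _ => ?_) h1
  have := h _ _ (p.2.2.2 i).1 (p.2.2.1 (Nat.le_succ i)) (p.2.2.2 (i + 1)).2
  rw [edist_dist, edist_dist]
  refine ENNReal.ofReal_le_ofReal ?_
  rw [dist_eq_norm, Real.dist_eq]
  exact this.trans (le_abs_self _)

theorem locallyBoundedVariationOn_of_norm_sub_le {k : ℝ≥0 → E} {H : ℝ≥0 → ℝ}
    (h : ∀ u v, u ≤ v → ‖k v - k u‖ ≤ H v - H u) : LocallyBoundedVariationOn k univ := by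
  intro a b _ _
  rw [univ_inter]
  rcases le_total a b with hab | hab
  · exact ne_top_of_le_ne_top ENNReal.ofReal_ne_top
      (eVariationOn_le_of_norm_sub_le hab fun u v _ huv _ => h u v huv)
  · refine BoundedVariationOn.of_subsingleton fun x hx y hy => ?_
    exact le_antisymm (hx.2.trans (hab.trans hy.1)) (hy.2.trans (hab.trans hx.1))

theorem pathVar_sub_le {k : ℝ≥0 → E} (hk : LocallyBoundedVariationOn k univ) {H : ℝ≥0 → ℝ}
    {s t : ℝ≥0} (hst : s ≤ t)
    (h : ∀ u v, s ≤ u → u ≤ v → v ≤ t → ‖k v - k u‖ ≤ H v - H u) :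
    pathVar k t - pathVar k s ≤ H t - H s := by
  rw [pathVar_sub hk hst]
  refine ENNReal.toReal_le_of_le_ofReal ?_ (eVariationOn_le_of_norm_sub_le hst h)
  exact (norm_nonneg _).trans (h s t le_rfl hst le_rfl)

theorem pathVar_tendsto_left {k : ℝ≥0 → E} (hk : LocallyBoundedVariationOn k univ) {t : ℝ≥0} {l : E}
    (h : Tendsto k (𝓝[<] t) (𝓝 l)) :
    Tendsto (pathVar k) (𝓝[<] t) (𝓝 (pathVar k t - dist (k t) l)) := by
  have := variationOnFromTo.tendsto_left (mem_univ 0) (mem_univ t) hk (by simpa using h)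
  simpa using! this

theorem LocallyBoundedVariationOn.exists_tendsto_nhdsLT [CompleteSpace E] {k : ℝ≥0 → E}
    (hk : LocallyBoundedVariationOn k univ) (t : ℝ≥0) : ∃ l, Tendsto k (𝓝[<] t) (𝓝 l) := by
  have hb : BoundedVariationOn k (Icc 0 t) := hk.ne_top_Icc 0 t
  obtain ⟨l, hl⟩ := hb.exists_tendsto_left t
  refine ⟨l, ?_⟩
  have : Icc 0 t ∩ Iio t = Iio t := by
    ext x; constructor
    · exact fun h => h.2
    · exact fun h => ⟨⟨zero_le, le_of_lt h⟩, h⟩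
  rwa [this] at hl

end PathVariation

/-! ### Minty's theorem, resolvents and midpoints of the domain. -/

section Minty

variable {E : Type*} [NormedAddCommGroup E] [InnerProductSpace ℝ E]

theorem nonneg_of_forall_quadratic_nonneg {a b : ℝ}
    (h : ∀ t : ℝ, 0 < t → t ≤ 1 → 0 ≤ t * a + t ^ 2 * b) : 0 ≤ a := by
  have h1 : ∀ᶠ t : ℝ in 𝓝[>] 0, 0 ≤ a + t * b := by
    filter_upwards [Ioc_mem_nhdsGT (zero_lt_one' ℝ)] with t ht
    have := h t ht.1 ht.2
    have h2 : 0 ≤ t * (a + t * b) := by linarith [this]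
    exact nonneg_of_mul_nonneg_right h2 ht.1
  have h2 : Tendsto (fun t : ℝ => a + t * b) (𝓝[>] 0) (𝓝 (a + 0 * b)) :=
    ((continuous_const.add (continuous_id.mul continuous_const)).tendsto 0).mono_left
      nhdsWithin_le_nhds
  simpa using ge_of_tendsto h2 h1

/-- The Fitzpatrick inequality: an upper bound of the Fitzpatrick function dominates the pairing. -/
theorem IsMaximalMonotone.inner_le_of_fitzpatrick_le {A : E → Set E} (hA : IsMaximalMonotone A)
    {z y : E} {r : ℝ}
    (h : ∀ a b, b ∈ A a → inner ℝ z b + inner ℝ a y - inner ℝ a b ≤ r) : inner ℝ z y ≤ r := by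
  by_contra hr
  push Not at hr
  have key : ∀ a b, b ∈ A a → 0 < inner ℝ (y - b) (z - a) := fun a b hab => by
    have := h a b hab
    simp only [inner_sub_left, inner_sub_right]
    rw [real_inner_comm z y, real_inner_comm a y, real_inner_comm z b, real_inner_comm a b]
    linarith
  -- Maximality puts `(z, y)` itself in the graph, where `key` reads `0 < 0`.
  have hmem := hA.maximal z y fun a b hab => (key a b hab).le
  simpa using key z y hmem

theorem IsMaximalMonotone.exists_mem_graph {A : E → Set E} (hA : IsMaximalMonotone A) :
    ∃ a b, b ∈ A a := by
  by_contra h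
  push Not at h
  exact h 0 0 (hA.maximal 0 0 fun u v huv => absurd huv (h u v))

/-- Minty's theorem at the origin: `0 ∈ z + A z` has a solution. -/
theorem IsMaximalMonotone.exists_neg_mem [FiniteDimensional ℝ E] {A : E → Set E}
    (hA : IsMaximalMonotone A) : ∃ z, -z ∈ A z := by
  obtain ⟨a₀, b₀, h₀⟩ := hA.exists_mem_graph
  have : ProperSpace E := FiniteDimensional.proper ℝ E
  -- The epigraph of the Fitzpatrick function of `A`, over which the convex function `f` is
  -- minimised.
  set Epi : Set (E × E × ℝ) :=
    {w | ∀ a b, b ∈ A a → inner ℝ w.1 b + inner ℝ a w.2.1 - inner ℝ a b ≤ w.2.2} with hEpi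
  set f : E × E × ℝ → ℝ := fun w => ‖w.1‖ ^ 2 / 2 + ‖w.2.1‖ ^ 2 / 2 + w.2.2 with hf
  have hgr : ∀ a b, b ∈ A a → (a, b, inner ℝ a b) ∈ Epi := fun a b hab a' b' hab' => by
    have := hA.monotone a b a' b' hab hab'
    simp only [inner_sub_left, inner_sub_right] at this
    rw [real_inner_comm a b, real_inner_comm a' b, real_inner_comm a b',
      real_inner_comm a' b'] at this
    simp only
    linarith
  have hfc : Continuous f := by fun_prop
  have hclosed : IsClosed Epi := by
    simp only [hEpi, ofPred_forall]
    refine isClosed_iInter fun a => isClosed_iInter fun b => isClosed_iInter fun _ => ?_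
    exact isClosed_le (by fun_prop) (by fun_prop)
  set w₀ : E × E × ℝ := (a₀, b₀, inner ℝ a₀ b₀)
  set K : Set (E × E × ℝ) := Epi ∩ {w | f w ≤ f w₀} with hK
  have hKc : IsClosed K := hclosed.inter (isClosed_le hfc continuous_const)
  -- One graph point `(a₀, b₀)` bounds the third coordinate below by an affine function of the first
  -- two, so the quadratic part of `f` makes it coercive.
  have hKb : Bornology.IsBounded K := by
    set M := ‖b₀‖ + ‖a₀‖ with hM
    set C := f w₀ + |inner ℝ a₀ b₀| with hC
    have hM0 : 0 ≤ M := by positivity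
    set R := 4 * M + 2 * |C| + 2 with hR
    have hR0 : 0 ≤ R := by positivity
    have hbd : ∀ w ∈ K, ‖w.1‖ ≤ R ∧ ‖w.2.1‖ ≤ R ∧ |w.2.2| ≤ R * M + |C| := by
      intro w hw
      have h1 := hw.1 a₀ b₀ h₀
      have h2 : ‖w.1‖ ^ 2 / 2 + ‖w.2.1‖ ^ 2 / 2 + w.2.2 ≤ f w₀ := hw.2
      have h3 := abs_real_inner_le_norm w.1 b₀
      have h4 := abs_real_inner_le_norm a₀ w.2.1
      have h5 := neg_abs_le (inner ℝ w.1 b₀)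
      have h6 := neg_abs_le (inner ℝ a₀ w.2.1)
      have h7 := le_abs_self (inner ℝ a₀ b₀)
      have n1 := norm_nonneg w.1
      have n2 := norm_nonneg w.2.1
      have n3 := norm_nonneg a₀
      have n4 := norm_nonneg b₀
      have hCa := le_abs_self C
      have e1 : ‖w.1‖ * ‖b₀‖ ≤ ‖w.1‖ * M := by gcongr; linarith
      have e2 : ‖a₀‖ * ‖w.2.1‖ ≤ ‖w.2.1‖ * M := by rw [mul_comm]; gcongr; linarith
      have main : ‖w.1‖ ^ 2 / 2 + ‖w.2.1‖ ^ 2 / 2 - ‖w.1‖ * M - ‖w.2.1‖ * M ≤ |C| := by linarith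
      have hC0 := abs_nonneg C
      have k1 : ‖w.1‖ ≤ R := by
        by_contra hh
        push Not at hh
        have t1 : (‖w.2.1‖ - M) ^ 2 ≥ 0 := sq_nonneg _
        have t2 : R * (M + |C| + 1) ≤ ‖w.1‖ * (‖w.1‖ / 2 - M) :=
          mul_le_mul hh.le (by linarith) (by positivity) (by positivity)
        have t3 := mul_nonneg hM0 hC0
        have t4 := mul_nonneg hM0 hM0
        have t5 := mul_nonneg hC0 hC0
        rw [hR] at t2
        nlinarith
      have k2 : ‖w.2.1‖ ≤ R := by
        by_contra hh
        push Not at hh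
        have t1 : (‖w.1‖ - M) ^ 2 ≥ 0 := sq_nonneg _
        have t2 : R * (M + |C| + 1) ≤ ‖w.2.1‖ * (‖w.2.1‖ / 2 - M) :=
          mul_le_mul hh.le (by linarith) (by positivity) (by positivity)
        have t3 := mul_nonneg hM0 hC0
        have t4 := mul_nonneg hM0 hM0
        have t5 := mul_nonneg hC0 hC0
        rw [hR] at t2
        nlinarith
      refine ⟨k1, k2, abs_le.mpr ⟨?_, ?_⟩⟩
      · have e3 : ‖w.1‖ * ‖b₀‖ ≤ R * ‖b₀‖ := by gcongr
        have e4 : ‖a₀‖ * ‖w.2.1‖ ≤ R * ‖a₀‖ := by rw [mul_comm]; gcongr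
        have e5 : R * M = R * ‖b₀‖ + R * ‖a₀‖ := by rw [hM]; ring
        have hfw : 0 ≤ f w₀ - inner ℝ a₀ b₀ := by
          have : f w₀ - inner ℝ a₀ b₀ = ‖a₀‖ ^ 2 / 2 + ‖b₀‖ ^ 2 / 2 := by simp [hf, w₀]
          rw [this]; positivity
        have h8 := neg_abs_le (inner ℝ a₀ b₀)
        linarith
      · have : 0 ≤ R * M := by positivity
        have h8 := abs_nonneg (inner ℝ a₀ b₀)
        have : 0 ≤ ‖w.1‖ ^ 2 / 2 + ‖w.2.1‖ ^ 2 / 2 := by positivity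
        linarith
    refine (Metric.isBounded_closedBall (x := (0 : E × E × ℝ)) (r := R + (R * M + |C|))).subset ?_
    intro w hw
    obtain ⟨k1, k2, k3⟩ := hbd w hw
    have : 0 ≤ R * M + |C| := by positivity
    rw [mem_closedBall_zero_iff, Prod.norm_def, Prod.norm_def, Real.norm_eq_abs]
    exact max_le (by linarith) (max_le (by linarith) (by linarith))
  have hKcomp : IsCompact K := Metric.isCompact_of_isClosed_isBounded hKc hKb
  obtain ⟨⟨z, y, r⟩, hwK, hmin⟩ :=
    hKcomp.exists_isMinOn ⟨w₀, hgr _ _ h₀, show f w₀ ≤ f w₀ from le_rfl⟩ hfc.continuousOn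
  have hminE : ∀ w ∈ Epi, f (z, y, r) ≤ f w := fun w hw => by
    rcases le_or_gt (f w) (f w₀) with h | h
    · exact hmin ⟨hw, h⟩
    · exact hwK.2.trans h.le
  have hzr : inner ℝ z y ≤ r := hA.inner_le_of_fitzpatrick_le hwK.1
  -- First-order optimality along the segment towards `(a, b, ⟨a, b⟩)`, a point of the convex set
  -- `Epi` by monotonicity.
  have hopt : ∀ a b, b ∈ A a →
      0 ≤ inner ℝ z (a - z) + inner ℝ y (b - y) + (inner ℝ a b - r) := by
    intro a b hab
    refine nonneg_of_forall_quadratic_nonneg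
      (b := ‖a - z‖ ^ 2 / 2 + ‖b - y‖ ^ 2 / 2) fun t ht0 ht1 => ?_
    have hmem : (z + t • (a - z), y + t • (b - y), r + t * (inner ℝ a b - r)) ∈ Epi := by
      intro a' b' hab'
      have h1 := hwK.1 a' b' hab'
      have h2 := hgr a b hab a' b' hab'
      simp only [inner_add_left, inner_add_right, inner_smul_left, inner_smul_right,
        inner_sub_left, inner_sub_right, RCLike.conj_to_real] at h1 h2 ⊢
      nlinarith
    have h3 := hminE _ hmem
    simp only [hf, norm_add_sq_real, inner_smul_right, norm_smul, Real.norm_eq_abs, abs_of_pos ht0,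
      mul_pow] at h3
    linarith
  have hkey : ∀ a b, b ∈ A a → ‖z + y‖ ^ 2 ≤ inner ℝ (-z - b) (-y - a) := by
    intro a b hab
    have h1 := hopt a b hab
    rw [norm_add_sq_real]
    simp only [inner_sub_left, inner_sub_right, inner_neg_left, inner_neg_right,
      real_inner_self_eq_norm_sq] at h1 ⊢
    rw [real_inner_comm y b, real_inner_comm a b]
    linarith
  -- `(-y, -z)` is related to the whole graph, hence belongs to it; testing `hkey` at this very
  -- point then forces `z + y = 0`.
  have hmem := hA.maximal (-y) (-z) fun a b hab => (sq_nonneg _).trans (hkey a b hab)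
  have h0 := hkey _ _ hmem
  simp only [sub_self, inner_zero_left] at h0
  have hzy : z + y = 0 := by
    rw [← norm_eq_zero]; exact pow_eq_zero_iff two_ne_zero |>.1 (le_antisymm h0 (sq_nonneg _))
  refine ⟨z, ?_⟩
  rwa [show -y = z from (eq_neg_of_add_eq_zero_left hzy).symm] at hmem

/-- Minty's theorem: `x ∈ z + h A z` has a solution. -/
theorem IsMaximalMonotone.exists_resolvent [FiniteDimensional ℝ E] {A : E → Set E}
    (hA : IsMaximalMonotone A) {h : ℝ} (hh : 0 < h) (x : E) :
    ∃ z, h⁻¹ • (x - z) ∈ A z := by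
  -- The operator `z ↦ h A (z + x)`: Minty's theorem at the origin for it is the resolvent equation
  -- at `x`, after a translation.
  have hB : IsMaximalMonotone fun z => {w | h⁻¹ • w ∈ A (z + x)} := by
    constructor
    · intro z y z' y' hy hy'
      have := hA.monotone _ _ _ _ hy hy'
      rw [← smul_sub, add_sub_add_right_eq_sub, inner_smul_left] at this
      exact nonneg_of_mul_nonneg_right this (by simpa using hh)
    · intro z y hz
      refine hA.maximal _ _ fun u v huv => ?_
      have := hz (u - x) (h • v) (by simpa [smul_smul, inv_mul_cancel₀ hh.ne'] using huv)
      have e : h⁻¹ • y - v = h⁻¹ • (y - h • v) := by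
        rw [smul_sub, smul_smul, inv_mul_cancel₀ hh.ne', one_smul]
      rw [e, inner_smul_left, show z + x - u = z - (u - x) by abel]
      exact mul_nonneg (by simpa using hh.le) this
  obtain ⟨z, hz⟩ := hB.exists_neg_mem
  exact ⟨z + x, by simpa using hz⟩

/-- The range of a generalized projection contains the midpoints of its points. -/
theorem IsGeneralizedProjection.midpoint_mem {D : Set E} {p : E → E}
    (hp : IsGeneralizedProjection D p) {x y : E} (hx : x ∈ D) (hy : y ∈ D) :
    (2⁻¹ : ℝ) • (x + y) ∈ D := by
  set m := (2⁻¹ : ℝ) • (x + y) with hm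
  have h1 := hp.nonexpansive m x
  have h2 := hp.nonexpansive m y
  rw [hp.eq_self x hx] at h1
  rw [hp.eq_self y hy] at h2
  have e1 : m - x = (2⁻¹ : ℝ) • (y - x) := by rw [hm]; module
  have e2 : m - y = -((2⁻¹ : ℝ) • (y - x)) := by rw [hm]; module
  rw [e1] at h1
  rw [e2, norm_neg] at h2
  have e3 := parallelogram_law_with_norm ℝ (p m - x) (p m - y)
  have e4 : p m - x + (p m - y) = (2 : ℝ) • (p m - m) := by rw [hm]; module
  have e5 : p m - x - (p m - y) = (2 : ℝ) • ((2⁻¹ : ℝ) • (y - x)) := by module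
  rw [e4, e5, norm_smul, norm_smul 2 ((2⁻¹ : ℝ) • (y - x))] at e3
  simp only [Real.norm_ofNat] at e3
  -- `p m` is within `‖y - x‖ / 2` of both `x` and `y`, and the parallelogram law leaves only the
  -- midpoint.
  have h3 : ‖p m - m‖ = 0 := by
    have n1 := norm_nonneg (p m - x)
    have n2 := norm_nonneg (p m - y)
    have n3 := norm_nonneg (p m - m)
    nlinarith
  rw [norm_eq_zero, sub_eq_zero] at h3
  rw [← h3]
  exact hp.mem m

open Classical in
/-- The resolvent `(1 + h A)⁻¹` (equal to the identity for `h = 0`). -/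
noncomputable def opResolvent (A : E → Set E) (h : ℝ) (x : E) : E :=
  if hz : ∃ z, h⁻¹ • (x - z) ∈ A z then hz.choose else x

variable [FiniteDimensional ℝ E] {A : E → Set E}

theorem IsMaximalMonotone.resolvent_mem (hA : IsMaximalMonotone A) {h : ℝ} (hh : 0 < h) (x : E) :
    h⁻¹ • (x - opResolvent A h x) ∈ A (opResolvent A h x) := by
  have := hA.exists_resolvent hh x
  rw [opResolvent, dif_pos this]
  exact this.choose_spec

theorem IsMaximalMonotone.resolvent_mem_opDomain (hA : IsMaximalMonotone A) {h : ℝ} (hh : 0 < h)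
    (x : E) : opResolvent A h x ∈ opDomain A := ⟨_, hA.resolvent_mem hh x⟩

/-- The resolvent is nonexpansive. -/
theorem IsMaximalMonotone.norm_resolvent_sub_le (hA : IsMaximalMonotone A) {h : ℝ} (hh : 0 < h)
    (x x' : E) : ‖opResolvent A h x - opResolvent A h x'‖ ≤ ‖x - x'‖ := by
  have h1 := hA.monotone _ _ _ _ (hA.resolvent_mem hh x) (hA.resolvent_mem hh x')
  set z := opResolvent A h x
  set z' := opResolvent A h x'
  rw [← smul_sub, inner_smul_left] at h1
  have h2 : 0 ≤ inner ℝ (x - z - (x' - z')) (z - z') :=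
    nonneg_of_mul_nonneg_right h1 (by simpa using hh)
  have h3 : ‖z - z'‖ * ‖z - z'‖ ≤ inner ℝ (x - x') (z - z') := by
    rw [← real_inner_self_eq_norm_mul_norm]
    have : x - z - (x' - z') = (x - x') - (z - z') := by abel
    rw [this, inner_sub_left] at h2
    linarith
  have h4 := h3.trans (real_inner_le_norm _ _)
  rcases (norm_nonneg (z - z')).eq_or_lt with h5 | h5
  · rw [← h5]; exact norm_nonneg _
  · exact le_of_mul_le_mul_right h4 h5

/-- The displacement of the resolvent at a point of the domain. -/
theorem IsMaximalMonotone.norm_sub_resolvent_le (hA : IsMaximalMonotone A) {h : ℝ} (hh : 0 < h)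
    {x b : E} (hb : b ∈ A x) : ‖x - opResolvent A h x‖ ≤ h * ‖b‖ := by
  have h1 := hA.monotone _ _ _ _ hb (hA.resolvent_mem hh x)
  set z := opResolvent A h x
  rw [inner_sub_left, inner_smul_left, real_inner_self_eq_norm_mul_norm] at h1
  have h1' : h⁻¹ * (‖x - z‖ * ‖x - z‖) ≤ ‖b‖ * ‖x - z‖ := by
    have := real_inner_le_norm b (x - z)
    simp only [RCLike.conj_to_real] at h1
    linarith
  rcases (norm_nonneg (x - z)).eq_or_lt with h5 | h5
  · rw [← h5]; positivity
  · rw [← mul_assoc] at h1'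
    have := le_of_mul_le_mul_right h1' h5
    rwa [inv_mul_le_iff₀ hh] at this

/-- The resolvent decreases the minimal norm of the values of `A`. -/
theorem IsMaximalMonotone.norm_yosida_le (hA : IsMaximalMonotone A) {h : ℝ} (hh : 0 < h)
    {x b : E} (hb : b ∈ A x) : ‖h⁻¹ • (x - opResolvent A h x)‖ ≤ ‖b‖ := by
  rw [norm_smul, norm_inv, Real.norm_eq_abs, abs_of_pos hh, inv_mul_le_iff₀ hh]
  exact hA.norm_sub_resolvent_le hh hb

/-- Points of the closure of the domain are approximated by points of the graph lying on the
side of the point where the operator pushes. -/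
theorem IsMaximalMonotone.exists_mem_near (hA : IsMaximalMonotone A) {m : E}
    (hm : m ∈ closure (opDomain A)) {ε : ℝ} (hε : 0 < ε) :
    ∃ a b, b ∈ A a ∧ ‖m - a‖ ≤ ε ∧ 0 ≤ inner ℝ (m - a) b := by
  obtain ⟨z, ⟨b, hb⟩, hz⟩ := Metric.mem_closure_iff.1 hm (ε / 3) (by positivity)
  rw [dist_eq_norm] at hz
  set h : ℝ := ε / 3 / (‖b‖ + 1) with hh'
  have hh : 0 < h := by positivity
  have h1 : h * ‖b‖ ≤ ε / 3 := by
    rw [hh', div_mul_eq_mul_div, div_le_iff₀ (by positivity)]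
    nlinarith [norm_nonneg b]
  -- At the resolvent point `a` the chosen value of `A` is `h⁻¹ • (m - a)`, which gives the sign.
  refine ⟨opResolvent A h m, _, hA.resolvent_mem hh m, ?_, ?_⟩
  · have h2 := hA.norm_sub_resolvent_le hh hb
    have h3 := hA.norm_resolvent_sub_le hh z m
    rw [norm_sub_rev z m] at h3
    have e : m - opResolvent A h m
        = (m - z) + (z - opResolvent A h z) + (opResolvent A h z - opResolvent A h m) := by abel
    rw [e]
    refine (norm_add₃_le).trans ?_
    linarith
  · rw [inner_smul_right, real_inner_self_eq_norm_sq]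
    positivity

end Minty

/-! ### The contraction semigroup, as a limit of implicit Euler schemes. -/

section Flow

variable {E : Type*} [NormedAddCommGroup E] [InnerProductSpace ℝ E] [FiniteDimensional ℝ E]
  {A : E → Set E}

theorem IsMaximalMonotone.norm_iterate_sub_le (hA : IsMaximalMonotone A) {h : ℝ} (hh : 0 < h)
    (n : ℕ) (x x' : E) : ‖(opResolvent A h)^[n] x - (opResolvent A h)^[n] x'‖ ≤ ‖x - x'‖ := by
  induction n with
  | zero => simp
  | succ n ih =>
    rw [Function.iterate_succ_apply', Function.iterate_succ_apply']
    exact (hA.norm_resolvent_sub_le hh _ _).trans ih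

theorem IsMaximalMonotone.exists_mem_iterate (hA : IsMaximalMonotone A) {h : ℝ} (hh : 0 < h)
    {x b : E} (hb : b ∈ A x) (n : ℕ) : ∃ c ∈ A ((opResolvent A h)^[n] x), ‖c‖ ≤ ‖b‖ := by
  induction n with
  | zero => exact ⟨b, hb, le_rfl⟩
  | succ n ih =>
    obtain ⟨c, hc, hcb⟩ := ih
    rw [Function.iterate_succ_apply']
    exact ⟨_, hA.resolvent_mem hh _, (hA.norm_yosida_le hh hc).trans hcb⟩

theorem IsMaximalMonotone.norm_iterate_add_sub_le (hA : IsMaximalMonotone A) {h : ℝ} (hh : 0 < h)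
    {x b : E} (hb : b ∈ A x) (n k : ℕ) :
    ‖(opResolvent A h)^[n + k] x - (opResolvent A h)^[n] x‖ ≤ k * (h * ‖b‖) := by
  induction k with
  | zero => simp
  | succ k ih =>
    obtain ⟨c, hc, hcb⟩ := hA.exists_mem_iterate hh hb (n + k)
    have h1 := hA.norm_sub_resolvent_le hh hc
    rw [norm_sub_rev, ← Function.iterate_succ_apply' (opResolvent A h)] at h1
    have h2 : h * ‖c‖ ≤ h * ‖b‖ := by gcongr
    have h3 := norm_sub_le_norm_sub_add_norm_sub ((opResolvent A h)^[n + (k + 1)] x)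
      ((opResolvent A h)^[n + k] x) ((opResolvent A h)^[n] x)
    push_cast
    rw [← add_assoc n k 1] at h3 ⊢
    linarith

/-- One step of the implicit Euler scheme compared with two half steps. -/
theorem IsMaximalMonotone.norm_resolvent_sub_half_sq_le (hA : IsMaximalMonotone A) {h : ℝ}
    (hh : 0 < h) (a : E) {x b : E} (hb : b ∈ A x) :
    ‖opResolvent A (2 * h) a - opResolvent A h (opResolvent A h x)‖ ^ 2
      ≤ ‖a - x‖ ^ 2 + 4 * h ^ 2 * ‖b‖ ^ 2 := by
  have h2h : 0 < 2 * h := by positivity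
  set a' := opResolvent A (2 * h) a
  set y := opResolvent A h x
  set y' := opResolvent A h y
  set ξ := (2 * h)⁻¹ • (a - a') with hξ
  set η := h⁻¹ • (x - y) with hη
  set η' := h⁻¹ • (y - y') with hη'
  have mξ : ξ ∈ A a' := hA.resolvent_mem h2h a
  have mη : η ∈ A y := hA.resolvent_mem hh x
  have mη' : η' ∈ A y' := hA.resolvent_mem hh y
  have n1 : ‖η‖ ≤ ‖b‖ := hA.norm_yosida_le hh hb
  have n2 : ‖η'‖ ≤ ‖η‖ := hA.norm_yosida_le hh mη
  have m1 := hA.monotone _ _ _ _ mξ mη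
  have m2 := hA.monotone _ _ _ _ mξ mη'
  have m3 := hA.monotone _ _ _ _ mη mη'
  have ea : a = a' + (2 * h) • ξ := by
    rw [hξ, smul_smul, mul_inv_cancel₀ h2h.ne', one_smul]; abel
  have ey : y = y' + h • η' := by
    rw [hη', smul_smul, mul_inv_cancel₀ hh.ne', one_smul]; abel
  have ex : x = y' + h • η' + h • η := by
    rw [← ey, hη, smul_smul, mul_inv_cancel₀ hh.ne', one_smul]; abel
  have e1 : a - x = (a' - y') + h • ((ξ - η) + (ξ - η')) := by
    rw [ea, ex]; module
  rw [e1, norm_add_sq_real, inner_smul_right, inner_add_right]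
  have p1 : inner ℝ (a' - y') (ξ - η) = inner ℝ (ξ - η) (a' - y) + h * inner ℝ (ξ - η) η' := by
    rw [real_inner_comm, ← inner_smul_right, ← inner_add_right]
    congr 1
    rw [ey]; module
  have p2 : inner ℝ (a' - y') (ξ - η') = inner ℝ (ξ - η') (a' - y') := real_inner_comm _ _
  have p3 : ‖h • (ξ - η + (ξ - η'))‖ ^ 2 = h ^ 2 * ‖ξ - η + (ξ - η')‖ ^ 2 := by
    rw [norm_smul, mul_pow, Real.norm_eq_abs, sq_abs]
  have p4 : ξ - η + (ξ - η') = (2 : ℝ) • (ξ - η) + (η - η') := by module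
  have p5 : ‖(2 : ℝ) • (ξ - η) + (η - η')‖ ^ 2
      = 4 * ‖ξ - η‖ ^ 2 + 4 * inner ℝ (ξ - η) (η - η') + ‖η - η'‖ ^ 2 := by
    rw [norm_add_sq_real, norm_smul, inner_smul_left]
    simp only [Real.norm_ofNat, RCLike.conj_to_real]
    ring
  have p9 : inner ℝ (ξ - η) (η - η') = inner ℝ (ξ - η) η - inner ℝ (ξ - η) η' :=
    inner_sub_right _ _ _
  have q1 : |inner ℝ (ξ - η) η| ≤ ‖ξ - η‖ * ‖b‖ :=
    (abs_real_inner_le_norm _ _).trans (by gcongr)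
  have q2 : |inner ℝ (ξ - η) η'| ≤ ‖ξ - η‖ * ‖b‖ :=
    (abs_real_inner_le_norm _ _).trans (by gcongr; exact n2.trans n1)
  have q3 := (abs_le.1 q1).1
  have q4 := (abs_le.1 q2).2
  -- After the monotone pairings are dropped, `h²` times this is what remains to be shown
  -- nonnegative. With `u = ‖ξ - η‖` and `v = ‖b‖` it is at least `4u² - 6uv + 4v²`.
  have q5 : 0 ≤ 4 * ‖ξ - η‖ ^ 2 + 4 * inner ℝ (ξ - η) η - 2 * inner ℝ (ξ - η) η'
      + ‖η - η'‖ ^ 2 + 4 * ‖b‖ ^ 2 := by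
    nlinarith [sq_nonneg (‖ξ - η‖ - ‖b‖), sq_nonneg ‖ξ - η‖, sq_nonneg ‖b‖,
      sq_nonneg ‖η - η'‖]
  rw [p1, p2, p3, p4, p5, p9]
  have q6 := mul_nonneg hh.le m1
  have q7 := mul_nonneg hh.le m2
  have q8 := mul_nonneg (sq_nonneg h) q5
  linarith

/-- Squared errors add up: `O(h²)` per step over `O(1/h)` steps is `O(h)`, so halving the step
displaces the scheme by `O(√h)`. -/
theorem IsMaximalMonotone.norm_iterate_sub_half_sq_le (hA : IsMaximalMonotone A) {h : ℝ}
    (hh : 0 < h) {x b : E} (hb : b ∈ A x) (n : ℕ) :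
    ‖(opResolvent A (2 * h))^[n] x - (opResolvent A h)^[2 * n] x‖ ^ 2
      ≤ n * (4 * h ^ 2 * ‖b‖ ^ 2) := by
  induction n with
  | zero => simp
  | succ n ih =>
    obtain ⟨c, hc, hcb⟩ := hA.exists_mem_iterate hh hb (2 * n)
    rw [Function.iterate_succ_apply', show 2 * (n + 1) = 2 * n + 1 + 1 by ring,
      Function.iterate_succ_apply', Function.iterate_succ_apply']
    have h1 := hA.norm_resolvent_sub_half_sq_le hh ((opResolvent A (2 * h))^[n] x) hc
    have h2 : 4 * h ^ 2 * ‖c‖ ^ 2 ≤ 4 * h ^ 2 * ‖b‖ ^ 2 := by gcongr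
    push_cast
    linarith

/-- The implicit Euler scheme of step `2⁻ᵐ` for `x' + A x ∋ 0`. -/
noncomputable def dyadicFlow (A : E → Set E) (m : ℕ) (t : ℝ≥0) (x : E) : E :=
  (opResolvent A ((2⁻¹ : ℝ) ^ m))^[⌊(2 : ℝ≥0) ^ m * t⌋₊] x

/-- The contraction semigroup generated by `-A`. -/
noncomputable def opFlow (A : E → Set E) (t : ℝ≥0) (x : E) : E :=
  limUnder atTop fun m => dyadicFlow A m t x

theorem inv_two_pow_pos (m : ℕ) : 0 < (2⁻¹ : ℝ) ^ m := by positivity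

theorem floor_mul_inv_two_pow_le (m : ℕ) (t : ℝ≥0) :
    (⌊(2 : ℝ≥0) ^ m * t⌋₊ : ℝ) * (2⁻¹ : ℝ) ^ m ≤ t := by
  have h1 : ((⌊(2 : ℝ≥0) ^ m * t⌋₊ : ℝ≥0) : ℝ) ≤ (2 : ℝ) ^ m * t := by
    have := NNReal.coe_le_coe.2 (Nat.floor_le (zero_le (a := (2 : ℝ≥0) ^ m * t)))
    simpa using! this
  rw [NNReal.coe_natCast] at h1
  rw [inv_pow, ← div_eq_mul_inv, div_le_iff₀ (by positivity)]
  linarith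

theorem lt_floor_mul_inv_two_pow (m : ℕ) (t : ℝ≥0) :
    (t : ℝ) < (⌊(2 : ℝ≥0) ^ m * t⌋₊ + 1 : ℝ) * (2⁻¹ : ℝ) ^ m := by
  have h1 : (2 : ℝ) ^ m * t < (⌊(2 : ℝ≥0) ^ m * t⌋₊ : ℝ) + 1 := by
    have := NNReal.coe_lt_coe.2 (Nat.lt_floor_add_one ((2 : ℝ≥0) ^ m * t))
    simpa using! this
  rw [inv_pow, ← div_eq_mul_inv, lt_div_iff₀ (by positivity)]
  linarith

theorem IsMaximalMonotone.norm_dyadicFlow_sub_le (hA : IsMaximalMonotone A) (m : ℕ) (t : ℝ≥0)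
    (x x' : E) : ‖dyadicFlow A m t x - dyadicFlow A m t x'‖ ≤ ‖x - x'‖ :=
  hA.norm_iterate_sub_le (inv_two_pow_pos m) _ _ _

theorem IsMaximalMonotone.dyadicFlow_mem (hA : IsMaximalMonotone A) (m : ℕ) (t : ℝ≥0) {x : E}
    (hx : x ∈ closure (opDomain A)) : dyadicFlow A m t x ∈ closure (opDomain A) := by
  rw [dyadicFlow]
  cases ⌊(2 : ℝ≥0) ^ m * t⌋₊ with
  | zero => exact hx
  | succ n =>
    rw [Function.iterate_succ_apply']
    exact subset_closure (hA.resolvent_mem_opDomain (inv_two_pow_pos m) _)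

theorem floor_two_mul_eq_or (c : ℝ≥0) : ⌊2 * c⌋₊ = 2 * ⌊c⌋₊ ∨ ⌊2 * c⌋₊ = 2 * ⌊c⌋₊ + 1 := by
  have h1 := Nat.floor_le (zero_le (a := c))
  have h2 := Nat.lt_floor_add_one c
  have h3 : 2 * ⌊c⌋₊ ≤ ⌊2 * c⌋₊ := Nat.le_floor (by push_cast; gcongr)
  have h4 : ⌊2 * c⌋₊ < 2 * ⌊c⌋₊ + 2 := by
    rw [Nat.floor_lt zero_le]
    push_cast
    calc 2 * c < 2 * (⌊c⌋₊ + 1) := by gcongr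
      _ = _ := by ring
  omega

/-- The bound is geometric in `m`, which makes the dyadic schemes Cauchy at points of the domain. -/
theorem IsMaximalMonotone.dist_dyadicFlow_succ_le (hA : IsMaximalMonotone A) {x b : E}
    (hb : b ∈ A x) (t : ℝ≥0) (m : ℕ) :
    dist (dyadicFlow A m t x) (dyadicFlow A (m + 1) t x)
      ≤ ‖b‖ * (√t + 1) * (√(2⁻¹)) ^ m := by
  set h : ℝ := (2⁻¹ : ℝ) ^ (m + 1) with hh
  have hpos : 0 < h := inv_two_pow_pos _
  have h2 : (2⁻¹ : ℝ) ^ m = 2 * h := by rw [hh, pow_succ]; ring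
  set n := ⌊(2 : ℝ≥0) ^ m * t⌋₊ with hn
  set n' := ⌊(2 : ℝ≥0) ^ (m + 1) * t⌋₊ with hn'
  have hn'2 : n' = 2 * n ∨ n' = 2 * n + 1 := by
    have := floor_two_mul_eq_or ((2 : ℝ≥0) ^ m * t)
    rwa [← mul_assoc, ← pow_succ'] at this
  have k1 := hA.norm_iterate_sub_half_sq_le hpos hb n
  -- Rounding the time at the finer scale may add one further half step.
  have k2 : ‖(opResolvent A h)^[n'] x - (opResolvent A h)^[2 * n] x‖ ≤ h * ‖b‖ := by
    rcases hn'2 with e | e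
    · rw [e, sub_self, norm_zero]; positivity
    · have := hA.norm_iterate_add_sub_le hpos hb (2 * n) 1
      rw [e]; simpa using this
  have hnt : (n : ℝ) * (2 * h) ≤ t := by rw [← h2]; exact floor_mul_inv_two_pow_le m t
  set q := (√(2⁻¹ : ℝ)) ^ m with hq
  have hq2 : q ^ 2 = 2 * h := by
    rw [hq, ← pow_mul, mul_comm, pow_mul, Real.sq_sqrt (by norm_num), h2]
  have hq0 : 0 ≤ q := by positivity
  have hq1 : q ≤ 1 := pow_le_one₀ (by positivity) (Real.sqrt_le_one.2 (by norm_num))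
  have k3 : ‖(opResolvent A (2 * h))^[n] x - (opResolvent A h)^[2 * n] x‖ ≤ ‖b‖ * √t * q := by
    refine abs_le_of_sq_le_sq' ?_ (by positivity) |>.2
    rw [mul_pow, mul_pow, Real.sq_sqrt t.coe_nonneg, hq2]
    refine k1.trans ?_
    have : (n : ℝ) * (2 * h) * (‖b‖ ^ 2 * (2 * h)) ≤ t * (‖b‖ ^ 2 * (2 * h)) := by gcongr
    linarith
  have k4 : h * ‖b‖ ≤ ‖b‖ * q := by
    rw [mul_comm]
    gcongr
    nlinarith
  rw [dist_eq_norm, dyadicFlow, dyadicFlow, h2]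
  have k5 := norm_sub_le_norm_sub_add_norm_sub ((opResolvent A (2 * h))^[n] x)
    ((opResolvent A h)^[2 * n] x) ((opResolvent A h)^[n'] x)
  rw [norm_sub_rev] at k2
  calc _ ≤ _ := k5
    _ ≤ ‖b‖ * √t * q + ‖b‖ * q := by linarith
    _ = _ := by ring

/-- Convergence extends from the domain to its closure because all the schemes are nonexpansive. -/
theorem IsMaximalMonotone.tendsto_dyadicFlow (hA : IsMaximalMonotone A) {x : E}
    (hx : x ∈ closure (opDomain A)) (t : ℝ≥0) :
    Tendsto (fun m => dyadicFlow A m t x) atTop (𝓝 (opFlow A t x)) := by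
  have : CompleteSpace E := FiniteDimensional.complete ℝ E
  refine CauchySeq.tendsto_limUnder ?_
  rw [Metric.cauchySeq_iff]
  intro ε hε
  obtain ⟨z, ⟨b, hb⟩, hz⟩ := Metric.mem_closure_iff.1 hx (ε / 3) (by positivity)
  have hc : CauchySeq fun m => dyadicFlow A m t z :=
    cauchySeq_of_le_geometric (√(2⁻¹)) (‖b‖ * (√t + 1))
      (by rw [Real.sqrt_lt' one_pos]; norm_num) (hA.dist_dyadicFlow_succ_le hb t)
  obtain ⟨N, hN⟩ := Metric.cauchySeq_iff.1 hc (ε / 3) (by positivity)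
  refine ⟨N, fun m hm n hn => ?_⟩
  have h1 := hN m hm n hn
  have h2 := hA.norm_dyadicFlow_sub_le m t x z
  have h3 := hA.norm_dyadicFlow_sub_le n t z x
  rw [← dist_eq_norm, ← dist_eq_norm] at h2 h3
  rw [dist_comm z x] at h3
  have h4 := dist_triangle4 (dyadicFlow A m t x) (dyadicFlow A m t z) (dyadicFlow A n t z)
    (dyadicFlow A n t x)
  linarith

theorem IsMaximalMonotone.norm_opFlow_sub_le (hA : IsMaximalMonotone A) {x x' : E}
    (hx : x ∈ closure (opDomain A)) (hx' : x' ∈ closure (opDomain A)) (t : ℝ≥0) :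
    ‖opFlow A t x - opFlow A t x'‖ ≤ ‖x - x'‖ :=
  le_of_tendsto' ((hA.tendsto_dyadicFlow hx t).sub (hA.tendsto_dyadicFlow hx' t)).norm
    fun m => hA.norm_dyadicFlow_sub_le m t x x'

theorem IsMaximalMonotone.opFlow_mem (hA : IsMaximalMonotone A) {x : E}
    (hx : x ∈ closure (opDomain A)) (t : ℝ≥0) : opFlow A t x ∈ closure (opDomain A) :=
  isClosed_closure.mem_of_tendsto (hA.tendsto_dyadicFlow hx t)
    (Eventually.of_forall fun m => hA.dyadicFlow_mem m t hx)

theorem opFlow_zero (A : E → Set E) (x : E) : opFlow A 0 x = x := by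
  have : (fun m => dyadicFlow A m 0 x) = fun _ => x := by
    ext m; simp [dyadicFlow]
  rw [opFlow, this]
  exact tendsto_const_nhds.limUnder_eq

theorem IsMaximalMonotone.norm_dyadicFlow_sub_time_le (hA : IsMaximalMonotone A) {x b : E}
    (hb : b ∈ A x) (m : ℕ) {s t : ℝ≥0} (hst : s ≤ t) :
    ‖dyadicFlow A m t x - dyadicFlow A m s x‖ ≤ ‖b‖ * (t - s + (2⁻¹ : ℝ) ^ m) := by
  set n := ⌊(2 : ℝ≥0) ^ m * s⌋₊
  set n' := ⌊(2 : ℝ≥0) ^ m * t⌋₊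
  have hnn : n ≤ n' := Nat.floor_le_floor (by gcongr)
  obtain ⟨k, hk⟩ := Nat.exists_eq_add_of_le hnn
  have h1 := hA.norm_iterate_add_sub_le (inv_two_pow_pos m) hb n k
  rw [← hk] at h1
  refine h1.trans ?_
  have h2 := floor_mul_inv_two_pow_le m t
  have h3 := lt_floor_mul_inv_two_pow m s
  have h4 : ((n' : ℕ) : ℝ) = n + k := by rw [hk]; push_cast; ring
  rw [← mul_assoc, mul_comm]
  gcongr
  change (n' : ℝ) * _ ≤ _ at h2
  change _ < ((n : ℝ) + 1) * _ at h3
  rw [h4] at h2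
  linarith

theorem IsMaximalMonotone.norm_opFlow_sub_time_le (hA : IsMaximalMonotone A) {x b : E}
    (hb : b ∈ A x) (s t : ℝ≥0) : ‖opFlow A t x - opFlow A s x‖ ≤ ‖b‖ * |(t : ℝ) - s| := by
  wlog hst : s ≤ t generalizing s t
  · rw [norm_sub_rev, abs_sub_comm]
    exact this t s (le_of_not_ge hst)
  have hx : x ∈ closure (opDomain A) := subset_closure ⟨b, hb⟩
  have hst' : (s : ℝ) ≤ t := hst
  rw [abs_of_nonneg (by linarith)]
  have h1 : Tendsto (fun m : ℕ => ‖b‖ * ((t : ℝ) - s + (2⁻¹ : ℝ) ^ m)) atTop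
      (𝓝 (‖b‖ * ((t : ℝ) - s + 0))) :=
    (tendsto_const_nhds.add
      (tendsto_pow_atTop_nhds_zero_of_lt_one (by norm_num) (by norm_num))).const_mul _
  rw [add_zero] at h1
  exact le_of_tendsto_of_tendsto'
    ((hA.tendsto_dyadicFlow hx t).sub (hA.tendsto_dyadicFlow hx s)).norm h1
    fun m => hA.norm_dyadicFlow_sub_time_le hb m hst

theorem IsMaximalMonotone.continuous_opFlow (hA : IsMaximalMonotone A) {x : E}
    (hx : x ∈ closure (opDomain A)) : Continuous fun t => opFlow A t x := by
  rw [Metric.continuous_iff]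
  intro t ε hε
  obtain ⟨z, ⟨b, hb⟩, hz⟩ := Metric.mem_closure_iff.1 hx (ε / 3) (by positivity)
  have hz' : z ∈ closure (opDomain A) := subset_closure ⟨b, hb⟩
  refine ⟨ε / 3 / (‖b‖ + 1), by positivity, fun s hs => ?_⟩
  have h1 := hA.norm_opFlow_sub_time_le hb t s
  have h2 := hA.norm_opFlow_sub_le hx hz' s
  have h3 := hA.norm_opFlow_sub_le hz' hx t
  rw [← dist_eq_norm, ← dist_eq_norm] at h2 h3
  rw [dist_comm z x] at h3
  rw [← dist_eq_norm] at h1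
  rw [NNReal.dist_eq] at hs
  have h5 : ‖b‖ * |(s : ℝ) - t| ≤ ε / 3 := by
    rw [lt_div_iff₀ (by positivity)] at hs
    nlinarith [abs_nonneg ((s : ℝ) - t)]
  have h4 := dist_triangle4 (opFlow A s x) (opFlow A s z) (opFlow A t z) (opFlow A t x)
  linarith

theorem floor_add_eq_or (a b : ℝ≥0) : ⌊a + b⌋₊ = ⌊a⌋₊ + ⌊b⌋₊ ∨ ⌊a + b⌋₊ = ⌊a⌋₊ + ⌊b⌋₊ + 1 := by
  have h1 := Nat.floor_le (zero_le (a := a))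
  have h2 := Nat.lt_floor_add_one a
  have h1' := Nat.floor_le (zero_le (a := b))
  have h2' := Nat.lt_floor_add_one b
  have h3 : ⌊a⌋₊ + ⌊b⌋₊ ≤ ⌊a + b⌋₊ := Nat.le_floor (by push_cast; gcongr)
  have h4 : ⌊a + b⌋₊ < ⌊a⌋₊ + ⌊b⌋₊ + 2 := by
    rw [Nat.floor_lt zero_le]
    push_cast
    calc a + b < (⌊a⌋₊ + 1) + (⌊b⌋₊ + 1) := by gcongr
      _ = _ := by ring
  omega

theorem IsMaximalMonotone.opFlow_add (hA : IsMaximalMonotone A) {x : E}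
    (hx : x ∈ closure (opDomain A)) (s t : ℝ≥0) :
    opFlow A (s + t) x = opFlow A t (opFlow A s x) := by
  have hs := hA.opFlow_mem hx s
  -- the discrete schemes at time `s + t` and at the successive times `s`, `t` differ by one step
  have hstep : ∀ z b, b ∈ A z → ∀ m, ‖dyadicFlow A m (s + t) z - dyadicFlow A m t
      (dyadicFlow A m s z)‖ ≤ (2⁻¹ : ℝ) ^ m * ‖b‖ := by
    intro z b hb m
    rw [dyadicFlow, dyadicFlow, dyadicFlow, ← Function.iterate_add_apply, mul_add]
    rcases floor_add_eq_or ((2 : ℝ≥0) ^ m * s) ((2 : ℝ≥0) ^ m * t) with e | e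
    · rw [e, add_comm, sub_self, norm_zero]; positivity
    · rw [e, add_comm ⌊(2 : ℝ≥0) ^ m * s⌋₊]
      simpa using hA.norm_iterate_add_sub_le (inv_two_pow_pos m) hb
        (⌊(2 : ℝ≥0) ^ m * t⌋₊ + ⌊(2 : ℝ≥0) ^ m * s⌋₊) 1
  have hlim : Tendsto (fun m => dyadicFlow A m t (dyadicFlow A m s x)) atTop
      (𝓝 (opFlow A t (opFlow A s x))) := by
    have h1 := hA.tendsto_dyadicFlow hs t
    refine tendsto_of_tendsto_of_dist h1 ?_
    have h2 := (hA.tendsto_dyadicFlow hx s).dist (tendsto_const_nhds (x := opFlow A s x))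
    rw [dist_self] at h2
    refine squeeze_zero (fun _ => dist_nonneg) (fun m => ?_) h2
    rw [dist_comm, dist_eq_norm, dist_eq_norm]
    exact hA.norm_dyadicFlow_sub_le m t _ _
  have hlim2 := hA.tendsto_dyadicFlow hx (s + t)
  refine eq_of_dist_eq_zero (le_antisymm (le_of_forall_pos_le_add fun ε hε => ?_) dist_nonneg)
  obtain ⟨z, ⟨b, hb⟩, hz⟩ := Metric.mem_closure_iff.1 hx (ε / 3) (by positivity)
  have h3 : Tendsto (fun m : ℕ => ε / 3 + (2⁻¹ : ℝ) ^ m * ‖b‖ + ε / 3) atTop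
      (𝓝 (ε / 3 + 0 * ‖b‖ + ε / 3)) :=
    (tendsto_const_nhds.add ((tendsto_pow_atTop_nhds_zero_of_lt_one (by norm_num)
      (by norm_num)).mul_const _)).add tendsto_const_nhds
  have h4 := le_of_tendsto_of_tendsto' (hlim2.dist hlim) h3 fun m => by
    have k1 := hA.norm_dyadicFlow_sub_le m (s + t) x z
    have k2 := hstep z b hb m
    have k3 := (hA.norm_dyadicFlow_sub_le m t _ _).trans (hA.norm_dyadicFlow_sub_le m s z x)
    rw [← dist_eq_norm, ← dist_eq_norm] at k1 k3
    rw [← dist_eq_norm] at k2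
    rw [dist_comm z x] at k3
    have := dist_triangle4 (dyadicFlow A m (s + t) x) (dyadicFlow A m (s + t) z)
      (dyadicFlow A m t (dyadicFlow A m s z)) (dyadicFlow A m t (dyadicFlow A m s x))
    linarith
  linarith

/-- One step reads `z = z' + h ξ` with `ξ ∈ A z'`. Expanding `‖z - a‖²`, the term `‖h ξ‖²` is
dropped and monotonicity replaces `ξ` by `b`; the term with `ρ` pays for pairing `b` with `x - a`
instead of `z' - a`. -/
theorem IsMaximalMonotone.norm_iterate_sub_sq_le (hA : IsMaximalMonotone A) {h : ℝ} (hh : 0 < h)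
    {x a b : E} (hb : b ∈ A a) {ρ : ℝ} (n : ℕ)
    (hρ : ∀ i ≤ n, ‖(opResolvent A h)^[i] x - x‖ ≤ ρ) :
    ‖(opResolvent A h)^[n] x - a‖ ^ 2
      ≤ ‖x - a‖ ^ 2 - 2 * (n * h) * (inner ℝ (x - a) b - ρ * ‖b‖) := by
  induction n with
  | zero => simp
  | succ n ih =>
    have ih := ih fun i hi => hρ i (hi.trans (Nat.le_succ n))
    have h1 := hρ (n + 1) le_rfl
    rw [Function.iterate_succ_apply'] at h1 ⊢
    set z := (opResolvent A h)^[n] x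
    set z' := opResolvent A h z
    have h2 := hA.monotone _ _ _ _ (hA.resolvent_mem hh z) hb
    have e : z - a = (z' - a) + h • (h⁻¹ • (z - z')) := by
      rw [smul_smul, mul_inv_cancel₀ hh.ne', one_smul]; abel
    set ξ := h⁻¹ • (z - z')
    rw [e, norm_add_sq_real, inner_smul_right] at ih
    have h3 : 0 ≤ ‖h • ξ‖ ^ 2 := sq_nonneg _
    have h4 : inner ℝ (ξ - b) (z' - a) = inner ℝ (z' - a) ξ - inner ℝ (z' - a) b := by
      rw [real_inner_comm, inner_sub_right]
    have h5 : inner ℝ (z' - a) b = inner ℝ (x - a) b + inner ℝ (z' - x) b := by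
      rw [← inner_add_left]; congr 1; abel
    have h6 : -(ρ * ‖b‖) ≤ inner ℝ (z' - x) b := by
      have := (abs_le.1 (abs_real_inner_le_norm (z' - x) b)).1
      have : ‖z' - x‖ * ‖b‖ ≤ ρ * ‖b‖ := by gcongr
      linarith
    have h7 : 0 ≤ inner ℝ (z' - a) ξ - (inner ℝ (x - a) b - ρ * ‖b‖) := by
      change 0 ≤ inner ℝ (ξ - b) (z' - a) at h2
      linarith
    have h8 := mul_nonneg hh.le h7
    push_cast
    linarith

/-- The local form of the dissipation inequality satisfied by the flow. -/
theorem IsMaximalMonotone.eventually_norm_opFlow_sub_sq_le (hA : IsMaximalMonotone A)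
    {x a b : E} (hx : x ∈ closure (opDomain A)) (hb : b ∈ A a) {ε : ℝ} (hε : 0 < ε) :
    ∀ᶠ t : ℝ≥0 in 𝓝 0,
      ‖opFlow A t x - a‖ ^ 2 ≤ ‖x - a‖ ^ 2 - 2 * t * inner ℝ (x - a) b + ε * t := by
  set ρ := ε / (2 * (‖b‖ + 1)) with hρdef
  have hρ0 : 0 < ρ := by positivity
  have hρb : 2 * (ρ * ‖b‖) ≤ ε := by
    rw [hρdef, div_mul_eq_mul_div, mul_div_assoc', div_le_iff₀ (by positivity)]
    nlinarith [norm_nonneg b]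
  -- A nearby point `z` of the domain moves at speed at most `‖c‖` under every scheme, so for small
  -- `t` all the schemes started at `x` stay within `ρ` of `x`.
  obtain ⟨z, ⟨c, hc⟩, hz⟩ := Metric.mem_closure_iff.1 hx (ρ / 3) (by positivity)
  rw [dist_eq_norm] at hz
  set δ : ℝ≥0 := (ρ / (3 * (‖c‖ + 1))).toNNReal with hδ
  have hδ0 : 0 < δ := by rw [hδ, Real.toNNReal_pos]; positivity
  filter_upwards [Iio_mem_nhds hδ0] with t ht
  have ht' : (t : ℝ) * ‖c‖ ≤ ρ / 3 := by
    have h1 : (t : ℝ) < ρ / (3 * (‖c‖ + 1)) := by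
      have := NNReal.coe_lt_coe.2 ht
      rwa [hδ, Real.coe_toNNReal _ (by positivity)] at this
    rw [lt_div_iff₀ (by positivity)] at h1
    nlinarith [t.coe_nonneg]
  have key : ∀ m : ℕ, ‖dyadicFlow A m t x - a‖ ^ 2 ≤ ‖x - a‖ ^ 2
      - 2 * (⌊(2 : ℝ≥0) ^ m * t⌋₊ * (2⁻¹ : ℝ) ^ m) * (inner ℝ (x - a) b - ρ * ‖b‖) := by
    intro m
    refine hA.norm_iterate_sub_sq_le (inv_two_pow_pos m) hb _ fun i hi => ?_
    have h1 := hA.norm_iterate_sub_le (inv_two_pow_pos m) i x z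
    have h2 := hA.norm_iterate_add_sub_le (inv_two_pow_pos m) hc 0 i
    rw [zero_add, Function.iterate_zero_apply, ← mul_assoc] at h2
    have h3 : (i : ℝ) * (2⁻¹ : ℝ) ^ m * ‖c‖ ≤ t * ‖c‖ := by
      gcongr
      refine le_trans ?_ (floor_mul_inv_two_pow_le m t)
      gcongr
    have h4 := dist_triangle4 ((opResolvent A ((2⁻¹ : ℝ) ^ m))^[i] x)
      ((opResolvent A ((2⁻¹ : ℝ) ^ m))^[i] z) z x
    simp only [dist_eq_norm] at h4
    rw [norm_sub_rev z x] at h4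
    linarith
  have hfl : Tendsto (fun m : ℕ => (⌊(2 : ℝ≥0) ^ m * t⌋₊ : ℝ) * (2⁻¹ : ℝ) ^ m) atTop
      (𝓝 (t : ℝ)) := by
    have h1 : Tendsto (fun m : ℕ => (t : ℝ) - (2⁻¹ : ℝ) ^ m) atTop (𝓝 ((t : ℝ) - 0)) :=
      tendsto_const_nhds.sub
        (tendsto_pow_atTop_nhds_zero_of_lt_one (by norm_num) (by norm_num))
    rw [sub_zero] at h1
    refine tendsto_of_tendsto_of_tendsto_of_le_of_le h1 tendsto_const_nhds (fun m => ?_)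
      fun m => floor_mul_inv_two_pow_le m t
    have := lt_floor_mul_inv_two_pow m t
    simp only
    linarith
  have h1 := le_of_tendsto_of_tendsto'
    (((hA.tendsto_dyadicFlow hx t).sub tendsto_const_nhds).norm.pow 2)
    (tendsto_const_nhds.sub ((hfl.const_mul 2).mul_const _)) key
  have h2 : (t : ℝ) * (2 * (ρ * ‖b‖)) ≤ t * ε := by gcongr
  linarith

end Flow

/-! ### Càdlàg paths: dyadic approximation, measurability, local bounds. -/

section Cadlag

/-- The approximating dyadic lies strictly to the right of `t`, so right continuity alone yields
convergence along these points. -/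
theorem exists_dyadic_right (t : ℝ≥0) (n : ℕ) :
    t < ((⌊(2 : ℝ≥0) ^ n * t⌋₊ : ℝ≥0) + 1) / 2 ^ n ∧
      ((⌊(2 : ℝ≥0) ^ n * t⌋₊ : ℝ≥0) + 1) / 2 ^ n ≤ t + (2⁻¹) ^ n := by
  have h1 := Nat.floor_le (zero_le (a := (2 : ℝ≥0) ^ n * t))
  have h2 := Nat.lt_floor_add_one ((2 : ℝ≥0) ^ n * t)
  have hp : (0 : ℝ≥0) < 2 ^ n := by positivity
  constructor
  · rw [lt_div_iff₀ hp, mul_comm]; exact h2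
  · rw [div_le_iff₀ hp, add_mul, ← mul_pow, inv_mul_cancel₀ two_ne_zero, one_pow, mul_comm t]
    gcongr

theorem tendsto_dyadic_right (t : ℝ≥0) :
    Tendsto (fun n : ℕ => ((⌊(2 : ℝ≥0) ^ n * t⌋₊ : ℝ≥0) + 1) / 2 ^ n) atTop (𝓝[>] t) := by
  refine tendsto_nhdsWithin_of_tendsto_nhds_of_eventually_within _ ?_
    (Eventually.of_forall fun n => (exists_dyadic_right t n).1)
  have h1 : Tendsto (fun n : ℕ => t + (2⁻¹ : ℝ≥0) ^ n) atTop (𝓝 (t + 0)) :=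
    tendsto_const_nhds.add (NNReal.tendsto_pow_atTop_nhds_zero_of_lt_one
      (by rw [← NNReal.coe_lt_coe]; norm_num))
  rw [add_zero] at h1
  exact tendsto_of_tendsto_of_tendsto_of_le_of_le tendsto_const_nhds h1
    (fun n => (exists_dyadic_right t n).1.le) fun n => (exists_dyadic_right t n).2

variable {E : Type*} [NormedAddCommGroup E]

theorem IsCadlag.tendsto_right {f : ℝ≥0 → E} (hf : IsCadlag f) (t : ℝ≥0) :
    Tendsto f (𝓝[>] t) (𝓝 (f t)) :=
  (hf t).1.tendsto.mono_left (nhdsWithin_mono _ Ioi_subset_Ici_self)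

theorem IsCadlag.tendsto_leftLim {f : ℝ≥0 → E} (hf : IsCadlag f) (t : ℝ≥0) :
    Tendsto f (𝓝[<] t) (𝓝 (Function.leftLim f t)) :=
  tendsto_leftLim_of_tendsto (hf t).2

theorem IsCadlag.of_tendsto {f : ℝ≥0 → E} (hr : ∀ t, Tendsto f (𝓝[>] t) (𝓝 (f t)))
    (hl : ∀ t, ∃ l, Tendsto f (𝓝[<] t) (𝓝 l)) : IsCadlag f := fun t => by
  refine ⟨?_, hl t⟩
  rw [← continuousWithinAt_Ioi_iff_Ici]
  exact hr t

theorem IsCadlag.sub {f g : ℝ≥0 → E} (hf : IsCadlag f) (hg : IsCadlag g) :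
    IsCadlag fun t => f t - g t := fun t => by
  obtain ⟨l, hl⟩ := (hf t).2
  obtain ⟨l', hl'⟩ := (hg t).2
  exact ⟨(hf t).1.sub (hg t).1, l - l', hl.sub hl'⟩

theorem IsCadlag.sub_const {f : ℝ≥0 → E} (hf : IsCadlag f) (c : E) :
    IsCadlag fun t => f t - c := fun t => by
  obtain ⟨l, hl⟩ := (hf t).2
  exact ⟨(hf t).1.sub continuousWithinAt_const, l - c, hl.sub tendsto_const_nhds⟩

theorem IsCadlag.stronglyMeasurable {f : ℝ≥0 → E} (hf : IsCadlag f) : StronglyMeasurable f := by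
  refine stronglyMeasurable_of_tendsto (u := atTop)
    (f := fun (n : ℕ) (t : ℝ≥0) => f (((⌊(2 : ℝ≥0) ^ n * t⌋₊ : ℝ≥0) + 1) / 2 ^ n)) (fun n => ?_)
    (tendsto_pi_nhds.2 fun t => (hf.tendsto_right t).comp (tendsto_dyadic_right t))
  have h1 : Measurable fun t : ℝ≥0 => ⌊(2 : ℝ≥0) ^ n * t⌋₊ :=
    Nat.measurable_floor.comp (measurable_const.mul measurable_id)
  exact (StronglyMeasurable.of_discrete (f := fun j : ℕ => f (((j : ℝ≥0) + 1) / 2 ^ n))).comp_measurable h1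

theorem IsCadlag.exists_bound {f : ℝ≥0 → E} (hf : IsCadlag f) (T : ℝ≥0) :
    ∃ C, ∀ t ≤ T, ‖f t‖ ≤ C := by
  refine forall_of_right_of_left (P := fun T => ∃ C, ∀ t ≤ T, ‖f t‖ ≤ C)
    ⟨‖f 0‖, fun t ht => by rw [nonpos_iff_eq_zero.1 ht]⟩
    (fun s t hst ⟨C, hC⟩ => ⟨C, fun u hu => hC u (hu.trans hst)⟩) ?_ ?_ T
  · rintro t ⟨C, hC⟩
    have h1 : ∀ᶠ s in 𝓝[>] t, ‖f s‖ < ‖f t‖ + 1 :=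
      (hf.tendsto_right t).norm.eventually_lt_const (by linarith)
    obtain ⟨s, hs, hsub⟩ := mem_nhdsGT_iff_exists_Ioc_subset.1 h1
    refine ⟨s, hs, max C (‖f t‖ + 1), fun u hu => ?_⟩
    rcases le_or_gt u t with h | h
    · exact (hC u h).trans (le_max_left _ _)
    · exact (hsub ⟨h, hu⟩).le.trans (le_max_right _ _)
  · intro t ht hlt
    obtain ⟨l, hl⟩ := (hf t).2
    have h1 : ∀ᶠ s in 𝓝[<] t, ‖f s‖ < ‖l‖ + 1 := hl.norm.eventually_lt_const (by linarith)
    obtain ⟨r, hr, hsub⟩ := (mem_nhdsLT_iff_exists_Ioo_subset' ht).1 h1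
    obtain ⟨s, hrs, hs⟩ := exists_between (show r < t from hr)
    obtain ⟨C, hC⟩ := hlt s hs
    refine ⟨max C (max (‖l‖ + 1) ‖f t‖), fun u hu => ?_⟩
    rcases le_or_gt u s with h | h
    · exact (hC u h).trans (le_max_left _ _)
    · rcases hu.eq_or_lt with h' | h'
      · rw [h']; exact (le_max_right _ _).trans (le_max_right _ _)
      · exact (hsub ⟨hrs.trans h, h'⟩).le.trans ((le_max_left _ _).trans (le_max_right _ _))

end Cadlag

/-! ### Estimates for the Stieltjes integral. -/

section StieltjesEstimates

variable {E : Type*} [NormedAddCommGroup E] [CompleteSpace E]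

/-- The Stieltjes measure of the variation of a right continuous path. -/
noncomputable def variationStieltjes {g : ℝ≥0 → E} (hg : BoundedVariationOn g univ)
    (hr : ∀ t, ContinuousWithinAt g (Ici t) t) : StieltjesFunction ℝ≥0 where
  toFun := pathVar g
  mono' := pathVar_mono hg.locallyBoundedVariationOn
  right_continuous' t := hg.continuousWithinAt_variationOnFromTo_Ici (hr t)

/-- The variation of the vector measure of a right continuous path is dominated by the Stieltjes
measure of its variation. -/
theorem variation_vectorMeasure_le {g : ℝ≥0 → E} (hg : BoundedVariationOn g univ)
    (hr : ∀ t, ContinuousWithinAt g (Ici t) t) :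
    hg.vectorMeasure.variation ≤ (variationStieltjes hg hr).measure := by
  have hrl : ∀ t, g.rightLim t = g t := fun t => (hr t).rightLim_eq
  set S := variationStieltjes hg hr with hS
  have hfin : IsFiniteMeasure S.measure :=
    S.isFiniteMeasure_of_forall_abs_le fun x => variationOnFromTo.abs_le_eVariationOn hg
  let m := AddContent.onIoc g
  have hm : ∀ s ∈ {s | ∃ u v : ℝ≥0, u ≤ v ∧ s = Ioc u v}, ‖m s‖ₑ ≤ S.measure s := by
    rintro s ⟨u, v, huv, rfl⟩
    rw [AddContent.onIoc_apply huv, S.measure_Ioc]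
    rw [← ofReal_norm]
    exact ENNReal.ofReal_le_ofReal (norm_sub_le_pathVar hg.locallyBoundedVariationOn huv)
  have hgen : (inferInstance : MeasurableSpace ℝ≥0)
      = MeasurableSpace.generateFrom {s | ∃ u v : ℝ≥0, u ≤ v ∧ s = Ioc u v} := by
    rw [BorelSpace.measurable_eq (α := ℝ≥0)]
    convert! borel_eq_generateFrom_Ioc_le ℝ≥0 using 2
    grind only
  -- The increments of `g` extend to a vector measure that is dominated by construction; it remains
  -- to recognise `hg.vectorMeasure` in it.
  obtain ⟨m', hm', hle⟩ := VectorMeasure.exists_extension_of_isSetSemiring_of_le_measure_of_generateFrom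
    IsSetSemiring.Ioc hm hgen
  have heq : hg.vectorMeasure = m' := by
    have hIoc : ∀ u v : ℝ≥0, u ≤ v → hg.vectorMeasure (Ioc u v) = m' (Ioc u v) := by
      intro u v huv
      rw [hm' _ ⟨u, v, huv, rfl⟩, AddContent.onIoc_apply huv, hg.vectorMeasure_Ioc huv, hrl, hrl]
    refine VectorMeasure.ext_of_generateFrom {s | ∃ u v : ℝ≥0, u ≤ v ∧ s = Ioc u v} ?_ hgen ?_ ?_
    · rintro s ⟨u, v, huv, rfl⟩
      exact hIoc u v huv
    · rintro s ⟨u, v, huv, rfl⟩ t ⟨u', v', huv', rfl⟩ hne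
      rw [Ioc_inter_Ioc] at hne ⊢
      obtain ⟨x, hx⟩ := hne
      exact ⟨_, _, (hx.1.trans_le hx.2).le, rfl⟩
    -- The intervals `(u, v]` never contain `0`, so that point is compared separately; neither
    -- measure charges it.
    · have h0 : hg.vectorMeasure {0} = m' {0} := by
        have h1 : m' {0} = 0 := by
          have h2 := hle {0}
          have h3 : ({0} : Set ℝ≥0) = botSet := (botSet_eq_singleton_of_isBot fun _ => zero_le).symm
          rw [h3, S.measure_botSet, ← h3] at h2
          exact enorm_eq_zero.1 (le_antisymm h2 zero_le)
        rw [h1, hg.vectorMeasure_singleton, hrl,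
          leftLim_eq_of_isBot (fun _ => zero_le), sub_self]
      have hU : (univ : Set ℝ≥0) = {0} ∪ ⋃ n : ℕ, Ioc 0 (n : ℝ≥0) := by
        ext x
        simp only [mem_univ, singleton_union, mem_insert_iff, mem_iUnion, mem_Ioc, true_iff]
        rcases eq_or_ne x 0 with h | h
        · exact Or.inl h
        · exact Or.inr ((exists_nat_ge x).imp fun n hn => ⟨pos_iff_ne_zero.2 h, hn⟩)
      have hdis : Disjoint ({0} : Set ℝ≥0) (⋃ n : ℕ, Ioc 0 (n : ℝ≥0)) := by
        simp
      have hmeas : MeasurableSet (⋃ n : ℕ, Ioc 0 (n : ℝ≥0)) :=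
        MeasurableSet.iUnion fun _ => measurableSet_Ioc
      rw [hU, VectorMeasure.of_union hdis (measurableSet_singleton _) hmeas,
        VectorMeasure.of_union hdis (measurableSet_singleton _) hmeas, h0]
      congr 1
      have hmono : Monotone fun n : ℕ => Ioc (0 : ℝ≥0) n := fun i j hij =>
        Ioc_subset_Ioc_right (by exact_mod_cast hij)
      refine tendsto_nhds_unique
        (hg.vectorMeasure.tendsto_vectorMeasure_iUnion_atTop_nat hmono fun _ => measurableSet_Ioc) ?_
      simp only [hIoc _ _ zero_le]
      exact m'.tendsto_vectorMeasure_iUnion_atTop_nat hmono fun _ => measurableSet_Ioc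
  rw [heq]
  exact VectorMeasure.variation_le_of_forall_enorm_le fun E _ => hle E

theorem continuousWithinAt_stopped {g : ℝ≥0 → E} (hr : ∀ t, ContinuousWithinAt g (Ici t) t)
    (T t : ℝ≥0) : ContinuousWithinAt (fun u => g (min u T)) (Ici t) t := by
  refine ContinuousWithinAt.comp (t := Ici (min t T)) (hr (min t T))
    (by fun_prop) fun u hu => min_le_min_right T hu

theorem pathVar_stopped {g : ℝ≥0 → E} {t T : ℝ≥0} (h : t ≤ T) :
    pathVar (fun u => g (min u T)) t = pathVar g t := by
  rw [pathVar, pathVar, variationOnFromTo.eq_of_le _ _ zero_le,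
    variationOnFromTo.eq_of_le _ _ zero_le]
  congr 1
  refine eVariationOn.congr fun u hu => ?_
  rw [min_eq_left (hu.2.2.trans h)]

theorem variation_vectorMeasure_stopped_Ioc_le {g : ℝ≥0 → E}
    (hg : LocallyBoundedVariationOn g univ) (hr : ∀ t, ContinuousWithinAt g (Ici t) t)
    {s t T : ℝ≥0} (hst : s ≤ t) (htT : t ≤ T) :
    (hg.stopped T).vectorMeasure.variation (Ioc s t) ≤ ENNReal.ofReal (pathVar g t - pathVar g s) := by
  refine (variation_vectorMeasure_le (hg.stopped T) (continuousWithinAt_stopped hr T) _).trans ?_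
  rw [StieltjesFunction.measure_Ioc]
  change ENNReal.ofReal (pathVar _ t - pathVar _ s) ≤ _
  rw [pathVar_stopped htT, pathVar_stopped (hst.trans htT)]

theorem isFiniteMeasure_variation_stopped {g : ℝ≥0 → E}
    (hg : LocallyBoundedVariationOn g univ) (hr : ∀ t, ContinuousWithinAt g (Ici t) t) (T : ℝ≥0) :
    IsFiniteMeasure (hg.stopped T).vectorMeasure.variation := by
  have : IsFiniteMeasure
      (variationStieltjes (hg.stopped T) (continuousWithinAt_stopped hr T)).measure :=
    StieltjesFunction.isFiniteMeasure_of_forall_abs_le _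
      fun x => variationOnFromTo.abs_le_eVariationOn (hg.stopped T)
  exact isFiniteMeasure_of_le _
    (variation_vectorMeasure_le (hg.stopped T) (continuousWithinAt_stopped hr T))

/-- `stieltjesIntegral` stops its integrator at the upper endpoint; independence of the stopping
time is what makes the integral additive over adjacent intervals. -/
theorem restrict_vectorMeasure_stopped {g : ℝ≥0 → E}
    (hg : LocallyBoundedVariationOn g univ) (hr : ∀ t, ContinuousWithinAt g (Ici t) t)
    {s t T : ℝ≥0} (hst : s ≤ t) (htT : t ≤ T) :
    (hg.stopped t).vectorMeasure.restrict (Ioc s t)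
      = (hg.stopped T).vectorMeasure.restrict (Ioc s t) := by
  have hrl : ∀ T u, (fun u => g (min u T)).rightLim u = g (min u T) := fun T u =>
    (continuousWithinAt_stopped hr T u).rightLim_eq
  have hgen : (inferInstance : MeasurableSpace ℝ≥0)
      = MeasurableSpace.generateFrom {s | ∃ u v : ℝ≥0, u ≤ v ∧ s = Ioc u v} := by
    rw [BorelSpace.measurable_eq (α := ℝ≥0)]
    convert! borel_eq_generateFrom_Ioc_le ℝ≥0 using 2
    grind only
  have hsub : ∀ u v, u ≤ v → v ≤ t → (hg.stopped t).vectorMeasure (Ioc u v)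
      = (hg.stopped T).vectorMeasure (Ioc u v) := fun u v huv hvt => by
    rw [BoundedVariationOn.vectorMeasure_Ioc _ huv, BoundedVariationOn.vectorMeasure_Ioc _ huv,
      hrl, hrl, hrl, hrl, min_eq_left hvt, min_eq_left (hvt.trans htT),
      min_eq_left (huv.trans hvt), min_eq_left ((huv.trans hvt).trans htT)]
  refine VectorMeasure.ext_of_generateFrom {s | ∃ u v : ℝ≥0, u ≤ v ∧ s = Ioc u v} ?_ hgen ?_ ?_
  · rintro _ ⟨u, v, huv, rfl⟩
    rw [VectorMeasure.restrict_apply _ measurableSet_Ioc measurableSet_Ioc,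
      VectorMeasure.restrict_apply _ measurableSet_Ioc measurableSet_Ioc, Ioc_inter_Ioc]
    rcases le_or_gt (max u s) (min v t) with h | h
    · exact hsub _ _ h (min_le_right _ _)
    · rw [Ioc_eq_empty (not_lt.2 h.le), VectorMeasure.empty, VectorMeasure.empty]
  · rintro s ⟨u, v, huv, rfl⟩ t ⟨u', v', huv', rfl⟩ hne
    rw [Ioc_inter_Ioc] at hne ⊢
    obtain ⟨x, hx⟩ := hne
    exact ⟨_, _, (hx.1.trans_le hx.2).le, rfl⟩
  · rw [VectorMeasure.restrict_apply _ measurableSet_Ioc MeasurableSet.univ,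
      VectorMeasure.restrict_apply _ measurableSet_Ioc MeasurableSet.univ, univ_inter]
    exact hsub _ _ hst le_rfl

theorem integrableOn_vectorMeasure_stopped {f g : ℝ≥0 → E} (hf : IsCadlag f)
    (hg : LocallyBoundedVariationOn g univ) (hr : ∀ t, ContinuousWithinAt g (Ici t) t)
    (s t T : ℝ≥0) : (hg.stopped T).vectorMeasure.IntegrableOn f (Ioc s t) := by
  have := isFiniteMeasure_variation_stopped hg hr T
  obtain ⟨C, hC⟩ := hf.exists_bound t
  rw [VectorMeasure.IntegrableOn, VectorMeasure.Integrable,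
    VectorMeasure.variation_restrict measurableSet_Ioc]
  refine Measure.integrableOn_of_bounded (M := C) (measure_ne_top _ _)
    hf.stronglyMeasurable.aestronglyMeasurable ?_
  filter_upwards [ae_restrict_mem measurableSet_Ioc] with u hu using hC u hu.2

variable [InnerProductSpace ℝ E]

theorem stieltjesIntegral_add {f g : ℝ≥0 → E} (hf : IsCadlag f)
    (hg : LocallyBoundedVariationOn g univ) (hr : ∀ t, ContinuousWithinAt g (Ici t) t)
    {s t r : ℝ≥0} (hst : s ≤ t) (htr : t ≤ r) :
    stieltjesIntegral f g hg s t + stieltjesIntegral f g hg t r = stieltjesIntegral f g hg s r := by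
  rw [stieltjesIntegral, stieltjesIntegral, stieltjesIntegral,
    restrict_vectorMeasure_stopped hg hr hst htr, ← Ioc_union_Ioc_eq_Ioc hst htr]
  refine (VectorMeasure.setIntegral_union ?_ measurableSet_Ioc measurableSet_Ioc
    (integrableOn_vectorMeasure_stopped hf hg hr _ _ _)
    (integrableOn_vectorMeasure_stopped hf hg hr _ _ _)).symm
  rw [Set.disjoint_left]
  exact fun x hx hx' => absurd hx'.1 (not_lt.2 hx.2)

/-- Comparison of the Stieltjes integral with a one-point Riemann sum. -/
theorem abs_stieltjesIntegral_sub_inner_le {f g : ℝ≥0 → E} (hf : IsCadlag f)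
    (hg : LocallyBoundedVariationOn g univ) (hr : ∀ t, ContinuousWithinAt g (Ici t) t)
    {s t : ℝ≥0} (hst : s ≤ t) {c : E} {ε : ℝ} (h : ∀ u ∈ Ioc s t, ‖f u - c‖ ≤ ε) :
    |stieltjesIntegral f g hg s t - inner ℝ c (g t - g s)| ≤ ε * (pathVar g t - pathVar g s) := by
  have hfin := isFiniteMeasure_variation_stopped hg hr t
  rcases hst.eq_or_lt with rfl | hlt
  · simp [stieltjesIntegral]
  have hε : 0 ≤ ε := (norm_nonneg _).trans (h t ⟨hlt, le_rfl⟩)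
  set μ := (hg.stopped t).vectorMeasure with hμ
  have hrl : ∀ u, (fun u => g (min u t)).rightLim u = g (min u t) := fun u =>
    (continuousWithinAt_stopped hr t u).rightLim_eq
  have h1 : μ (Ioc s t) = g t - g s := by
    rw [hμ, BoundedVariationOn.vectorMeasure_Ioc _ hst, hrl, hrl, min_self, min_eq_left hst]
  have hfinr : IsFiniteMeasure (μ.restrict (Ioc s t)).variation := by
    rw [VectorMeasure.variation_restrict measurableSet_Ioc]; infer_instance
  have h2 : (μ.restrict (Ioc s t)).integral (fun _ => c) (innerSL ℝ) = inner ℝ c (g t - g s) := by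
    rw [VectorMeasure.setIntegral_const, h1]; rfl
  have hint := integrableOn_vectorMeasure_stopped hf hg hr s t t
  have hconst : (μ.restrict (Ioc s t)).Integrable fun _ => c := integrable_const c
  rw [← h2, stieltjesIntegral, ← VectorMeasure.integral_fun_sub hint hconst, ← Real.norm_eq_abs]
  have h3 := VectorMeasure.norm_setIntegral_le_of_norm_le_const (μ := μ) (s := Ioc s t)
    (B := innerSL ℝ) (f := fun u => f u - c) h
  refine h3.trans ?_
  have h4 : ‖innerSL ℝ (E := E)‖ ≤ 1 := by
    refine ContinuousLinearMap.opNorm_le_bound _ zero_le_one fun x => ?_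
    rw [innerSL_apply_norm, one_mul]
  have h5 : μ.variation.real (Ioc s t) ≤ pathVar g t - pathVar g s :=
    ENNReal.toReal_le_of_le_ofReal (sub_nonneg.2 (pathVar_mono hg hst))
      (variation_vectorMeasure_stopped_Ioc_le hg hr hst le_rfl)
  calc ε * ‖innerSL ℝ (E := E)‖ * μ.variation.real (Ioc s t)
      ≤ ε * 1 * (pathVar g t - pathVar g s) := by gcongr
    _ = _ := by ring

end StieltjesEstimates

/-! ### Regularity of the continuous part. -/

section ContPart

variable {E : Type*} [NormedAddCommGroup E] [CompleteSpace E]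

/-- Away from finitely many times, the increments of a path of locally bounded variation and of its
continuous part agree up to the increments of a small monotone function. -/
theorem exists_contPart_sub_le {k : ℝ≥0 → E} (hk : LocallyBoundedVariationOn k univ)
    {p T : ℝ≥0} (hpT : p ≤ T) {η : ℝ} (hη : 0 < η) :
    ∃ (F : Finset ℝ≥0) (W : ℝ≥0 → ℝ), p ∈ F ∧ Monotone W ∧ (∀ t, 0 ≤ W t) ∧ (∀ t ≤ T, W t ≤ η) ∧
      ∀ a b, a ≤ b → ‖contPart k b - contPart k a - (k b - k a)
        + ∑ u ∈ F with u ∈ Ioc a b, jump k u‖ ≤ W b - W a := by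
  classical
  have hs := summable_norm_jump hk T
  have hlim := tendsto_tsum_compl_atTop_zero fun s : Iic T => ‖jump k s‖
  obtain ⟨F₀, hF₀⟩ := eventually_atTop.1 (hlim.eventually_lt_const hη)
  -- `F₀` carries all but `η` of the total size of the jumps on `[0, T]`. Adding `p` ensures that
  -- the jump at this chosen time is counted exactly; `W` sums the jumps left out.
  set F₁ : Finset (Iic T) := F₀ ∪ {⟨p, hpT⟩} with hF₁
  set F : Finset ℝ≥0 := F₁.map (Function.Embedding.subtype _) with hF
  set j : ℝ≥0 → E := (Fᶜ : Set ℝ≥0).indicator (jump k) with hj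
  have hjn : ∀ s, ‖j s‖ = (Fᶜ : Set ℝ≥0).indicator (fun s => ‖jump k s‖) s :=
    fun s => norm_indicator_eq_indicator_norm _ _
  have hjle : ∀ s, ‖j s‖ ≤ ‖jump k s‖ := fun s => norm_indicator_le_norm_self _ _
  have hjs : ∀ t, Summable fun s : Iic t => ‖j s‖ := fun t =>
    (summable_norm_jump hk t).of_nonneg_of_le (fun _ => norm_nonneg _) fun s => hjle s
  set W : ℝ≥0 → ℝ := fun t => ∑' s : Iic t, ‖j s‖ with hW
  have hdis : ∀ a b : ℝ≥0, Disjoint (Iic a) (Ioc a b) := fun a b => by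
    rw [Set.disjoint_left]; intro x hx hx'; exact absurd hx'.1 (not_lt.mpr hx)
  have hIoc : ∀ (f : ℝ≥0 → ℝ) (a b : ℝ≥0), (Summable fun s : Iic b => f s) →
      Summable fun s : Ioc a b => f s := fun f a b h =>
    h.comp_injective (i := fun s : Ioc a b => (⟨s.1, s.2.2⟩ : Iic b))
      (fun x y h => Subtype.ext (congrArg (fun z : Iic b => z.1) h))
  have hWadd : ∀ a b, a ≤ b → W b = W a + ∑' s : Ioc a b, ‖j s‖ := fun a b hab => by
    simp only [hW]
    rw [← Iic_union_Ioc_eq_Iic hab]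
    exact Summable.tsum_union_disjoint (f := fun s => ‖j s‖) (hdis a b) (hjs a)
      (hIoc (fun s => ‖j s‖) a b (hjs b))
  have hWmono : Monotone W := fun a b hab => by
    rw [hWadd a b hab]
    exact le_add_of_nonneg_right (tsum_nonneg fun _ => norm_nonneg _)
  refine ⟨F, W, ?_, hWmono, fun t => tsum_nonneg fun _ => norm_nonneg _, fun t ht => ?_, ?_⟩
  · simp [hF, hF₁, hpT]
  · refine (hWmono ht).trans ?_
    have h1 := hF₀ F₁ Finset.subset_union_left
    have h2 : W T = ∑' a : {x // x ∉ F₁}, ‖jump k (a : Iic T)‖ := by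
      have h3 := tsum_subtype {x : Iic T | x ∉ F₁} fun s => ‖jump k s‖
      refine Eq.trans ?_ h3.symm
      refine tsum_congr fun s => ?_
      rw [hjn]
      by_cases hsF : s ∈ F₁
      · rw [indicator_of_notMem, indicator_of_notMem]
        · simpa using hsF
        · simp [hF]; exact ⟨s.2, hsF⟩
      · rw [indicator_of_mem, indicator_of_mem]
        · simpa using hsF
        · simp [hF]; exact fun _ => hsF
    rw [h2]
    exact h1.le
  · intro a b hab
    have hsb := summable_norm_jump hk b
    have hsa := summable_norm_jump hk a
    have e1 : ∑' s : Iic b, jump k s = ∑' s : Iic a, jump k s + ∑' s : Ioc a b, jump k s := by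
      rw [← Iic_union_Ioc_eq_Iic hab]
      exact Summable.tsum_union_disjoint (hdis a b) hsa.of_norm
        (hIoc (fun s => ‖jump k s‖) a b hsb).of_norm
    have e2 : ∑' s : Ioc a b, jump k s
        = ∑' s : Ioc a b, j s + ∑ u ∈ F with u ∈ Ioc a b, jump k u := by
      have hsum : HasSum (fun s : Ioc a b => (F : Set ℝ≥0).indicator (jump k) s)
          (∑ u ∈ F with u ∈ Ioc a b, jump k u) := by
        rw [← Finset.sum_subtype_eq_sum_filter]
        have h1 : ∑ s ∈ F.subtype (fun u => u ∈ Ioc a b), jump k s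
            = ∑ s ∈ F.subtype (fun u => u ∈ Ioc a b), (F : Set ℝ≥0).indicator (jump k) s :=
          Finset.sum_congr rfl fun s hs => by
            rw [indicator_of_mem (Finset.mem_coe.2 (Finset.mem_subtype.1 hs))]
        rw [h1]
        refine hasSum_sum_of_ne_finset_zero fun s hs => indicator_of_notMem (fun h => hs ?_) _
        exact Finset.mem_subtype.2 (Finset.mem_coe.1 h)
      rw [← hsum.tsum_eq, ← Summable.tsum_add
        (hIoc (fun s => ‖j s‖) a b (hjs b)).of_norm hsum.summable]
      refine tsum_congr fun s => ?_
      rw [hj, add_comm]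
      exact (congrFun (indicator_self_add_compl (F : Set ℝ≥0) (jump k)) s).symm
    have e4 : contPart k b - contPart k a - (k b - k a) + ∑ u ∈ F with u ∈ Ioc a b, jump k u
        = - ∑' s : Ioc a b, j s := by
      simp only [contPart, e1, e2]; abel
    rw [e4, norm_neg, hWadd a b hab, add_sub_cancel_left]
    exact norm_tsum_le_tsum_norm (hIoc (fun s => ‖j s‖) a b (hjs b))

theorem eventually_right_notMem_Ioc (F : Finset ℝ≥0) (t : ℝ≥0) :
    ∀ᶠ s in 𝓝[>] t, ∀ u ∈ F, u ∉ Ioc t s := by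
  rw [Filter.eventually_all_finset]
  intro u _
  rcases le_or_gt u t with h | h
  · exact Eventually.of_forall fun s hs => absurd hs.1 (not_lt.2 h)
  · filter_upwards [Ioo_mem_nhdsGT h] with s hs hu using absurd hu.2 (not_le.2 hs.2)

/-- `exists_contPart_sub_le` in the form used to the right of a given time. -/
theorem eventually_norm_contPart_sub_le {k : ℝ≥0 → E} {F : Finset ℝ≥0} {W : ℝ≥0 → ℝ}
    (h : ∀ a b, a ≤ b → ‖contPart k b - contPart k a - (k b - k a)
        + ∑ u ∈ F with u ∈ Ioc a b, jump k u‖ ≤ W b - W a) (t : ℝ≥0) :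
    ∀ᶠ s in 𝓝[>] t, ‖contPart k s - contPart k t - (k s - k t)‖ ≤ W s - W t := by
  filter_upwards [eventually_right_notMem_Ioc F t, self_mem_nhdsWithin] with s hs hts
  have := h t s (le_of_lt hts)
  rwa [Finset.filter_false_of_mem hs, Finset.sum_empty, add_zero] at this

theorem tendsto_contPart_right {k : ℝ≥0 → E} (hk : LocallyBoundedVariationOn k univ) {t : ℝ≥0}
    (hr : Tendsto k (𝓝[>] t) (𝓝 (k t))) :
    Tendsto (contPart k) (𝓝[>] t) (𝓝 (contPart k t)) := by
  rw [Metric.tendsto_nhds]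
  intro ε hε
  obtain ⟨F, W, -, hWm, hW0, hWη, h⟩ := exists_contPart_sub_le hk (p := t) (T := t + 1)
    le_self_add (half_pos hε)
  filter_upwards [eventually_norm_contPart_sub_le h t,
    Metric.tendsto_nhds.1 hr (ε / 2) (half_pos hε),
    Ioo_mem_nhdsGT (lt_add_one t)] with s h1 h2 h3
  rw [dist_eq_norm] at h2 ⊢
  have h4 := hWη s h3.2.le
  have h5 := hW0 t
  have := norm_add_le (contPart k s - contPart k t - (k s - k t)) (k s - k t)
  rw [sub_add_cancel] at this
  linarith

/-- The finite set is made to contain `t`, and close to `t` on the left it has no other point in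
`(s, t]`. Hence the jump of `k` at `t` is cancelled exactly and the rest is small. -/
theorem tendsto_contPart_left {k : ℝ≥0 → E} (hk : LocallyBoundedVariationOn k univ) (t : ℝ≥0) :
    Tendsto (contPart k) (𝓝[<] t) (𝓝 (contPart k t)) := by
  rw [Metric.tendsto_nhds]
  intro ε hε
  obtain ⟨F, W, htF, hWm, hW0, hWη, h⟩ := exists_contPart_sub_le hk (p := t) (T := t)
    le_rfl (half_pos hε)
  have hl : Tendsto k (𝓝[<] t) (𝓝 (Function.leftLim k t)) :=
    tendsto_leftLim_of_tendsto (hk.exists_tendsto_nhdsLT t)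
  have hF : ∀ᶠ s in 𝓝[<] t, ∀ u ∈ F, u ∈ Ioc s t → u = t := by
    rw [Filter.eventually_all_finset]
    intro u _
    rcases lt_or_ge u t with h | h
    · filter_upwards [Ioo_mem_nhdsLT h] with s hs hu using absurd hu.1 (not_lt.2 hs.1.le)
    · exact Eventually.of_forall fun s hs => le_antisymm hs.2 h
  filter_upwards [hF, Metric.tendsto_nhds.1 hl (ε / 2) (half_pos hε), self_mem_nhdsWithin]
    with s h1 h2 h3
  have h3 : s < t := h3
  have h4 := h s t h3.le
  have e : (F.filter fun u => u ∈ Ioc s t) = {t} := by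
    ext u
    simp only [Finset.mem_filter, Finset.mem_singleton]
    refine ⟨fun hu => h1 u hu.1 hu.2, ?_⟩
    rintro rfl
    exact ⟨htF, h3, le_rfl⟩
  rw [e, Finset.sum_singleton, jump] at h4
  have e2 : contPart k t - contPart k s - (k t - k s) + (k t - Function.leftLim k t)
      = (contPart k t - contPart k s) + (k s - Function.leftLim k t) := by abel
  rw [e2] at h4
  rw [dist_eq_norm] at h2
  rw [dist_comm, dist_eq_norm]
  have h5 := hWη t le_rfl
  have h6 := hW0 s
  have h7 := norm_sub_le ((contPart k t - contPart k s) + (k s - Function.leftLim k t))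
    (k s - Function.leftLim k t)
  rw [add_sub_cancel_right] at h7
  linarith

end ContPart

/-! ### The Lebesgue integral in the variational inequality. -/

section TimeIntegral

variable {E : Type*} [NormedAddCommGroup E] [InnerProductSpace ℝ E]

theorem IsCadlag.intervalIntegrable_inner {x : ℝ≥0 → E} (hx : IsCadlag x) (α β : E) (s t : ℝ≥0) :
    IntervalIntegrable (fun u : ℝ => inner ℝ (x u.toNNReal - α) β) volume s t := by
  obtain ⟨C, hC⟩ := (hx.sub_const α).exists_bound (max s t)
  have hm : StronglyMeasurable fun u : ℝ => inner ℝ (x u.toNNReal - α) β :=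
    ((hx.sub_const α).stronglyMeasurable.comp_measurable measurable_real_toNNReal).inner
      stronglyMeasurable_const
  refine (intervalIntegrable_const (c := C * ‖β‖)).mono_fun hm.aestronglyMeasurable ?_
  filter_upwards [ae_restrict_mem measurableSet_uIoc] with u hu
  have h1 : u.toNNReal ≤ max s t := by
    rw [Real.toNNReal_le_iff_le_coe, NNReal.coe_max]
    exact hu.2
  have h2 := norm_inner_le_norm (𝕜 := ℝ) (x u.toNNReal - α) β
  have h3 := hC _ h1
  have h4 : 0 ≤ C := (norm_nonneg _).trans h3
  rw [Real.norm_of_nonneg (by positivity : (0 : ℝ) ≤ C * ‖β‖)]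
  exact h2.trans (by gcongr)

theorem IsCadlag.integral_inner_add {x : ℝ≥0 → E} (hx : IsCadlag x) (α β : E) (s t r : ℝ≥0) :
    (∫ u in (s : ℝ)..t, inner ℝ (x u.toNNReal - α) β)
      + (∫ u in (t : ℝ)..r, inner ℝ (x u.toNNReal - α) β)
      = ∫ u in (s : ℝ)..r, inner ℝ (x u.toNNReal - α) β :=
  intervalIntegral.integral_add_adjacent_intervals (hx.intervalIntegrable_inner α β s t)
    (hx.intervalIntegrable_inner α β t r)

theorem IsCadlag.abs_integral_inner_sub_le {x : ℝ≥0 → E} (hx : IsCadlag x) (α β : E) {s t : ℝ≥0}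
    (hst : s ≤ t) {c ε : ℝ} (h : ∀ u ∈ Ioc s t, |inner ℝ (x u - α) β - c| ≤ ε) :
    |(∫ u in (s : ℝ)..t, inner ℝ (x u.toNNReal - α) β) - (t - s) * c| ≤ ε * (t - s) := by
  have h1 : (∫ u in (s : ℝ)..t, inner ℝ (x u.toNNReal - α) β) - (t - s) * c
      = ∫ u in (s : ℝ)..t, (inner ℝ (x u.toNNReal - α) β - c) := by
    rw [intervalIntegral.integral_sub (hx.intervalIntegrable_inner α β s t)
      intervalIntegrable_const, intervalIntegral.integral_const, smul_eq_mul]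
  have hst' : (s : ℝ) ≤ t := hst
  rw [h1, ← Real.norm_eq_abs, ← abs_of_nonneg (sub_nonneg.2 hst')]
  refine intervalIntegral.norm_integral_le_of_norm_le_const fun u hu => ?_
  rw [uIoc_of_le hst'] at hu
  refine h _ ⟨?_, ?_⟩
  · rw [Real.lt_toNNReal_iff_coe_lt]; exact hu.1
  · rw [Real.toNNReal_le_iff_le_coe]; exact hu.2

theorem IsCadlag.eventually_forall_Ioc_norm_sub_le {x : ℝ≥0 → E} (hx : IsCadlag x) (t : ℝ≥0)
    {ε : ℝ} (hε : 0 < ε) : ∀ᶠ s in 𝓝[>] t, ∀ u ∈ Ioc t s, ‖x u - x t‖ ≤ ε := by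
  have h1 := Metric.tendsto_nhds.1 (hx.tendsto_right t) ε hε
  obtain ⟨r, hr, hsub⟩ := mem_nhdsGT_iff_exists_Ioc_subset.1 h1
  filter_upwards [Ioc_mem_nhdsGT hr] with s hs u hu
  have := hsub ⟨hu.1, hu.2.trans hs.2⟩
  rw [← dist_eq_norm]
  exact le_of_lt this

theorem IsCadlag.eventually_abs_integral_inner_sub_le {x : ℝ≥0 → E} (hx : IsCadlag x) (α β : E)
    (t : ℝ≥0) {ε : ℝ} (hε : 0 < ε) : ∀ᶠ s : ℝ≥0 in 𝓝[>] t,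
      |(∫ u in (t : ℝ)..s, inner ℝ (x u.toNNReal - α) β) - (s - t) * inner ℝ (x t - α) β|
        ≤ ε * (s - t) := by
  filter_upwards [hx.eventually_forall_Ioc_norm_sub_le t (ε := ε / (‖β‖ + 1)) (by positivity),
    self_mem_nhdsWithin] with s hs hts
  refine hx.abs_integral_inner_sub_le α β (le_of_lt hts) fun u hu => ?_
  have h1 := hs u hu
  rw [← inner_sub_left, sub_sub_sub_cancel_right]
  refine (abs_real_inner_le_norm _ _).trans ?_
  rw [le_div_iff₀ (by positivity)] at h1
  nlinarith [norm_nonneg (x u - x t)]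

end TimeIntegral

/-! ### The jump condition as a statement about left limits. -/

section Jumps

variable {E : Type*} [NormedAddCommGroup E] [InnerProductSpace ℝ E]

/-- The jumps of `y - k` are given by the map `p`. -/
def HasProjectedJumps (p : E → E) (y k : ℝ≥0 → E) : Prop :=
  ∀ t, Tendsto (fun s => p (y t - k s)) (𝓝[<] t) (𝓝 (y t - k t))

theorem IsGeneralizedProjection.continuous {D : Set E} {p : E → E}
    (hp : IsGeneralizedProjection D p) : Continuous p := by
  have : LipschitzWith 1 p := LipschitzWith.of_dist_le_mul fun x y => by
    rw [dist_eq_norm, dist_eq_norm, NNReal.coe_one, one_mul]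
    exact hp.nonexpansive x y
  exact this.continuous

/-- The drivers are frozen at their values at `t`, so `y t - k s` approximates the state after the
jump of `y` and before that of `k`. As `p` is non-expansive, the jumps of `k` and `k'` cannot
separate two such states. -/
theorem HasProjectedJumps.eventually_norm_sub_sq_le {D : Set E} {p : E → E}
    (hp : IsGeneralizedProjection D p) {y k y' k' : ℝ≥0 → E} (h : HasProjectedJumps p y k)
    (h' : HasProjectedJumps p y' k') (t : ℝ≥0) {η : ℝ} (hη : 0 < η) :
    ∀ᶠ s in 𝓝[<] t, ‖(y t - k t) - (y' t - k' t)‖ ^ 2 ≤ ‖(y t - k s) - (y' t - k' s)‖ ^ 2 + η := by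
  have h1 := ((h t).sub (h' t)).norm.pow 2
  have h2 := h1.eventually_const_lt (u := ‖(y t - k t) - (y' t - k' t)‖ ^ 2 - η) (by linarith)
  filter_upwards [h2] with s hs
  have h3 : ‖p (y t - k s) - p (y' t - k' s)‖ ^ 2 ≤ ‖(y t - k s) - (y' t - k' s)‖ ^ 2 := by
    gcongr
    exact hp.nonexpansive _ _
  linarith

theorem HasProjectedJumps.eventually_norm_sub_const_sq_le {D : Set E} {p : E → E}
    (hp : IsGeneralizedProjection D p) {y k : ℝ≥0 → E} (h : HasProjectedJumps p y k) {z : E}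
    (hz : z ∈ D) (t : ℝ≥0) {η : ℝ} (hη : 0 < η) :
    ∀ᶠ s in 𝓝[<] t, ‖y t - k t - z‖ ^ 2 ≤ ‖y t - k s - z‖ ^ 2 + η := by
  have h' : HasProjectedJumps p (fun _ => z) (fun _ => 0) := fun t => by
    simp only [sub_zero, hp.eq_self z hz]; exact tendsto_const_nhds
  simpa using h.eventually_norm_sub_sq_le hp h' t hη

variable [CompleteSpace E]

/-- When `k` does not jump, the limit is `p (x t) = x t`. The left-limit form therefore needs no
case distinction, and it is stable under locally uniform limits. -/
theorem IsSkorokhodSolution.hasProjectedJumps {A : E → Set E} {p : E → E}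
    (hp : IsGeneralizedProjection (closure (opDomain A)) p) {y x k : ℝ≥0 → E}
    (h : IsSkorokhodSolution A p y x k) : HasProjectedJumps p y k := by
  intro t
  have hl := h.cadlag_k.tendsto_leftLim t
  have h1 : Tendsto (fun s => p (y t - k s)) (𝓝[<] t) (𝓝 (p (y t - Function.leftLim k t))) :=
    (hp.continuous.tendsto _).comp (tendsto_const_nhds.sub hl)
  have hxt : y t - k t = x t := by rw [← h.add_eq t, add_sub_cancel_right]
  rw [hxt]
  suffices p (y t - Function.leftLim k t) = x t by rwa [this] at h1
  by_cases hj : jump k t = 0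
  · rw [jump, sub_eq_zero] at hj
    rw [← hj, hxt]
    exact hp.eq_self _ (h.mem_closure t)
  · rw [h.jump_eq t (norm_pos_iff.2 hj)]
    congr 1
    have hb : (𝓝[<] t).NeBot := by
      rcases eq_or_ne t 0 with rfl | ht
      · rw [jump, leftLim_eq_of_isBot (fun _ => zero_le), sub_self] at hj
        exact absurd rfl hj
      · exact nhdsLT_neBot_of_exists_lt ⟨0, pos_iff_ne_zero.2 ht⟩
    have hy : y = fun s => x s + k s := funext fun s => (h.add_eq s).symm
    have h2 : Function.leftLim y t = Function.leftLim x t + Function.leftLim k t := by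
      rw [hy]
      exact leftLim_eq_of_tendsto ((h.cadlag_x.tendsto_leftLim t).add hl)
    rw [jump, h2]
    abel

end Jumps

/-! ### Uniqueness for the deterministic problem. -/

section Uniqueness

variable {E : Type*} [NormedAddCommGroup E] [InnerProductSpace ℝ E] [CompleteSpace E]
  {A : E → Set E} {p : E → E}

/-- The local form of the variational inequality. -/
theorem IsSkorokhodSolution.eventually_inner_le {y x k : ℝ≥0 → E}
    (h : IsSkorokhodSolution A p y x k) {α β : E} (hβ : β ∈ A α) {W : ℝ≥0 → ℝ} {t : ℝ≥0}
    (hW : ∀ᶠ s in 𝓝[>] t, ‖contPart k s - contPart k t - (k s - k t)‖ ≤ W s - W t)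
    {ε : ℝ} (hε : 0 < ε) :
    ∀ᶠ s : ℝ≥0 in 𝓝[>] t, ((s : ℝ) - t) * inner ℝ (x t - α) β ≤ inner ℝ (x t - α) (k s - k t)
      + ‖x t - α‖ * (W s - W t)
      + ε * (pathVar (contPart k) s - pathVar (contPart k) t + (s - t)) := by
  have hr : ∀ t, ContinuousWithinAt (contPart k) (Ici t) t := fun t => by
    rw [← continuousWithinAt_Ioi_iff_Ici]
    exact tendsto_contPart_right h.bv (h.cadlag_k.tendsto_right t)
  filter_upwards [hW, h.cadlag_x.eventually_forall_Ioc_norm_sub_le t hε,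
    h.cadlag_x.eventually_abs_integral_inner_sub_le α β t hε, self_mem_nhdsWithin]
    with s h1 h2 h3 hts
  have hts : t < s := hts
  have h4 := h.integral_nonneg α β hβ t s hts
  have h5 := abs_stieltjesIntegral_sub_inner_le (h.cadlag_x.sub_const α) h.bv.contPart hr hts.le
    (c := x t - α) (ε := ε) fun u hu => by
      rw [sub_sub_sub_cancel_right]; exact h2 u hu
  have h6 := (abs_le.1 h5).2
  have h7 := (abs_le.1 h3).1
  have h8 : inner ℝ (x t - α) (contPart k s - contPart k t)
      = inner ℝ (x t - α) (k s - k t)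
        + inner ℝ (x t - α) (contPart k s - contPart k t - (k s - k t)) := by
    rw [← inner_add_right]; congr 1; abel
  have h9 := (real_inner_le_norm (x t - α) (contPart k s - contPart k t - (k s - k t))).trans
    (mul_le_mul_of_nonneg_left h1 (norm_nonneg _))
  rw [h8] at h6
  rw [mul_add]
  linarith

theorem IsSkorokhodSolution.sub_eq {y x k : ℝ≥0 → E} (h : IsSkorokhodSolution A p y x k) (t : ℝ≥0) :
    y t - k t = x t := by rw [← h.add_eq t, add_sub_cancel_right]

/-- Uniqueness for the Skorokhod problem up to time `T`. -/
theorem IsSkorokhodSolution.eq_of_eq_on [FiniteDimensional ℝ E] (hA : IsMaximalMonotone A)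
    (hp : IsGeneralizedProjection (closure (opDomain A)) p) {y x k y' x' k' : ℝ≥0 → E}
    (h : IsSkorokhodSolution A p y x k) (h' : IsSkorokhodSolution A p y' x' k') {T : ℝ≥0}
    (hy : ∀ t ≤ T, y t = y' t) : k T = k' T := by
  set κ : ℝ≥0 → E := fun t => k t - k' t with hκ
  set V := pathVar k
  set V' := pathVar k'
  set Vc := pathVar (contPart k)
  set Vc' := pathVar (contPart k')
  have mV : Monotone V := pathVar_mono h.bv
  have mV' : Monotone V' := pathVar_mono h'.bv
  have mVc : Monotone Vc := pathVar_mono h.bv.contPart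
  have mVc' : Monotone Vc' := pathVar_mono h'.bv.contPart
  set M := V T + V' T with hM
  have hM0 : 0 ≤ M := add_nonneg (pathVar_nonneg _ _) (pathVar_nonneg _ _)
  have hdκ : ∀ s t, s ≤ t → ‖κ t - κ s‖ ≤ (V t - V s) + (V' t - V' s) := fun s t hst => by
    have e : κ t - κ s = (k t - k s) - (k' t - k' s) := by simp only [hκ]; abel
    rw [e]
    exact (norm_sub_le _ _).trans
      (add_le_add (norm_sub_le_pathVar h.bv hst) (norm_sub_le_pathVar h'.bv hst))
  have hκ0 : κ 0 = 0 := by simp [hκ, h.k_zero, h'.k_zero]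
  have hκM : ∀ t ≤ T, ‖κ t‖ ≤ M := fun t ht => by
    have h1 := hdκ 0 t zero_le
    rw [hκ0, sub_zero] at h1
    have h2 := mV ht
    have h3 := mV' ht
    have h4 : V 0 = 0 := pathVar_zero k
    have h5 : V' 0 = 0 := pathVar_zero k'
    linarith
  have hxκ : ∀ t ≤ T, x t - x' t = - κ t := fun t ht => by
    rw [← h.sub_eq t, ← h'.sub_eq t, hy t ht]; simp only [hκ]; abel
  have main : ∀ ε : ℝ, 0 < ε → ε ≤ 1 →
      ‖κ T‖ ^ 2 ≤ ε * (5 * M + 4 * (Vc T + Vc' T) + 8 * T + 8 * (M + 1)) := by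
    intro ε hε hε1
    obtain ⟨F, W, -, mW, hW0, hWη, hW⟩ := exists_contPart_sub_le h.bv (zero_le (a := T)) hε
    obtain ⟨F', W', -, mW', hW0', hWη', hW'⟩ := exists_contPart_sub_le h'.bv (zero_le (a := T)) hε
    -- The increment of `‖κ‖²` is `2⟨κ t, κ s - κ t⟩ + ‖κ s - κ t‖²`. The summed inequalities
    -- contain only a quarter of the first term, hence the factors `4` and `8`; the square costs one
    -- more `ε (V + V')`, hence `5`.
    set Q : ℝ≥0 → ℝ := fun t => ε * (5 * (V t + V' t) + 4 * (Vc t + Vc' t) + 8 * t)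
      + 4 * (M + 1) * (W t + W' t) - ‖κ t‖ ^ 2 with hQ
    have hQle : Q 0 ≤ Q T := by
      refine le_of_forall_eventually_le zero_le (fun t _ htT => ?_) fun t _ htT η hη => ?_
      -- `A` may be empty at `x t`, `x' t` and `m`, so the test point is a nearby `α`. There is no
      -- bound on `β`, and the sign of `⟨m - α, β⟩` takes its place.
      · set m := (2⁻¹ : ℝ) • (x t + x' t) with hm
        obtain ⟨α, β, hβ, hmα, hmβ⟩ := hA.exists_mem_near
          (hp.midpoint_mem (h.mem_closure t) (h'.mem_closure t)) hε
        rw [← hm] at hmα hmβ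
        have c1 := h.cadlag_k.tendsto_right t
        have c2 := h'.cadlag_k.tendsto_right t
        have c3 : Tendsto κ (𝓝[>] t) (𝓝 (κ t)) := c1.sub c2
        filter_upwards [h.eventually_inner_le hβ (eventually_norm_contPart_sub_le hW t) hε,
          h'.eventually_inner_le hβ (eventually_norm_contPart_sub_le hW' t) hε,
          Metric.tendsto_nhds.1 c3 ε hε, self_mem_nhdsWithin] with s h1 h2 h3 hts
        have hts : t ≤ s := le_of_lt hts
        rw [dist_eq_norm] at h3
        have ex : x t - α = -((2⁻¹ : ℝ) • κ t) + (m - α) := by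
          have := hxκ t htT.le
          have e2 : κ t = x' t - x t := by rw [← neg_sub, this, neg_neg]
          rw [e2, hm]; module
        have ex' : x' t - α = (2⁻¹ : ℝ) • κ t + (m - α) := by
          have := hxκ t htT.le
          have e2 : κ t = x' t - x t := by rw [← neg_sub, this, neg_neg]
          rw [e2, hm]; module
        have nκ : ‖(2⁻¹ : ℝ) • κ t‖ ≤ M := by
          rw [norm_smul, Real.norm_of_nonneg (by norm_num)]
          have := hκM t htT.le
          have := norm_nonneg (κ t)
          linarith
        have nx : ‖x t - α‖ ≤ M + 1 := by
          rw [ex]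
          refine (norm_add_le _ _).trans ?_
          rw [norm_neg]; linarith
        have nx' : ‖x' t - α‖ ≤ M + 1 := by
          rw [ex']
          refine (norm_add_le _ _).trans ?_
          linarith
        have w1 : ‖x t - α‖ * (W s - W t) ≤ (M + 1) * (W s - W t) :=
          mul_le_mul_of_nonneg_right nx (sub_nonneg.2 (mW hts))
        have w2 : ‖x' t - α‖ * (W' s - W' t) ≤ (M + 1) * (W' s - W' t) :=
          mul_le_mul_of_nonneg_right nx' (sub_nonneg.2 (mW' hts))
        have i1 : inner ℝ (x t - α) β + inner ℝ (x' t - α) β = 2 * inner ℝ (m - α) β := by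
          rw [ex, ex', inner_add_left, inner_add_left, inner_neg_left]; ring
        -- Since `x t - α` and `x' t - α` are `m - α` shifted by `-κ t / 2` and `κ t / 2`, the sum
        -- isolates `⟨κ t, κ s - κ t⟩`, up to terms with the small factor `m - α`.
        have i2 : inner ℝ (x t - α) (k s - k t) + inner ℝ (x' t - α) (k' s - k' t)
            = -(2⁻¹ * inner ℝ (κ t) (κ s - κ t))
              + (inner ℝ (m - α) (k s - k t) + inner ℝ (m - α) (k' s - k' t)) := by
          have e : κ s - κ t = (k s - k t) - (k' s - k' t) := by simp only [hκ]; abel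
          have e' : inner ℝ (κ t) (κ s - κ t)
              = inner ℝ (κ t) (k s - k t) - inner ℝ (κ t) (k' s - k' t) := by
            rw [e, inner_sub_right]
          rw [ex, ex', e', inner_add_left, inner_add_left, inner_neg_left, inner_smul_left,
            inner_smul_left]
          simp only [RCLike.conj_to_real]
          ring
        have i3 : inner ℝ (m - α) (k s - k t) ≤ ε * (V s - V t) :=
          (real_inner_le_norm _ _).trans
            (mul_le_mul hmα (norm_sub_le_pathVar h.bv hts) (norm_nonneg _) hε.le)
        have i4 : inner ℝ (m - α) (k' s - k' t) ≤ ε * (V' s - V' t) :=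
          (real_inner_le_norm _ _).trans
            (mul_le_mul hmα (norm_sub_le_pathVar h'.bv hts) (norm_nonneg _) hε.le)
        have i5 : 0 ≤ ((s : ℝ) - t) * (2 * inner ℝ (m - α) β) :=
          mul_nonneg (sub_nonneg.2 hts) (by linarith)
        rw [← i1, mul_add] at i5
        have q1 : ‖κ s‖ ^ 2 = ‖κ t‖ ^ 2 + 2 * inner ℝ (κ t) (κ s - κ t) + ‖κ s - κ t‖ ^ 2 := by
          rw [← norm_add_sq_real, add_sub_cancel]
        have q2 : ‖κ s - κ t‖ ^ 2 ≤ ε * ((V s - V t) + (V' s - V' t)) := by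
          rw [sq]
          exact mul_le_mul h3.le (hdκ t s hts) (norm_nonneg _) hε.le
        simp only [hQ]
        linarith
      -- The monotone terms of `Q` only help here, and the projected jumps do not increase `‖κ‖²`.
      · have hJ := h.hasProjectedJumps hp
        have hJ' := h'.hasProjectedJumps hp
        filter_upwards [hJ.eventually_norm_sub_sq_le hp hJ' t hη, self_mem_nhdsWithin]
          with s h1 hst
        have hst : s ≤ t := le_of_lt hst
        have hst' : (s : ℝ) ≤ t := hst
        have e1 : y t - k t - (y' t - k' t) = - κ t := by
          rw [hy t htT]; simp only [hκ]; abel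
        have e2 : y t - k s - (y' t - k' s) = - κ s := by
          rw [hy t htT]; simp only [hκ]; abel
        rw [e1, e2, norm_neg, norm_neg] at h1
        have a1 := mV hst
        have a2 := mV' hst
        have a3 := mVc hst
        have a4 := mVc' hst
        have a5 : ε * (5 * (V s + V' s) + 4 * (Vc s + Vc' s) + 8 * s)
            ≤ ε * (5 * (V t + V' t) + 4 * (Vc t + Vc' t) + 8 * t) :=
          mul_le_mul_of_nonneg_left (by linarith) hε.le
        have a6 : 4 * (M + 1) * (W s + W' s) ≤ 4 * (M + 1) * (W t + W' t) :=
          mul_le_mul_of_nonneg_left (add_le_add (mW hst) (mW' hst)) (by linarith)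
        simp only [hQ]
        linarith
    have b1 : 0 ≤ Q 0 := by
      have v1 : V 0 = 0 := pathVar_zero k
      have v2 : V' 0 = 0 := pathVar_zero k'
      have v3 : Vc 0 = 0 := pathVar_zero _
      have v4 : Vc' 0 = 0 := pathVar_zero _
      simp only [hQ, v1, v2, v3, v4, hκ0, norm_zero]
      have : 0 ≤ 4 * (M + 1) * (W 0 + W' 0) :=
        mul_nonneg (by linarith) (add_nonneg (hW0 0) (hW0' 0))
      simpa using this
    have b2 := hWη T le_rfl
    have b3 := hWη' T le_rfl
    have b4 : 4 * (M + 1) * (W T + W' T) ≤ 4 * (M + 1) * (ε + ε) :=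
      mul_le_mul_of_nonneg_left (add_le_add b2 b3) (by linarith)
    simp only [hQ] at b1 hQle
    rw [hM] at b4 ⊢
    linarith
  have hlim : Tendsto (fun ε : ℝ => ε * (5 * M + 4 * (Vc T + Vc' T) + 8 * T + 8 * (M + 1)))
      (𝓝[>] 0) (𝓝 (0 * (5 * M + 4 * (Vc T + Vc' T) + 8 * T + 8 * (M + 1)))) :=
    ((continuous_id.mul continuous_const).tendsto 0).mono_left nhdsWithin_le_nhds
  have h0 := ge_of_tendsto hlim (by
    filter_upwards [Ioc_mem_nhdsGT (zero_lt_one' ℝ)] with ε hε using main ε hε.1 hε.2)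
  rw [zero_mul] at h0
  have h1 : ‖κ T‖ = 0 := pow_eq_zero_iff two_ne_zero |>.1 (le_antisymm h0 (sq_nonneg _))
  exact sub_eq_zero.1 (norm_eq_zero.1 h1)

end Uniqueness

/-! ### Step solutions: stability, variational inequality, variation bounds. -/

section StepSolutions

variable {E : Type*} [NormedAddCommGroup E] [InnerProductSpace ℝ E] [FiniteDimensional ℝ E]
  {A : E → Set E} {p : E → E} {y k y' k' : ℝ≥0 → E}

/-- `y` is a right-locally constant path, and `y - k` follows the semigroup generated by `-A`
to the right of any time, with jumps given by `p`. -/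
structure IsStepSolution (A : E → Set E) (p : E → E) (y k : ℝ≥0 → E) : Prop where
  right : ∀ t, ∀ᶠ s : ℝ≥0 in 𝓝[>] t, y s = y t ∧ y s - k s = opFlow A (s - t) (y t - k t)
  jumps : HasProjectedJumps p y k
  mem : ∀ t, y t - k t ∈ closure (opDomain A)
  k_zero : k 0 = 0
  bv : LocallyBoundedVariationOn k univ

theorem norm_sq_le_of_norm_sub_sq_le {e a b : E} {η ε : ℝ} (h : ‖e - a‖ ^ 2 ≤ ‖e - b‖ ^ 2 + η)
    (he : ‖e‖ ≤ ε) : ‖a‖ ^ 2 ≤ ‖b‖ ^ 2 + 2 * ε * ‖a - b‖ + η := by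
  rw [norm_sub_sq_real, norm_sub_sq_real] at h
  have h1 : inner ℝ e a - inner ℝ e b ≤ ε * ‖a - b‖ := by
    rw [← inner_sub_right]
    exact (real_inner_le_norm _ _).trans (by gcongr)
  linarith

/-- Stability of step solutions with respect to the driving path. -/
theorem IsStepSolution.norm_sub_sq_le (hA : IsMaximalMonotone A)
    (hp : IsGeneralizedProjection (closure (opDomain A)) p) (h : IsStepSolution A p y k)
    (h' : IsStepSolution A p y' k') {T : ℝ≥0} {ε : ℝ} (hy : ∀ t ≤ T, ‖y t - y' t‖ ≤ ε) :
    ‖k T - k' T‖ ^ 2 ≤ 2 * ε * (pathVar k T + pathVar k' T) := by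
  have hε : 0 ≤ ε := (norm_nonneg _).trans (hy 0 zero_le)
  have hinc : ∀ s t, s ≤ t → 2 * ε * ‖(k t - k' t) - (k s - k' s)‖
      ≤ 2 * ε * ((pathVar k t + pathVar k' t) - (pathVar k s + pathVar k' s)) := by
    intro s t hst
    have h1 := norm_sub_le_pathVar h.bv hst
    have h2 := norm_sub_le_pathVar h'.bv hst
    have h3 := norm_sub_le (k t - k s) (k' t - k' s)
    rw [show (k t - k' t) - (k s - k' s) = (k t - k s) - (k' t - k' s) by abel]
    gcongr
    linarith
  have e1 : ∀ t u, (y t - k u) - (y' t - k' u) = (y t - y' t) - (k u - k' u) := fun t u => by abel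
  -- The semigroup and `p` both contract the distance `‖(y - y') - (k - k')‖` with `y - y'` frozen.
  -- Expanding the squares turns this into control of `‖k - k'‖²`, at the cost of `2ε` times the
  -- increment of `k - k'`.
  have key := le_of_forall_eventually_le (a := 0) (b := T)
    (f := fun t => 2 * ε * (pathVar k t + pathVar k' t) - ‖k t - k' t‖ ^ 2) zero_le ?_ ?_
  · simp only [pathVar_zero, h.k_zero, h'.k_zero] at key
    simp at key
    linarith
  · intro t _ htT
    filter_upwards [h.right t, h'.right t, self_mem_nhdsWithin] with s h1 h2 hts
    have h3 := hA.norm_opFlow_sub_le (h.mem t) (h'.mem t) (s - t)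
    rw [← h1.2, ← h2.2, h1.1, h2.1, e1, e1] at h3
    have h3' := pow_le_pow_left₀ (norm_nonneg _) h3 2
    have h4 := norm_sq_le_of_norm_sub_sq_le (h3'.trans_eq (add_zero _).symm) (hy t htT.le)
    have h5 := hinc t s (le_of_lt hts)
    linarith
  · intro t _ htT η hη
    filter_upwards [h.jumps.eventually_norm_sub_sq_le hp h'.jumps t hη,
      self_mem_nhdsWithin] with s h1 hst
    rw [e1, e1] at h1
    have h4 := norm_sq_le_of_norm_sub_sq_le h1 (hy t htT)
    have h5 := hinc s t (le_of_lt hst)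
    linarith

/-- The integrated form of the variational inequality for step solutions. -/
theorem IsStepSolution.variational_mono (hA : IsMaximalMonotone A)
    (hp : IsGeneralizedProjection (closure (opDomain A)) p) (h : IsStepSolution A p y k)
    {α β : E} (hβ : β ∈ A α) {u v : ℝ≥0} (x₀ y₀ : E) {ρ o : ℝ}
    (hx : ∀ r ∈ Icc u v, ‖y r - k r - x₀‖ ≤ ρ) (hy : ∀ r ∈ Icc u v, ‖y r - y₀‖ ≤ o)
    {s t : ℝ≥0} (hus : u ≤ s) (hst : s ≤ t) (htv : t ≤ v) :
    ‖k t‖ ^ 2 - ‖k s‖ ^ 2 + 2 * (t - s) * inner ℝ (x₀ - α) β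
      ≤ 2 * inner ℝ (y₀ - α) (k t - k s) + 2 * ρ * ‖β‖ * (t - s)
        + 2 * o * (pathVar k t - pathVar k s) := by
  -- With everything at time `s` on one side and at time `t` on the other, the claim becomes the
  -- monotonicity of a single function, as real induction requires.
  have step : ∀ ε > 0, 2 * inner ℝ (y₀ - α) (k s) - ‖k s‖ ^ 2 - 2 * s * inner ℝ (x₀ - α) β
        + (2 * ρ * ‖β‖ + ε) * s + 2 * o * pathVar k s
      ≤ 2 * inner ℝ (y₀ - α) (k t) - ‖k t‖ ^ 2 - 2 * t * inner ℝ (x₀ - α) β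
        + (2 * ρ * ‖β‖ + ε) * t + 2 * o * pathVar k t := by
    intro ε hε
    have hyinc : ∀ w ∈ Icc u v, ∀ a b, a ≤ b → inner ℝ (y w - α) (k b - k a)
        ≤ inner ℝ (y₀ - α) (k b - k a) + o * (pathVar k b - pathVar k a) := by
      intro w hw a b hab
      have h1 : inner ℝ (y w - α) (k b - k a) - inner ℝ (y₀ - α) (k b - k a)
          = inner ℝ (y w - y₀) (k b - k a) := by
        rw [← inner_sub_left, sub_sub_sub_cancel_right]
      have h2 : inner ℝ (y w - y₀) (k b - k a) ≤ o * (pathVar k b - pathVar k a) :=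
        (real_inner_le_norm _ _).trans (mul_le_mul (hy w hw) (norm_sub_le_pathVar h.bv hab)
          (norm_nonneg _) ((norm_nonneg _).trans (hy w hw)))
      linarith
    have hexp : ∀ w a, ‖y w - k a - α‖ ^ 2 = ‖y w - α‖ ^ 2 - 2 * inner ℝ (y w - α) (k a)
        + ‖k a‖ ^ 2 := by
      intro w a
      rw [show y w - k a - α = (y w - α) - k a by abel, norm_sub_sq_real]
    refine le_of_forall_eventually_le (f := fun t : ℝ≥0 => 2 * inner ℝ (y₀ - α) (k t) - ‖k t‖ ^ 2
      - 2 * t * inner ℝ (x₀ - α) β + (2 * ρ * ‖β‖ + ε) * t + 2 * o * pathVar k t) hst ?_ ?_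
    · intro w hsw hwt
      have hw : w ∈ Icc u v := ⟨hus.trans hsw, hwt.le.trans htv⟩
      have hlim : Tendsto (fun b : ℝ≥0 => b - w) (𝓝[>] w) (𝓝 0) := by
        have : Tendsto (fun b : ℝ≥0 => b - w) (𝓝 w) (𝓝 (w - w)) :=
          (continuous_id.sub continuous_const).tendsto w
        rw [tsub_self] at this
        exact this.mono_left nhdsWithin_le_nhds
      filter_upwards [h.right w, hlim.eventually
        (hA.eventually_norm_opFlow_sub_sq_le (h.mem w) hβ hε), self_mem_nhdsWithin] with b h1 h2 hwb
      have hwb' : w ≤ b := le_of_lt hwb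
      -- As `y b = y w`, both squares of the dissipation inequality are expanded around the same `y
      -- w - α`, whose norm cancels.
      rw [← h1.2, h1.1, hexp, hexp, NNReal.coe_sub hwb'] at h2
      have h3 := hyinc w hw w b hwb'
      rw [inner_sub_right, inner_sub_right] at h3
      have h4 : inner ℝ (x₀ - α) β ≤ inner ℝ (y w - k w - α) β + ρ * ‖β‖ := by
        have h5 : inner ℝ (x₀ - α) β - inner ℝ (y w - k w - α) β
            = inner ℝ (x₀ - (y w - k w)) β := by
          rw [← inner_sub_left, sub_sub_sub_cancel_right]
        have h6 : inner ℝ (x₀ - (y w - k w)) β ≤ ρ * ‖β‖ :=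
          (real_inner_le_norm _ _).trans (by rw [norm_sub_rev]; gcongr; exact hx w hw)
        linarith
      have hd : (0 : ℝ) ≤ b - w := sub_nonneg.2 hwb'
      have h7 := mul_le_mul_of_nonneg_left h4 hd
      linarith
    · intro w hsw hwt η hη
      have hw : w ∈ Icc u v := ⟨hus.trans hsw.le, hwt.trans htv⟩
      have hα : α ∈ closure (opDomain A) := subset_closure ⟨β, hβ⟩
      have hlim : Tendsto (fun b : ℝ≥0 => ((2 * ρ * ‖β‖ + ε) - 2 * inner ℝ (x₀ - α) β) * (b : ℝ))
          (𝓝[<] w) (𝓝 (((2 * ρ * ‖β‖ + ε) - 2 * inner ℝ (x₀ - α) β) * w)) := by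
        have : Continuous fun b : ℝ≥0 =>
            ((2 * ρ * ‖β‖ + ε) - 2 * inner ℝ (x₀ - α) β) * (b : ℝ) := by fun_prop
        exact (this.tendsto w).mono_left nhdsWithin_le_nhds
      filter_upwards [h.jumps.eventually_norm_sub_const_sq_le hp hα w (half_pos hη),
        hlim.eventually_le_const (lt_add_of_pos_right _ (half_pos hη)),
        self_mem_nhdsWithin] with b h1 h2 hbw
      have hbw' : b ≤ w := le_of_lt hbw
      rw [hexp, hexp] at h1
      have h3 := hyinc w hw b w hbw'
      rw [inner_sub_right, inner_sub_right] at h3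
      linarith
  have hd : (0 : ℝ) ≤ t - s := sub_nonneg.2 hst
  refine le_of_forall_pos_le_add fun ε hε => ?_
  have h1 := step (ε / (t - s + 1)) (by positivity)
  have h2 : ε / (t - s + 1) * (t - s) ≤ ε := by
    rw [div_mul_eq_mul_div, div_le_iff₀ (by positivity)]
    nlinarith
  rw [inner_sub_right]
  linarith

/-- Expanding `‖k t‖²` around `k s` turns `y s - α` into `y s - k s - α` and leaves only the
nonnegative `‖k t - k s‖²`. This form, with no integral against `k`, passes to limits. -/
theorem IsStepSolution.variational_ineq (hA : IsMaximalMonotone A)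
    (hp : IsGeneralizedProjection (closure (opDomain A)) p) (h : IsStepSolution A p y k)
    {α β : E} (hβ : β ∈ A α) {s t : ℝ≥0} (hst : s ≤ t) {ρ o : ℝ}
    (hx : ∀ r ∈ Icc s t, ‖y r - k r - (y s - k s)‖ ≤ ρ) (hy : ∀ r ∈ Icc s t, ‖y r - y s‖ ≤ o) :
    ‖k t - k s‖ ^ 2 + 2 * (t - s) * inner ℝ (y s - k s - α) β
      ≤ 2 * inner ℝ (y s - k s - α) (k t - k s) + 2 * ρ * ‖β‖ * (t - s)
        + 2 * o * (pathVar k t - pathVar k s) := by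
  have h1 := h.variational_mono hA hp hβ _ _ hx hy le_rfl hst le_rfl
  have h2 : inner ℝ (y s - k s - α) (k t - k s)
      = inner ℝ (y s - α) (k t - k s) - inner ℝ (k s) (k t - k s) := by
    rw [← inner_sub_left]; congr 1; abel
  have h3 : ‖k t‖ ^ 2 = ‖k s‖ ^ 2 + 2 * inner ℝ (k s) (k t - k s) + ‖k t - k s‖ ^ 2 := by
    rw [← norm_add_sq_real, add_sub_cancel]
  linarith

theorem norm_le_sum_abs_inner {ι : Type*} [Fintype ι] (e : OrthonormalBasis ι ℝ E) (w : E) :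
    ‖w‖ ≤ ∑ i, |inner ℝ (e i) w| := by
  conv_lhs => rw [← e.sum_repr' w]
  refine (norm_sum_le _ _).trans (Finset.sum_le_sum fun i _ => ?_)
  rw [norm_smul, e.norm_eq_one, mul_one, Real.norm_eq_abs]

/-- On time intervals where the driving path oscillates little, the variation of a step solution is
bounded in terms of its initial value. -/
theorem IsMaximalMonotone.exists_variation_bound (hA : IsMaximalMonotone A)
    (hp : IsGeneralizedProjection (closure (opDomain A)) p)
    (hint : (interior (opDomain A)).Nonempty) :
    ∃ (a : E) (o : ℝ) (G : ℝ → ℝ), a ∈ closure (opDomain A) ∧ 0 < o ∧ ∀ (y k : ℝ≥0 → E),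
      IsStepSolution A p y k → ∀ u v : ℝ≥0, u ≤ v → (v : ℝ) ≤ u + 1 →
      (∀ r ∈ Icc u v, ‖y r - y u‖ ≤ o) → ∀ B, ‖y u - k u - a‖ ≤ B →
      pathVar k v - pathVar k u ≤ G B := by
  obtain ⟨a, ha⟩ := hint
  obtain ⟨r, hr, hball⟩ := Metric.nhds_basis_closedBall.mem_iff.1 (mem_interior_iff_mem_nhds.1 ha)
  set e := stdOrthonormalBasis ℝ E with he
  set N := Module.finrank ℝ E
  have hdom : ∀ f : E, ‖f‖ ≤ 1 → ∃ b, b ∈ A (a + r • f) := by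
    intro f hf
    refine hball ?_
    rw [Metric.mem_closedBall, dist_eq_norm, add_sub_cancel_left, norm_smul,
      Real.norm_of_nonneg hr.le]
    nlinarith
  have he1 : ∀ j, ‖e j‖ ≤ 1 := fun j => (e.norm_eq_one j).le
  have he2 : ∀ j, ‖-e j‖ ≤ 1 := fun j => by rw [norm_neg]; exact he1 j
  choose b₁ hb₁ using fun j => hdom (e j) (he1 j)
  choose b₂ hb₂ using fun j => hdom (-e j) (he2 j)
  obtain ⟨b₀, hb₀⟩ := hdom 0 (by simp)
  set M := ‖b₀‖ + ∑ j, (‖b₁ j‖ + ‖b₂ j‖) with hM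
  have hM0 : 0 ≤ M := by positivity
  have hM1 : ∀ j, ‖b₁ j‖ + ‖b₂ j‖ ≤ M := fun j => by
    have := Finset.single_le_sum (f := fun j => ‖b₁ j‖ + ‖b₂ j‖) (fun _ _ => by positivity)
      (Finset.mem_univ j)
    have h0 := norm_nonneg b₀
    linarith
  have hM2 : ‖b₀‖ ≤ M := by
    have : 0 ≤ ∑ j, (‖b₁ j‖ + ‖b₂ j‖) := by positivity
    linarith
  -- `N` coordinates, each bounded by `(H t - H s) / (2 * r)`; `N + 1` keeps `c` positive even in
  -- dimension zero.
  set c : ℝ := (N + 1) / (2 * r) with hc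
  have hc0 : 0 < c := by positivity
  -- Chosen so that the variation term of `c * H` is half the variation of `k`, which can be
  -- absorbed on the left.
  set o : ℝ := (4 * c)⁻¹ with ho
  have ho0 : 0 < o := by positivity
  have hco : c * (2 * o) = 2⁻¹ := by rw [ho]; field_simp; norm_num
  -- The largest displacement `D` will satisfy `D² ≤ (2B + 2M) D + 2 (o + B + r) M`, so it is at
  -- most the sum of the coefficients plus one.
  set D₀ : ℝ → ℝ := fun B => (2 * B + 2 * M) + 2 * (o + B + r) * M + 1 with hD₀
  refine ⟨a, o, fun B => 2 * c * (2 * B * D₀ B + 2 * (o + D₀ B + B + r) * M),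
    subset_closure (interior_subset ha), ho0, ?_⟩
  intro y k h u v huv hvu hy B hB
  have hB0 : 0 ≤ B := (norm_nonneg _).trans hB
  set S := (fun s => ‖k s - k u‖) '' Icc u v with hS
  have hSb : BddAbove S := by
    refine ⟨pathVar k v - pathVar k u, ?_⟩
    rintro _ ⟨s, hs, rfl⟩
    have h1 := norm_sub_le_pathVar h.bv hs.1
    have h2 := pathVar_mono h.bv hs.2
    simp only
    linarith
  have hSn : S.Nonempty := ⟨_, u, ⟨le_rfl, huv⟩, rfl⟩
  set D := sSup S
  have hD : ∀ s ∈ Icc u v, ‖k s - k u‖ ≤ D := fun s hs => le_csSup hSb ⟨s, hs, rfl⟩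
  have hD0 : 0 ≤ D := (norm_nonneg _).trans (hD u ⟨le_rfl, huv⟩)
  have hx : ∀ s ∈ Icc u v, ‖y s - k s - (y u - k u)‖ ≤ o + D := fun s hs => by
    rw [show y s - k s - (y u - k u) = (y s - y u) - (k s - k u) by abel]
    exact (norm_sub_le _ _).trans (add_le_add (hy s hs) (hD s hs))
  set C := 2 * (o + D + B + r) * M with hC
  have hC0 : 0 ≤ C := by positivity
  -- the increments of `H` dominate the increments of `k`
  set H : ℝ≥0 → ℝ := fun t => 2 * inner ℝ (y u - a) (k t) - ‖k t‖ ^ 2 + C * t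
    + 2 * o * pathVar k t with hH
  -- Testing at `a + r • f` inside the domain bounds the component of the increment of `k` along
  -- `f`.
  have dir : ∀ f b, ‖f‖ ≤ 1 → b ∈ A (a + r • f) → ‖b‖ ≤ M → ∀ s t, u ≤ s → s ≤ t → t ≤ v →
      2 * r * inner ℝ f (k t - k s) ≤ H t - H s := by
    intro f b hf hb hbM s t hus hst htv
    have h1 := h.variational_mono hA hp hb (y u - k u) (y u) hx hy hus hst htv
    have hd : (0 : ℝ) ≤ t - s := sub_nonneg.2 hst
    have h2 : -((B + r) * M) ≤ inner ℝ (y u - k u - (a + r • f)) b := by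
      have h3 := neg_le_of_abs_le (abs_real_inner_le_norm (y u - k u - (a + r • f)) b)
      have h4 : ‖y u - k u - (a + r • f)‖ ≤ B + r := by
        rw [← sub_sub]
        refine (norm_sub_le _ _).trans (add_le_add hB ?_)
        rw [norm_smul, Real.norm_of_nonneg hr.le]
        nlinarith
      have h5 : ‖y u - k u - (a + r • f)‖ * ‖b‖ ≤ (B + r) * M := by gcongr
      linarith
    have h3 : (o + D) * ‖b‖ ≤ (o + D) * M := by gcongr
    have h4 := mul_le_mul_of_nonneg_right h2 hd
    have h5 := mul_le_mul_of_nonneg_right h3 hd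
    have h6 : inner ℝ (y u - (a + r • f)) (k t - k s)
        = inner ℝ (y u - a) (k t) - inner ℝ (y u - a) (k s) - r * inner ℝ f (k t - k s) := by
      rw [← sub_sub, inner_sub_left, inner_smul_left, inner_sub_right (y u - a)]
      simp
    simp only [hH, hC]
    rw [h6] at h1
    linarith
  have incr : ∀ s t, u ≤ s → s ≤ t → t ≤ v → ‖k t - k s‖ ≤ c * H t - c * H s := by
    intro s t hus hst htv
    have h0 : 0 ≤ H t - H s := by
      simpa using dir 0 b₀ (by simp) hb₀ hM2 s t hus hst htv
    have h1 : ∀ j, |inner ℝ (e j) (k t - k s)| ≤ (H t - H s) / (2 * r) := by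
      intro j
      have h2 := dir _ _ (he1 j) (hb₁ j) (by linarith [hM1 j, norm_nonneg (b₂ j)]) s t hus hst htv
      have h3 := dir _ _ (he2 j) (hb₂ j) (by linarith [hM1 j, norm_nonneg (b₁ j)]) s t hus hst htv
      rw [inner_neg_left] at h3
      rw [le_div_iff₀ (by positivity), ← abs_of_pos (by positivity : 0 < 2 * r), ← abs_mul]
      exact abs_le.2 ⟨by linarith, by linarith⟩
    calc ‖k t - k s‖ ≤ ∑ j, |inner ℝ (e j) (k t - k s)| := norm_le_sum_abs_inner e _
      _ ≤ ∑ _j : Fin N, (H t - H s) / (2 * r) := Finset.sum_le_sum fun j _ => h1 j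
      _ = N * ((H t - H s) / (2 * r)) := by simp
      _ ≤ (N + 1) * ((H t - H s) / (2 * r)) := by gcongr; linarith
      _ = c * H t - c * H s := by rw [hc]; ring
  have var : ∀ t ∈ Icc u v, pathVar k t - pathVar k u
      ≤ 2 * c * (2 * B * ‖k t - k u‖ - ‖k t - k u‖ ^ 2 + C) := by
    intro t ht
    have h1 := pathVar_sub_le h.bv (H := fun t => c * H t) ht.1
      fun s w hs hsw hw => incr s w hs hsw (hw.trans ht.2)
    have h3 : ‖k t‖ ^ 2 = ‖k u‖ ^ 2 + 2 * inner ℝ (k u) (k t - k u) + ‖k t - k u‖ ^ 2 := by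
      rw [← norm_add_sq_real, add_sub_cancel]
    have h4 : inner ℝ (y u - a) (k t) - inner ℝ (y u - a) (k u) - inner ℝ (k u) (k t - k u)
        ≤ B * ‖k t - k u‖ := by
      have : inner ℝ (y u - a) (k t) - inner ℝ (y u - a) (k u) - inner ℝ (k u) (k t - k u)
          = inner ℝ (y u - k u - a) (k t - k u) := by
        rw [← inner_sub_right, ← inner_sub_left]; congr 1; abel
      rw [this]
      exact (real_inner_le_norm _ _).trans (by gcongr)
    have h5 : (t : ℝ) - u ≤ 1 := by
      have : (t : ℝ) ≤ v := ht.2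
      linarith
    have h6 := mul_le_mul_of_nonneg_left h5 hC0
    have h7 : H t - H u ≤ (2 * B * ‖k t - k u‖ - ‖k t - k u‖ ^ 2 + C)
        + 2 * o * (pathVar k t - pathVar k u) := by
      simp only [hH]
      linarith
    have h8 := mul_le_mul_of_nonneg_left h7 hc0.le
    have h9 : c * (2 * o * (pathVar k t - pathVar k u)) = 2⁻¹ * (pathVar k t - pathVar k u) := by
      rw [← hco]; ring
    linarith
  -- The variation is nonnegative, so the negative square in `var` bounds the displacement; `C` is
  -- affine in `D`, which closes the estimate.
  have hsq : ∀ t ∈ Icc u v, ‖k t - k u‖ ^ 2 ≤ 2 * B * D + C := by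
    intro t ht
    have h1 := var t ht
    have h2 : 0 ≤ pathVar k t - pathVar k u := sub_nonneg.2 (pathVar_mono h.bv ht.1)
    have h3 : 0 ≤ 2 * B * ‖k t - k u‖ - ‖k t - k u‖ ^ 2 + C :=
      nonneg_of_mul_nonneg_right (h2.trans h1) (by positivity)
    have h4 : 2 * B * ‖k t - k u‖ ≤ 2 * B * D := by gcongr; exact hD t ht
    linarith
  have hDle : D ≤ D₀ B := by
    have h1 : D ≤ √(2 * B * D + C) := by
      refine csSup_le hSn ?_
      rintro _ ⟨t, ht, rfl⟩
      exact Real.le_sqrt_of_sq_le (hsq t ht)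
    have h2 : D ^ 2 ≤ 2 * B * D + C := by
      rw [← Real.sq_sqrt (by positivity : 0 ≤ 2 * B * D + C)]
      gcongr
    by_contra! h3
    have h4 : 0 ≤ 2 * (o + B + r) * M := by positivity
    have h5 : 1 ≤ D := by
      simp only [hD₀] at h3
      nlinarith
    simp only [hD₀] at h3
    simp only [hC] at h2
    nlinarith
  refine (var v ⟨huv, le_rfl⟩).trans ?_
  have h1 : 2 * B * ‖k v - k u‖ ≤ 2 * B * D₀ B := by
    gcongr
    exact (hD v ⟨huv, le_rfl⟩).trans hDle
  have h2 : C ≤ 2 * (o + D₀ B + B + r) * M := by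
    simp only [hC]; gcongr
  have h3 := sq_nonneg ‖k v - k u‖
  exact mul_le_mul_of_nonneg_left (by linarith) (by positivity)

/-- Uniform bounds for the variation of step solutions driven by uniformly close paths. -/
theorem IsMaximalMonotone.exists_pathVar_le (hA : IsMaximalMonotone A)
    (hp : IsGeneralizedProjection (closure (opDomain A)) p)
    (hint : (interior (opDomain A)).Nonempty) :
    ∃ ε₀ > 0, ∀ (ι : Type) (y : ι → ℝ≥0 → E) (k : ι → ℝ≥0 → E) (y₀ : ℝ≥0 → E), IsCadlag y₀ →
      (∀ i, IsStepSolution A p (y i) (k i)) → (∀ i t, ‖y i t - y₀ t‖ ≤ ε₀) →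
      ∀ T, ∃ C, ∀ i, ∀ t ≤ T, pathVar (k i) t ≤ C := by
  obtain ⟨a, o, G, ha, ho, hG⟩ := hA.exists_variation_bound hp hint
  -- An oscillation `o / 2` of `y₀` plus two approximation errors `o / 4` stays within the allowed
  -- `o`.
  refine ⟨o / 4, by positivity, fun ι y k y₀ hy₀ h hy => ?_⟩
  have hyy : ∀ i s t, ‖y i t - y i s‖ ≤ ‖y₀ t - y₀ s‖ + o / 2 := fun i s t => by
    have h1 := hy i s
    have h2 := hy i t
    rw [norm_sub_rev] at h1
    rw [show y i t - y i s = (y i t - y₀ t) + (y₀ s - y i s) + (y₀ t - y₀ s) by abel]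
    refine norm_add₃_le.trans ?_
    linarith
  have hxb : ∀ i s t, ‖y i t - k i s - a‖ ≤ ‖y₀ t‖ + o / 4 + ‖a‖ + pathVar (k i) s := by
    intro i s t
    have h1 := norm_sub_le_pathVar (h i).bv (zero_le (a := s))
    rw [(h i).k_zero, sub_zero, pathVar_zero, sub_zero] at h1
    have h2 := norm_sub_le (y i t - k i s) a
    have h3 := norm_sub_le (y i t) (k i s)
    have h4 := norm_le_insert' (y i t) (y₀ t)
    have h5 := hy i t
    linarith
  refine forall_of_right_of_left ?_ ?_ ?_ ?_
  · refine ⟨0, fun i t ht => ?_⟩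
    rw [le_antisymm ht zero_le, pathVar_zero]
  · rintro s t hst ⟨C, hC⟩
    exact ⟨C, fun i r hr => hC i r (hr.trans hst)⟩
  · rintro t ⟨C, hC⟩
    obtain ⟨s, ⟨hs, hst⟩, hs1⟩ := ((hy₀.eventually_forall_Ioc_norm_sub_le t
      (half_pos ho)).and self_mem_nhdsWithin |>.and
      (Ioc_mem_nhdsGT (lt_add_of_pos_right t zero_lt_one))).exists
    set B := ‖y₀ t‖ + o / 4 + ‖a‖ + C
    refine ⟨s, hst, max C (C + G B), fun i r hr => ?_⟩
    rcases le_or_gt r t with hrt | htr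
    · exact (hC i r hrt).trans (le_max_left _ _)
    · refine le_trans ?_ (le_max_right _ _)
      have h1 := hG _ _ (h i) t r htr.le (by exact_mod_cast hr.trans hs1.2) ?_ B ?_
      · linarith [hC i t le_rfl]
      · intro w hw
        rcases hw.1.eq_or_lt with rfl | htw
        · rw [sub_self, norm_zero]; exact ho.le
        · linarith [hyy i t w, hs w ⟨htw, hw.2.trans hr⟩]
      · simp only [B]; linarith [hxb i t t, hC i t le_rfl]
  · intro t ht hlt
    obtain ⟨l, hl⟩ := (hy₀ t).2
    have hl' := Metric.tendsto_nhds.1 hl (o / 4) (by positivity)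
    have hl'' : ∀ᶠ s in 𝓝[<] t, s ∈ Ioo (t - 1) t :=
      Ioo_mem_nhdsLT (tsub_lt_self ht zero_lt_one)
    obtain ⟨s₀, hs₀, hsub⟩ := (mem_nhdsLT_iff_exists_Ioo_subset' ht).1 (hl'.and hl'')
    obtain ⟨s, hs0, hst⟩ := exists_between (mem_Iio.1 hs₀)
    obtain ⟨C, hC⟩ := hlt s hst
    obtain ⟨C₀, hC₀⟩ := hy₀.exists_bound t
    set B := C₀ + o / 4 + ‖a‖ + C
    set C₁ := max C (C + G B)
    set B₂ := C₀ + o / 4 + ‖a‖ + C₁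
    have hC₁ : ∀ i, ∀ r < t, pathVar (k i) r ≤ C₁ := by
      intro i r hr
      rcases le_or_gt r s with hrs | hsr
      · exact (hC i r hrs).trans (le_max_left _ _)
      · refine le_trans ?_ (le_max_right _ _)
        have h1 := hG _ _ (h i) s r hsr.le ?_ ?_ B ?_
        · linarith [hC i s le_rfl]
        · have h2 : (t : ℝ≥0) ≤ s + 1 := by
            rw [← tsub_le_iff_right]
            exact (hsub ⟨hs0, hst⟩).2.1.le
          exact_mod_cast hr.le.trans h2
        · intro w hw
          have h2 : dist (y₀ w) l < o / 4 := (hsub ⟨hs0.trans_le hw.1, hw.2.trans_lt hr⟩).1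
          have h3 : dist (y₀ s) l < o / 4 := (hsub ⟨hs0, hst⟩).1
          have h4 := dist_triangle_right (y₀ w) (y₀ s) l
          rw [dist_eq_norm (y₀ w) (y₀ s)] at h4
          linarith [hyy i s w]
        · simp only [B]; linarith [hxb i s s, hC i s le_rfl, hC₀ s hst.le]
    -- `C₁` bounds the variation strictly before the endpoint. The state is within `B₂` of `a` both
    -- before and after the correction there, since `p` fixes `a`, so the last jump adds at most `2
    -- * B₂`.
    refine ⟨max C₁ (C₁ + 2 * B₂), fun i r hr => ?_⟩
    rcases hr.lt_or_eq with hrt | rfl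
    · exact (hC₁ i r hrt).trans (le_max_left _ _)
    refine le_trans ?_ (le_max_right _ _)
    have : (𝓝[<] r).NeBot := nhdsLT_neBot_of_exists_lt ⟨s, hst⟩
    have hB₂ : ∀ᶠ w in 𝓝[<] r, ‖y i r - k i w - a‖ ≤ B₂ := by
      filter_upwards [self_mem_nhdsWithin] with w hw
      simp only [B₂]; linarith [hxb i w r, hC₁ i w hw, hC₀ r le_rfl]
    have h1 : ‖y i r - k i r - a‖ ≤ B₂ := by
      refine le_of_tendsto (((h i).jumps r).sub_const a).norm ?_
      filter_upwards [hB₂] with w hw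
      have h2 := hp.nonexpansive (y i r - k i w) a
      rw [hp.eq_self a ha] at h2
      exact h2.trans hw
    obtain ⟨m, hm⟩ := (h i).bv.exists_tendsto_nhdsLT r
    have h2 : dist (k i r) m ≤ 2 * B₂ := by
      refine le_of_tendsto (tendsto_const_nhds.dist hm) ?_
      filter_upwards [hB₂] with w hw
      rw [dist_eq_norm, show k i r - k i w
        = (y i r - k i w - a) - (y i r - k i r - a) by abel]
      refine (norm_sub_le _ _).trans (by linarith)
    have h3 : pathVar (k i) r - dist (k i r) m ≤ C₁ := by
      refine le_of_tendsto (pathVar_tendsto_left (h i).bv hm) ?_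
      filter_upwards [self_mem_nhdsWithin] with w hw
      exact hC₁ i w hw
    linarith

end StepSolutions

/-! ### From the local to the integral variational inequality. -/

section VariationalInequality

variable {E : Type*} [NormedAddCommGroup E] [InnerProductSpace ℝ E] [CompleteSpace E]

/-- The variational inequality for the continuous part of `k` follows from its local form for `k`,
with an error controlled by a monotone function. -/
theorem stieltjesIntegral_contPart_sub_nonneg {x k : ℝ≥0 → E} (hx : IsCadlag x) (hk : IsCadlag k)
    (hbv : LocallyBoundedVariationOn k univ) {α β : E} {V : ℝ≥0 → ℝ} (hV : Monotone V)
    (hloc : ∀ t, ∀ ε > 0, ∀ᶠ s : ℝ≥0 in 𝓝[>] t, ((s : ℝ) - t) * inner ℝ (x t - α) β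
      ≤ inner ℝ (x t - α) (k s - k t) + ε * (V s - V t + (s - t)))
    {s₀ t₀ : ℝ≥0} (hst : s₀ ≤ t₀) :
    0 ≤ stieltjesIntegral (fun u => x u - α) (contPart k) hbv.contPart s₀ t₀
      - ∫ u in (s₀ : ℝ)..(t₀ : ℝ), inner ℝ (x u.toNNReal - α) β := by
  have hxα := hx.sub_const α
  have hr : ∀ t, ContinuousWithinAt (contPart k) (Ici t) t := fun t => by
    rw [← continuousWithinAt_Ioi_iff_Ici]
    exact tendsto_contPart_right hbv (hk.tendsto_right t)
  obtain ⟨B, hB⟩ := hxα.exists_bound t₀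
  have hB0 : 0 ≤ B := (norm_nonneg _).trans (hB 0 zero_le)
  set Vc := pathVar (contPart k) with hVc
  have mVc : Monotone Vc := pathVar_mono hbv.contPart
  have main : ∀ ε > 0, 0 ≤ (stieltjesIntegral (fun u => x u - α) (contPart k) hbv.contPart s₀ t₀
      - ∫ u in (s₀ : ℝ)..(t₀ : ℝ), inner ℝ (x u.toNNReal - α) β)
      + ε * (Vc t₀ - Vc s₀ + (V t₀ - V s₀) + 2 * (t₀ - s₀) + B) := by
    intro ε hε
    obtain ⟨F, W, -, mW, W0, Wε, hW⟩ := exists_contPart_sub_le hbv hst hε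
    have key := le_of_forall_eventually_le (a := s₀) (b := t₀) (f := fun t : ℝ≥0 =>
      (stieltjesIntegral (fun u => x u - α) (contPart k) hbv.contPart s₀ t
        - ∫ u in (s₀ : ℝ)..(t : ℝ), inner ℝ (x u.toNNReal - α) β)
      + (ε * (Vc t + V t + 2 * t) + B * W t)) hst ?_ ?_
    · have h1 := abs_stieltjesIntegral_sub_inner_le hxα hbv.contPart hr (le_refl s₀) (c := 0)
        (ε := 0) (fun u hu => absurd hu.1 (not_lt.2 hu.2))
      have h2 : stieltjesIntegral (fun u => x u - α) (contPart k) hbv.contPart s₀ s₀ = 0 := by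
        simpa using h1
      simp only [h2, intervalIntegral.integral_same] at key
      have h3 : B * W t₀ ≤ B * ε := mul_le_mul_of_nonneg_left (Wε t₀ le_rfl) hB0
      have h4 : 0 ≤ B * W s₀ := mul_nonneg hB0 (W0 s₀)
      linarith
    · intro t hst' htt
      filter_upwards [hloc t ε hε, eventually_norm_contPart_sub_le hW t,
        hx.eventually_forall_Ioc_norm_sub_le t hε,
        hx.eventually_abs_integral_inner_sub_le α β t hε, self_mem_nhdsWithin] with s h1 h2 h3 h4 hts
      have hts' : t ≤ s := le_of_lt hts
      rw [← stieltjesIntegral_add hxα hbv.contPart hr hst' hts',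
        ← hx.integral_inner_add α β s₀ t s]
      have h5 := abs_le.1 (abs_stieltjesIntegral_sub_inner_le hxα hbv.contPart hr hts'
        (c := x t - α) (ε := ε) fun u hu => by rw [sub_sub_sub_cancel_right]; exact h3 u hu)
      have h6 : inner ℝ (x t - α) (k s - k t) - B * (W s - W t)
          ≤ inner ℝ (x t - α) (contPart k s - contPart k t) := by
        have h7 := abs_le.1 (abs_real_inner_le_norm (x t - α)
          (contPart k s - contPart k t - (k s - k t)))
        have h8 : ‖x t - α‖ * ‖contPart k s - contPart k t - (k s - k t)‖ ≤ B * (W s - W t) := by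
          have := hB t htt.le
          gcongr
        rw [inner_sub_right] at h7
        linarith
      have h9 := abs_le.1 h4
      simp only [← hVc] at h5
      linarith
    · intro t hst' htt η hη
      -- Since `contPart k` has no jumps, its variation is left continuous and both integrals over
      -- `(s, t]` vanish as `s` increases to `t`.
      have hlim : Tendsto (fun s : ℝ≥0 => B * (Vc t - Vc s) + B * ‖β‖ * ((t : ℝ) - s))
          (𝓝[<] t) (𝓝 0) := by
        have h1 := pathVar_tendsto_left hbv.contPart (tendsto_contPart_left hbv t)
        rw [dist_self, sub_zero, ← hVc] at h1
        have h2 : Tendsto (fun s : ℝ≥0 => (s : ℝ)) (𝓝[<] t) (𝓝 t) :=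
          (NNReal.continuous_coe.tendsto t).mono_left nhdsWithin_le_nhds
        have h3 := ((h1.const_sub (Vc t)).const_mul B).add ((h2.const_sub (t : ℝ)).const_mul
          (B * ‖β‖))
        simpa using h3
      filter_upwards [hlim.eventually_le_const hη, Ico_mem_nhdsLT hst'] with s h1 hs
      have hst'' : s ≤ t := hs.2.le
      rw [← stieltjesIntegral_add hxα hbv.contPart hr hs.1 hst'',
        ← hx.integral_inner_add α β s₀ s t]
      have h2 := abs_le.1 (abs_stieltjesIntegral_sub_inner_le hxα hbv.contPart hr hst''
        (c := 0) (ε := B) fun u hu => by rw [sub_zero]; exact hB u (hu.2.trans htt))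
      have h3 := abs_le.1 (hx.abs_integral_inner_sub_le α β hst'' (c := 0) (ε := B * ‖β‖)
        fun u hu => by
          rw [sub_zero]
          refine (abs_real_inner_le_norm _ _).trans ?_
          have := hB u (hu.2.trans htt)
          gcongr)
      rw [inner_zero_left, sub_zero] at h2
      rw [mul_zero, sub_zero] at h3
      simp only [← hVc] at h2
      have h4 := mul_le_mul_of_nonneg_left (mVc hst'') hε.le
      have h5 := mul_le_mul_of_nonneg_left (hV hst'') hε.le
      have h6 := mul_le_mul_of_nonneg_left (NNReal.coe_le_coe.2 hst'') hε.le
      have h7 := mul_le_mul_of_nonneg_left (mW hst'') hB0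
      linarith
  set R := Vc t₀ - Vc s₀ + (V t₀ - V s₀) + 2 * ((t₀ : ℝ) - s₀) + B with hR
  have hR0 : 0 ≤ R := by
    have h1 := mVc hst
    have h2 := hV hst
    have h3 := NNReal.coe_le_coe.2 hst
    simp only [hR]
    linarith
  refine le_of_forall_pos_le_add fun ε hε => ?_
  have h1 := main (ε / (R + 1)) (by positivity)
  have h2 : ε / (R + 1) * R ≤ ε := by
    rw [div_mul_eq_mul_div, div_le_iff₀ (by positivity)]
    nlinarith
  linarith

end VariationalInequality

/-! ### Passing to the limit in the step solutions. -/

section Limit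

variable {E : Type*} [NormedAddCommGroup E] [InnerProductSpace ℝ E] [FiniteDimensional ℝ E]
  {A : E → Set E} {p : E → E}

theorem IsStepSolution.tendsto_right {y k : ℝ≥0 → E} (hA : IsMaximalMonotone A)
    (h : IsStepSolution A p y k) (t : ℝ≥0) : Tendsto k (𝓝[>] t) (𝓝 (k t)) := by
  have h1 : Tendsto (fun s : ℝ≥0 => y t - opFlow A (s - t) (y t - k t)) (𝓝[>] t) (𝓝 (k t)) := by
    have h2 : Continuous fun s : ℝ≥0 => y t - opFlow A (s - t) (y t - k t) :=
      continuous_const.sub ((hA.continuous_opFlow (h.mem t)).comp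
        (continuous_id.sub continuous_const))
    have h3 := h2.tendsto t
    simp only [tsub_self, opFlow_zero, sub_sub_cancel] at h3
    exact h3.mono_left nhdsWithin_le_nhds
  refine h1.congr' ?_
  filter_upwards [h.right t] with s hs
  rw [← hs.2, hs.1, sub_sub_cancel]

theorem HasProjectedJumps.of_limit {D : Set E} (hp : IsGeneralizedProjection D p)
    {y k : ℝ≥0 → E}
    (h : ∀ T, ∀ ε > 0, ∃ y' k' : ℝ≥0 → E, HasProjectedJumps p y' k' ∧
      ∀ t ≤ T, ‖y' t - y t‖ ≤ ε ∧ ‖k' t - k t‖ ≤ ε) : HasProjectedJumps p y k := by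
  intro t
  rw [Metric.tendsto_nhds]
  intro ε hε
  obtain ⟨y', k', h', hyk⟩ := h t (ε / 8) (by positivity)
  filter_upwards [Metric.tendsto_nhds.1 (h' t) (ε / 2) (by positivity), self_mem_nhdsWithin]
    with s h1 hs
  have h2 := hp.nonexpansive (y t - k s) (y' t - k' s)
  have h3 := (hyk t le_rfl).1
  have h4 := (hyk t le_rfl).2
  have h5 := (hyk s (le_of_lt hs)).2
  have h6 : ‖(y t - k s) - (y' t - k' s)‖ ≤ ε / 8 + ε / 8 := by
    rw [show (y t - k s) - (y' t - k' s) = (k' s - k s) - (y' t - y t) by abel]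
    exact (norm_sub_le _ _).trans (by linarith)
  have h7 : ‖(y' t - k' t) - (y t - k t)‖ ≤ ε / 8 + ε / 8 := by
    rw [show (y' t - k' t) - (y t - k t) = (y' t - y t) - (k' t - k t) by abel]
    exact (norm_sub_le _ _).trans (by linarith)
  rw [dist_eq_norm] at h1 ⊢
  rw [show p (y t - k s) - (y t - k t) = (p (y t - k s) - p (y' t - k' s))
    + (p (y' t - k' s) - (y' t - k' t)) + ((y' t - k' t) - (y t - k t)) by abel]
  refine norm_add₃_le.trans_lt ?_
  linarith

theorem HasProjectedJumps.eq_of_jump_ne_zero {D : Set E} (hp : IsGeneralizedProjection D p)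
    {y x k : ℝ≥0 → E} (h : HasProjectedJumps p y k) (hy : IsCadlag y) (hk : IsCadlag k)
    (hx : ∀ t, x t = y t - k t) {t : ℝ≥0} (hj : 0 < ‖jump k t‖) :
    x t = p (Function.leftLim x t + jump y t) := by
  rcases eq_or_ne (𝓝[<] t) ⊥ with hb | hb
  · rw [jump, leftLim_eq_of_eq_bot _ hb, sub_self, norm_zero] at hj
    exact absurd hj (lt_irrefl _)
  have : (𝓝[<] t).NeBot := ⟨hb⟩
  have h1 := (hy.tendsto_leftLim t).sub (hk.tendsto_leftLim t)
  have h2 : Function.leftLim x t = Function.leftLim y t - Function.leftLim k t :=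
    leftLim_eq_of_tendsto (h1.congr fun s => (hx s).symm)
  have h3 : Tendsto (fun s => p (y t - k s)) (𝓝[<] t) (𝓝 (p (y t - Function.leftLim k t))) :=
    (hp.continuous.tendsto _).comp ((hk.tendsto_leftLim t).const_sub (y t))
  rw [h2, jump, show Function.leftLim y t - Function.leftLim k t + (y t - Function.leftLim y t)
    = y t - Function.leftLim k t by abel, hx]
  exact tendsto_nhds_unique (h t) h3

/-- Pointwise limits along an ultrafilter of monotone functions which are locally uniformly
bounded. -/
theorem exists_monotone_ultrafilter_limit {ι : Type*} (U : Ultrafilter ι) {V : ι → ℝ≥0 → ℝ}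
    (hV : ∀ i, Monotone (V i)) (h0 : ∀ i t, 0 ≤ V i t) (hb : ∀ t, ∃ C, ∀ i, V i t ≤ C) :
    ∃ V' : ℝ≥0 → ℝ, Monotone V' ∧ ∀ t, Tendsto (fun i => V i t) U (𝓝 (V' t)) := by
  have hlim : ∀ t, ∃ v, Tendsto (fun i => V i t) U (𝓝 v) := by
    intro t
    obtain ⟨C, hC⟩ := hb t
    obtain ⟨v, -, hv⟩ := (isCompact_Icc (a := (0 : ℝ)) (b := C)).ultrafilter_le_nhds
      (U.map fun i => V i t) (by
        rw [Ultrafilter.coe_map, le_principal_iff]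
        exact Filter.mem_map.2 (univ_mem' fun i => ⟨h0 i t, hC i⟩))
    exact ⟨v, hv⟩
  choose V' hV' using hlim
  exact ⟨V', fun s t hst => le_of_tendsto_of_tendsto' (hV' s) (hV' t) fun i => hV i hst, hV'⟩

/-- Limits of step solutions driven by paths converging uniformly solve the Skorokhod problem. -/
theorem IsMaximalMonotone.exists_isSkorokhodSolution_of_tendsto (hA : IsMaximalMonotone A)
    (hp : IsGeneralizedProjection (closure (opDomain A)) p)
    (hint : (interior (opDomain A)).Nonempty) :
    ∃ ε₀ > 0, ∀ (y : ℝ≥0 → E) (yn kn : ℕ → ℝ≥0 → E) (ε : ℕ → ℝ), IsCadlag y →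
      (∀ n, IsStepSolution A p (yn n) (kn n)) → (∀ n t, ‖yn n t - y t‖ ≤ ε n) →
      (∀ n, ε n ≤ ε₀) → Tendsto ε atTop (𝓝 0) →
      ∃ k, IsSkorokhodSolution A p y (fun t => y t - k t) k ∧
        ∀ t, Tendsto (fun n => kn n t) atTop (𝓝 (k t)) := by
  obtain ⟨ε₀, hε₀, hbound⟩ := hA.exists_pathVar_le hp hint
  refine ⟨ε₀, hε₀, fun y yn kn ε hy h hyn hε hε' => ?_⟩
  have hV := hbound ℕ yn kn y hy h fun n t => (hyn n t).trans (hε n)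
  have hyt : ∀ t, Tendsto (fun n => yn n t) atTop (𝓝 (y t)) := fun t => by
    rw [tendsto_iff_norm_sub_tendsto_zero]
    exact squeeze_zero (fun _ => norm_nonneg _) (fun n => hyn n t) hε'
  have hpair : ∀ T C, (∀ n, ∀ t ≤ T, pathVar (kn n) t ≤ C) → ∀ t ≤ T, ∀ n m,
      ‖kn n t - kn m t‖ ≤ √(2 * (ε n + ε m) * (C + C)) := by
    intro T C hC t ht n m
    refine Real.le_sqrt_of_sq_le (((h n).norm_sub_sq_le hA hp (h m) (T := t) (ε := ε n + ε m)
      fun s _ => ?_).trans ?_)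
    · rw [show yn n s - yn m s = (yn n s - y s) - (yn m s - y s) by abel]
      exact (norm_sub_le _ _).trans (add_le_add (hyn n s) (hyn m s))
    · have h1 : 0 ≤ ε n := (norm_nonneg _).trans (hyn n 0)
      have h2 : 0 ≤ ε m := (norm_nonneg _).trans (hyn m 0)
      have h3 := hC n t ht
      have h4 := hC m t ht
      gcongr
  have hcauchy : ∀ t, CauchySeq fun n => kn n t := by
    intro t
    obtain ⟨C, hC⟩ := hV t
    have h1 : Tendsto (fun q : ℕ × ℕ => √(2 * (ε q.1 + ε q.2) * (C + C))) (atTop ×ˢ atTop)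
        (𝓝 √(2 * (0 + 0) * (C + C))) :=
      ((((hε'.comp tendsto_fst).add (hε'.comp tendsto_snd)).const_mul 2).mul_const _).sqrt
    rw [add_zero, mul_zero, zero_mul, Real.sqrt_zero] at h1
    rw [cauchySeq_iff_tendsto_dist_atTop_0, ← prod_atTop_atTop_eq]
    refine squeeze_zero (fun _ => dist_nonneg) (fun q => ?_) h1
    rw [dist_eq_norm]
    exact hpair t C hC t le_rfl q.1 q.2
  choose k hk using fun t => cauchySeq_tendsto_of_complete (hcauchy t)
  have hunif : ∀ T, ∀ η > 0, ∀ᶠ n in atTop, ∀ t ≤ T, ‖kn n t - k t‖ ≤ η := by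
    intro T η hη
    obtain ⟨C, hC⟩ := hV T
    have h1 : Tendsto (fun n => √(2 * (ε n + 0) * (C + C))) atTop (𝓝 √(2 * (0 + 0) * (C + C))) :=
      (((hε'.add_const 0).const_mul 2).mul_const _).sqrt
    have h1' : √(2 * (0 + 0) * (C + C)) < η := by simpa using hη
    filter_upwards [h1.eventually_le_const h1'] with n hn t ht
    refine le_trans ?_ hn
    have h2 : Tendsto (fun m => √(2 * (ε n + ε m) * (C + C))) atTop
        (𝓝 √(2 * (ε n + 0) * (C + C))) := ((((hε'.const_add _).const_mul 2).mul_const _).sqrt)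
    exact le_of_tendsto_of_tendsto' ((hk t).const_sub _).norm h2 fun m => hpair T C hC t ht n m
  -- Along an ultrafilter the bounded variations converge at every time. The limit `V` need not be
  -- the variation of `k`; it is enough that its increments dominate those of `k`.
  set U : Ultrafilter ℕ := Ultrafilter.of atTop with hU
  have hUle : (U : Filter ℕ) ≤ atTop := Ultrafilter.of_le _
  obtain ⟨V, mV, hVlim⟩ := exists_monotone_ultrafilter_limit U (V := fun n => pathVar (kn n))
    (fun n => pathVar_mono (h n).bv) (fun n t => pathVar_nonneg _ _)
    (fun t => (hV t).imp fun C hC n => hC n t le_rfl)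
  have hkV : ∀ s t, s ≤ t → ‖k t - k s‖ ≤ V t - V s := fun s t hst =>
    le_of_tendsto_of_tendsto' (((hk t).sub (hk s)).norm.mono_left hUle)
      ((hVlim t).sub (hVlim s)) fun n => norm_sub_le_pathVar (h n).bv hst
  have hbv : LocallyBoundedVariationOn k univ := locallyBoundedVariationOn_of_norm_sub_le hkV
  have hkc : IsCadlag k := by
    refine IsCadlag.of_tendsto (fun t => ?_) fun t => hbv.exists_tendsto_nhdsLT t
    rw [Metric.tendsto_nhds]
    intro η hη
    obtain ⟨n, hn⟩ := (hunif (t + 1) (η / 4) (by positivity)).exists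
    filter_upwards [Metric.tendsto_nhds.1 ((h n).tendsto_right hA t) (η / 2) (by positivity),
      Ioc_mem_nhdsGT (lt_add_of_pos_right t zero_lt_one)] with s h1 hs
    have h2 := hn s hs.2
    have h3 := hn t le_self_add
    rw [dist_eq_norm] at h1 ⊢
    rw [norm_sub_rev] at h2
    rw [show k s - k t = (k s - kn n s) + (kn n s - kn n t) + (kn n t - k t) by abel]
    refine norm_add₃_le.trans_lt ?_
    linarith
  have hxc : IsCadlag fun t => y t - k t := hy.sub hkc
  have hjumps : HasProjectedJumps p y k := by
    refine HasProjectedJumps.of_limit hp fun T η hη => ?_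
    obtain ⟨n, h1, h2⟩ := ((hunif T η hη).and (hε'.eventually_le_const hη)).exists
    exact ⟨yn n, kn n, (h n).jumps, fun t ht => ⟨(hyn n t).trans h2, h1 t ht⟩⟩
  have hvar : ∀ α β, β ∈ A α → ∀ s t : ℝ≥0, s ≤ t → ∀ ρ o,
      (∀ r ∈ Icc s t, ‖y r - k r - (y s - k s)‖ ≤ ρ) → (∀ r ∈ Icc s t, ‖y r - y s‖ ≤ o) →
      ‖k t - k s‖ ^ 2 + 2 * (t - s) * inner ℝ (y s - k s - α) β
        ≤ 2 * inner ℝ (y s - k s - α) (k t - k s) + 2 * ρ * ‖β‖ * (t - s)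
          + 2 * o * (V t - V s) := by
    intro α β hβ s t hst ρ o hρ ho
    refine le_of_forall_pos_le_add fun η' hη' => ?_
    set R := 2 * ‖β‖ * ((t : ℝ) - s) + 2 * (V t - V s) with hR
    have hR0 : 0 ≤ R := by
      have h1 := mV hst
      have h2 : 0 ≤ 2 * ‖β‖ * ((t : ℝ) - s) :=
        mul_nonneg (by positivity) (sub_nonneg.2 (NNReal.coe_le_coe.2 hst))
      linarith
    set η := η' / (R + 1) with hη
    have hη0 : 0 < η := by positivity
    have hηR : η * R ≤ η' := by
      rw [hη, div_mul_eq_mul_div, div_le_iff₀ (by positivity)]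
      nlinarith
    have ev : ∀ᶠ n in (U : Filter ℕ), ‖kn n t - kn n s‖ ^ 2
          + 2 * (t - s) * inner ℝ (yn n s - kn n s - α) β
        ≤ 2 * inner ℝ (yn n s - kn n s - α) (kn n t - kn n s) + 2 * (ρ + η) * ‖β‖ * (t - s)
          + 2 * (o + η) * (pathVar (kn n) t - pathVar (kn n) s) := by
      refine hUle ?_
      filter_upwards [hunif t (η / 4) (by positivity), hε'.eventually_le_const
        (show (0 : ℝ) < η / 4 by positivity)] with n h1 h2
      refine (h n).variational_ineq hA hp hβ hst (fun r hr => ?_) fun r hr => ?_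
      · rw [show yn n r - kn n r - (yn n s - kn n s) = (y r - k r - (y s - k s))
          + ((yn n r - y r) - (yn n s - y s)) - ((kn n r - k r) - (kn n s - k s)) by abel]
        have h3 := norm_sub_le ((y r - k r - (y s - k s)) + ((yn n r - y r) - (yn n s - y s)))
          ((kn n r - k r) - (kn n s - k s))
        have h4 := norm_add_le (y r - k r - (y s - k s)) ((yn n r - y r) - (yn n s - y s))
        have h5 := norm_sub_le (yn n r - y r) (yn n s - y s)
        have h6 := norm_sub_le (kn n r - k r) (kn n s - k s)
        linarith [hyn n r, hyn n s, h1 r hr.2, h1 s hst, hρ r hr]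
      · rw [show yn n r - yn n s = (y r - y s) + ((yn n r - y r) - (yn n s - y s)) by abel]
        have h4 := norm_add_le (y r - y s) ((yn n r - y r) - (yn n s - y s))
        have h5 := norm_sub_le (yn n r - y r) (yn n s - y s)
        linarith [hyn n r, hyn n s, ho r hr]
    have hxs : Tendsto (fun n => yn n s - kn n s - α) U (𝓝 (y s - k s - α)) :=
      (((hyt s).sub (hk s)).sub_const α).mono_left hUle
    have hδ : Tendsto (fun n => kn n t - kn n s) U (𝓝 (k t - k s)) :=
      ((hk t).sub (hk s)).mono_left hUle
    have h1 := le_of_tendsto_of_tendsto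
      ((hδ.norm.pow 2).add ((hxs.inner tendsto_const_nhds).const_mul (2 * ((t : ℝ) - s))))
      ((((hxs.inner hδ).const_mul 2).add tendsto_const_nhds).add
        (((hVlim t).sub (hVlim s)).const_mul (2 * (o + η)))) ev
    have h2 : η * R = 2 * η * ‖β‖ * (t - s) + 2 * η * (V t - V s) := by rw [hR]; ring
    linarith
  refine ⟨k, ⟨hxc, hkc, fun t => sub_add_cancel _ _, fun t => ?_, hbv, ?_, ?_, ?_⟩, hk⟩
  · exact isClosed_closure.mem_of_tendsto ((hyt t).sub (hk t))
      (Eventually.of_forall fun n => (h n).mem t)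
  · refine tendsto_nhds_unique (hk 0) ?_
    simp only [(h _).k_zero]
    exact tendsto_const_nhds
  · intro α β hβ s t hst
    -- Just after `t`, right continuity makes both oscillations in `hvar` at most `η`; dropping the
    -- square leaves an error controlled by the increments of `V` and of time.
    refine stieltjesIntegral_contPart_sub_nonneg hxc hkc hbv mV (fun t ε₁ hε₁ => ?_) hst.le
    set η := ε₁ / (‖β‖ + 1) with hη
    have hη0 : 0 < η := by positivity
    have hηε : η ≤ ε₁ := div_le_self hε₁.le (by linarith [norm_nonneg β])
    have hηβ : η * ‖β‖ ≤ ε₁ := by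
      rw [hη, div_mul_eq_mul_div, div_le_iff₀ (by positivity)]
      nlinarith [norm_nonneg β]
    filter_upwards [hxc.eventually_forall_Ioc_norm_sub_le t hη0,
      hy.eventually_forall_Ioc_norm_sub_le t hη0, self_mem_nhdsWithin] with s h1 h2 hts
    have hts' : t ≤ s := le_of_lt hts
    have h3 := hvar α β hβ t s hts' η η
      (fun r hr => by
        rcases hr.1.eq_or_lt with rfl | htr
        · rw [sub_self, norm_zero]; exact hη0.le
        · exact h1 r ⟨htr, hr.2⟩)
      (fun r hr => by
        rcases hr.1.eq_or_lt with rfl | htr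
        · rw [sub_self, norm_zero]; exact hη0.le
        · exact h2 r ⟨htr, hr.2⟩)
    have h4 : (0 : ℝ) ≤ s - t := sub_nonneg.2 (NNReal.coe_le_coe.2 hts')
    have h5 := mul_le_mul_of_nonneg_right hηβ h4
    have h6 := mul_le_mul_of_nonneg_right hηε (sub_nonneg.2 (mV hts'))
    have h7 := sq_nonneg ‖k s - k t‖
    linarith
  · intro t ht
    exact hjumps.eq_of_jump_ne_zero hp hy hkc (fun _ => rfl) ht

end Limit

/-! ### Step approximation of a càdlàg path. -/

section StepTimes

variable {E : Type*} [NormedAddCommGroup E] [InnerProductSpace ℝ E]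

/-- The first time after `s`, capped at `s + 1`, at which `y` has moved by more than `ε`. -/
noncomputable def nextTime (ε : ℝ) (y : ℝ≥0 → E) (s : ℝ≥0) : ℝ≥0 :=
  sInf ({t | s < t ∧ ε < ‖y t - y s‖} ∪ {s + 1})

/-- The successive times at which `y` has moved by more than `ε`. -/
noncomputable def stepTime (ε : ℝ) (y : ℝ≥0 → E) : ℕ → ℝ≥0
  | 0 => 0
  | n + 1 => nextTime ε y (stepTime ε y n)

/-- The index of the step interval containing `t`. -/
noncomputable def stepIndex (ε : ℝ) (y : ℝ≥0 → E) (t : ℝ≥0) : ℕ :=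
  sInf {n | t < stepTime ε y (n + 1)}

/-- The step path following `y` up to an error `ε`. -/
noncomputable def stepDriver (ε : ℝ) (y : ℝ≥0 → E) (t : ℝ≥0) : E :=
  y (stepTime ε y (stepIndex ε y t))

theorem nextTime_lt_iff {ε : ℝ} {y : ℝ≥0 → E} {s q : ℝ≥0} :
    nextTime ε y s < q ↔ (∃ t, s < t ∧ t < q ∧ ε < ‖y t - y s‖) ∨ s + 1 < q := by
  rw [nextTime, csInf_lt_iff (OrderBot.bddBelow _) ⟨s + 1, Or.inr rfl⟩]
  constructor
  · rintro ⟨t, ⟨h1, h2⟩ | rfl, h3⟩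
    · exact Or.inl ⟨t, h1, h3, h2⟩
    · exact Or.inr h3
  · rintro (⟨t, h1, h3, h2⟩ | h)
    · exact ⟨t, Or.inl ⟨h1, h2⟩, h3⟩
    · exact ⟨_, Or.inr rfl, h⟩

theorem norm_sub_le_of_lt_nextTime {ε : ℝ} (hε : 0 ≤ ε) {y : ℝ≥0 → E} {s t : ℝ≥0} (hst : s ≤ t)
    (ht : t < nextTime ε y s) : ‖y t - y s‖ ≤ ε := by
  rcases hst.eq_or_lt with rfl | hst
  · rwa [sub_self, norm_zero]
  by_contra! h
  obtain ⟨q, hq1, hq2⟩ := exists_between ht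
  exact (lt_irrefl _) ((nextTime_lt_iff.2 (Or.inl ⟨t, hst, hq1, h⟩)).trans hq2)

variable {ε : ℝ} {y : ℝ≥0 → E}

theorem IsCadlag.lt_nextTime (hy : IsCadlag y) (hε : 0 < ε) (s : ℝ≥0) : s < nextTime ε y s := by
  obtain ⟨u, h1, h2⟩ := ((hy.eventually_forall_Ioc_norm_sub_le s hε).and self_mem_nhdsWithin).exists
  refine lt_of_lt_of_le (lt_min h2 (lt_add_of_pos_right s zero_lt_one)) (b := min u (s + 1)) ?_
  by_contra! h3
  rcases nextTime_lt_iff.1 h3 with ⟨t, h4, h5, h6⟩ | h4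
  · exact absurd (h1 t ⟨h4, (h5.trans_le (min_le_left _ _)).le⟩) (not_le.2 h6)
  · exact absurd h4 (not_lt.2 (min_le_right _ _))

theorem IsCadlag.strictMono_stepTime (hy : IsCadlag y) (hε : 0 < ε) : StrictMono (stepTime ε y) :=
  strictMono_nat_of_lt_succ fun _ => hy.lt_nextTime hε _

/-- If the step times accumulated at `L`, the left limit there would confine `y` to oscillations
below `ε`, contradicting a move by more than `ε` after each late step. The cap `s + 1` is not active
within distance one of `L`. -/
theorem IsCadlag.exists_lt_stepTime (hy : IsCadlag y) (hε : 0 < ε) (T : ℝ≥0) :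
    ∃ n, T < stepTime ε y n := by
  by_contra! hT
  have hm := hy.strictMono_stepTime hε
  have hb : BddAbove (range (stepTime ε y)) := ⟨T, by rintro _ ⟨n, rfl⟩; exact hT n⟩
  set L := ⨆ n, stepTime ε y n with hL
  have hlt : ∀ n, stepTime ε y n < L := fun n =>
    (hm n.lt_succ_self).trans_le (le_ciSup hb (n + 1))
  have hlim : Tendsto (stepTime ε y) atTop (𝓝[<] L) :=
    tendsto_nhdsWithin_iff.2 ⟨tendsto_atTop_ciSup hm.monotone hb, Eventually.of_forall hlt⟩
  obtain ⟨l, hl⟩ := (hy L).2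
  have hL0 : 0 < L := zero_le.trans_lt (hlt 0)
  obtain ⟨s, hs, hsub⟩ := (mem_nhdsLT_iff_exists_Ioo_subset' hL0).1
    ((Metric.tendsto_nhds.1 hl (ε / 2) (by positivity)).and
      (Ioo_mem_nhdsLT (tsub_lt_self hL0 zero_lt_one)))
  obtain ⟨n, hn⟩ := (hlim.eventually (Ioo_mem_nhdsLT (mem_Iio.1 hs))).exists
  rcases nextTime_lt_iff.1 (hlt (n + 1)) with ⟨t, h1, h2, h3⟩ | h1
  · have h4 : dist (y t) l < ε / 2 := (hsub ⟨hn.1.trans h1, h2⟩).1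
    have h5 : dist (y (stepTime ε y n)) l < ε / 2 := (hsub hn).1
    have h6 := dist_triangle_right (y t) (y (stepTime ε y n)) l
    rw [dist_eq_norm (y t) (y _)] at h6
    linarith
  · exact lt_asymm (hsub hn).2.1 (lt_tsub_iff_right.2 h1)

theorem IsCadlag.lt_stepTime_stepIndex (hy : IsCadlag y) (hε : 0 < ε) (t : ℝ≥0) :
    t < stepTime ε y (stepIndex ε y t + 1) := by
  have h : {n | t < stepTime ε y (n + 1)}.Nonempty := by
    obtain ⟨n, hn⟩ := hy.exists_lt_stepTime hε t
    exact ⟨n, hn.trans (hy.strictMono_stepTime hε n.lt_succ_self)⟩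
  exact Nat.sInf_mem h

theorem stepTime_stepIndex_le (ε : ℝ) (y : ℝ≥0 → E) (t : ℝ≥0) :
    stepTime ε y (stepIndex ε y t) ≤ t := by
  rcases h : stepIndex ε y t with _ | n
  · exact zero_le
  · have h1 : n < stepIndex ε y t := by omega
    exact not_lt.1 (Nat.notMem_of_lt_sInf h1)

theorem IsCadlag.stepIndex_eq (hy : IsCadlag y) (hε : 0 < ε) {t : ℝ≥0} {n : ℕ}
    (h1 : stepTime ε y n ≤ t) (h2 : t < stepTime ε y (n + 1)) : stepIndex ε y t = n := by
  have hm := hy.strictMono_stepTime hε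
  have h3 := hm.lt_iff_lt.1 (h1.trans_lt (hy.lt_stepTime_stepIndex hε t))
  have h4 := hm.lt_iff_lt.1 ((stepTime_stepIndex_le ε y t).trans_lt h2)
  omega

theorem IsCadlag.norm_stepDriver_sub_le (hy : IsCadlag y) (hε : 0 < ε) (t : ℝ≥0) :
    ‖stepDriver ε y t - y t‖ ≤ ε := by
  rw [norm_sub_rev]
  exact norm_sub_le_of_lt_nextTime hε.le (stepTime_stepIndex_le ε y t)
    (hy.lt_stepTime_stepIndex hε t)

end StepTimes

/-! ### Construction of step solutions, and deterministic existence. -/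

section StepConstruction

variable {E : Type*} [NormedAddCommGroup E] [InnerProductSpace ℝ E] [FiniteDimensional ℝ E]
  {A : E → Set E} {p : E → E} {ε : ℝ} {y : ℝ≥0 → E}

/-- The values at the step times of the solution driven by the step path. -/
noncomputable def stepState (A : E → Set E) (p : E → E) (ε : ℝ) (y : ℝ≥0 → E) : ℕ → E
  | 0 => p (y 0)
  | n + 1 => p (opFlow A (stepTime ε y (n + 1) - stepTime ε y n) (stepState A p ε y n)
      + (y (stepTime ε y (n + 1)) - y (stepTime ε y n)))

/-- The solution driven by the step path. -/
noncomputable def stepPath (A : E → Set E) (p : E → E) (ε : ℝ) (y : ℝ≥0 → E) (t : ℝ≥0) : E :=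
  opFlow A (t - stepTime ε y (stepIndex ε y t)) (stepState A p ε y (stepIndex ε y t))

/-- The correction term of the solution driven by the step path. -/
noncomputable def stepCorrection (A : E → Set E) (p : E → E) (ε : ℝ) (y : ℝ≥0 → E) (t : ℝ≥0) : E :=
  stepDriver ε y t - stepPath A p ε y t

/-- Seen as a step solution with constant driver, a semigroup trajectory inherits the variation
bounds proved for step solutions. -/
theorem IsMaximalMonotone.isStepSolution_flow (hA : IsMaximalMonotone A)
    (hp : IsGeneralizedProjection (closure (opDomain A)) p) {z : E} (hz : z ∈ opDomain A) :
    IsStepSolution A p (fun _ => z) (fun t => z - opFlow A t z) := by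
  have hz' := subset_closure hz
  refine ⟨fun t => ?_, fun t => ?_, fun t => ?_, ?_, ?_⟩
  · filter_upwards [self_mem_nhdsWithin] with s hts
    refine ⟨rfl, ?_⟩
    rw [sub_sub_cancel, sub_sub_cancel, ← hA.opFlow_add hz', add_tsub_cancel_of_le (le_of_lt hts)]
  · simp only [sub_sub_cancel]
    simp only [hp.eq_self _ (hA.opFlow_mem hz' _)]
    exact ((hA.continuous_opFlow hz').tendsto t).mono_left nhdsWithin_le_nhds
  · rw [sub_sub_cancel]
    exact hA.opFlow_mem hz' t
  · rw [opFlow_zero, sub_self]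
  · obtain ⟨b, hb⟩ := hz
    refine locallyBoundedVariationOn_of_norm_sub_le (H := fun t => ‖b‖ * t) fun u v huv => ?_
    rw [sub_sub_sub_cancel_left, norm_sub_rev]
    refine (hA.norm_opFlow_sub_time_le hb u v).trans ?_
    rw [abs_of_nonneg (sub_nonneg.2 (NNReal.coe_le_coe.2 huv)), mul_sub]

/-- Trajectories of the semigroup have locally bounded variation. -/
theorem IsMaximalMonotone.exists_flow_variation (hA : IsMaximalMonotone A)
    (hp : IsGeneralizedProjection (closure (opDomain A)) p)
    (hint : (interior (opDomain A)).Nonempty) {z : E} (hz : z ∈ closure (opDomain A)) :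
    ∃ H : ℝ≥0 → ℝ, Monotone H ∧ ∀ s t, s ≤ t → ‖opFlow A t z - opFlow A s z‖ ≤ H t - H s := by
  obtain ⟨ε₀, hε₀, hbound⟩ := hA.exists_pathVar_le hp hint
  -- The Lipschitz bound in time is available only from the domain; from its closure, trajectories
  -- are limits of trajectories with uniformly bounded variation.
  obtain ⟨w, hw, hwz⟩ := mem_closure_iff_seq_limit.1 hz
  obtain ⟨N, hN⟩ := eventually_atTop.1 ((Metric.tendsto_nhds.1 hwz ε₀ hε₀))
  have hwz' : Tendsto (fun n => w (n + N)) atTop (𝓝 z) := hwz.comp (tendsto_add_atTop_nat N)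
  have hstep := fun n => hA.isStepSolution_flow hp (hw (n + N))
  have hb := hbound ℕ _ _ (fun _ => z) (fun t => ⟨continuousWithinAt_const, z, tendsto_const_nhds⟩)
    hstep (fun n t => by rw [← dist_eq_norm]; exact (hN (n + N) le_add_self).le)
  obtain ⟨V, mV, hV⟩ := exists_monotone_ultrafilter_limit (Ultrafilter.of atTop)
    (fun n => pathVar_mono (hstep n).bv) (fun n t => pathVar_nonneg _ _)
    (fun t => (hb t).imp fun C hC n => hC n t le_rfl)
  have hflow : ∀ t, Tendsto (fun n => opFlow A t (w (n + N))) atTop (𝓝 (opFlow A t z)) := by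
    intro t
    rw [tendsto_iff_norm_sub_tendsto_zero] at hwz' ⊢
    exact squeeze_zero (fun _ => norm_nonneg _)
      (fun n => hA.norm_opFlow_sub_le (subset_closure (hw _)) hz t) hwz'
  refine ⟨V, mV, fun s t hst => ?_⟩
  refine le_of_tendsto_of_tendsto' (((hflow t).sub (hflow s)).norm.mono_left (Ultrafilter.of_le _))
    ((hV t).sub (hV s)) fun n => ?_
  have := norm_sub_le_pathVar (hstep n).bv hst
  rwa [sub_sub_sub_cancel_left, norm_sub_rev] at this

theorem stepState_mem (hp : IsGeneralizedProjection (closure (opDomain A)) p) (ε : ℝ)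
    (y : ℝ≥0 → E) (n : ℕ) : stepState A p ε y n ∈ closure (opDomain A) := by
  cases n with
  | zero => exact hp.mem _
  | succ n => exact hp.mem _

theorem IsCadlag.stepCorrection_eq (hy : IsCadlag y) (hε : 0 < ε) {t : ℝ≥0} {n : ℕ}
    (h1 : stepTime ε y n ≤ t) (h2 : t < stepTime ε y (n + 1)) :
    stepDriver ε y t = y (stepTime ε y n) ∧ stepCorrection A p ε y t
      = y (stepTime ε y n) - opFlow A (t - stepTime ε y n) (stepState A p ε y n) := by
  have h := hy.stepIndex_eq hε h1 h2
  simp only [stepCorrection, stepDriver, stepPath, h, and_self]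

theorem IsMaximalMonotone.isStepSolution_stepCorrection (hA : IsMaximalMonotone A)
    (hp : IsGeneralizedProjection (closure (opDomain A)) p)
    (hint : (interior (opDomain A)).Nonempty) (hy : IsCadlag y)
    (hy0 : y 0 ∈ closure (opDomain A)) (hε : 0 < ε) :
    IsStepSolution A p (stepDriver ε y) (stepCorrection A p ε y) := by
  have hm := hy.strictMono_stepTime hε
  have hx : ∀ t, stepDriver ε y t - stepCorrection A p ε y t = stepPath A p ε y t := fun t => by
    rw [stepCorrection, sub_sub_cancel]
  have hz := stepState_mem hp ε y
  have hflow : ∀ n, Continuous fun t : ℝ≥0 =>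
      opFlow A (t - stepTime ε y n) (stepState A p ε y n) := fun n =>
    (hA.continuous_opFlow (hz n)).comp (continuous_id.sub continuous_const)
  have hright : ∀ t, ∀ᶠ s in 𝓝[>] t, s < stepTime ε y (stepIndex ε y t + 1) := fun t =>
    nhdsWithin_le_nhds (Iio_mem_nhds (hy.lt_stepTime_stepIndex hε t))
  -- the step interval to the left of a positive time
  have hleft : ∀ t, 0 < t → ∃ n, stepTime ε y n < t ∧ t ≤ stepTime ε y (n + 1) ∧
      stepDriver ε y t - (y (stepTime ε y n)
        - opFlow A (t - stepTime ε y n) (stepState A p ε y n)) ∈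
        {w | p w = stepPath A p ε y t} := by
    intro t ht
    rcases (stepTime_stepIndex_le ε y t).lt_or_eq with h1 | h1
    · refine ⟨_, h1, (hy.lt_stepTime_stepIndex hε t).le, ?_⟩
      show p _ = _
      rw [stepDriver, sub_sub_cancel, hp.eq_self _ (hA.opFlow_mem (hz _) _), stepPath]
    · rcases h2 : stepIndex ε y t with _ | n
      · rw [h2] at h1
        exact absurd h1 ht.ne
      · rw [h2] at h1
        refine ⟨n, h1 ▸ hm n.lt_succ_self, h1.ge, ?_⟩
        show p _ = _
        rw [stepDriver, stepPath, h2, ← h1, tsub_self, opFlow_zero, stepState]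
        congr 1
        abel
  refine ⟨fun t => ?_, fun t => ?_, fun t => ?_, ?_, ?_⟩
  · filter_upwards [hright t, self_mem_nhdsWithin] with s hs hts
    have hts' : t ≤ s := le_of_lt hts
    have h1 := stepTime_stepIndex_le ε y t
    have h2 := hy.stepIndex_eq hε (h1.trans hts') hs
    rw [hx, hx, stepDriver, stepPath, h2]
    refine ⟨rfl, ?_⟩
    rw [stepPath, ← hA.opFlow_add (hz _)]
    congr 1
    rw [add_comm, tsub_add_tsub_cancel hts' h1]
  · rcases eq_zero_or_pos t with rfl | ht
    · have : 𝓝[<] (0 : ℝ≥0) = ⊥ := by simp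
      rw [this]
      exact tendsto_bot
    obtain ⟨n, h1, h2, h3⟩ := hleft t ht
    rw [hx, ← show p _ = _ from h3]
    have h4 := (((hflow n).tendsto t).mono_left (nhdsWithin_le_nhds (s := Iio t))).const_sub
      (y (stepTime ε y n))
    refine (hp.continuous.tendsto _).comp (Tendsto.congr' ?_ (h4.const_sub _))
    filter_upwards [Ico_mem_nhdsLT h1] with s hs
    rw [(hy.stepCorrection_eq hε hs.1 (hs.2.trans_le h2)).2]
  · rw [hx]
    exact hA.opFlow_mem (hz _) _
  · have h1 : stepIndex ε y 0 = 0 := hy.stepIndex_eq hε le_rfl (hy.lt_nextTime hε 0)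
    rw [stepCorrection, stepDriver, stepPath, h1]
    simp only [stepTime, stepState, tsub_self, opFlow_zero, hp.eq_self _ hy0, sub_self]
  · have hfin : ∀ t, eVariationOn (stepCorrection A p ε y) (Icc 0 t) ≠ ⊤ := by
      have hpiece : ∀ n s t, stepTime ε y n ≤ s → s ≤ t → t ≤ stepTime ε y (n + 1) →
          eVariationOn (stepCorrection A p ε y) (Icc s t) ≠ ⊤ := by
        intro n s t hs hst ht
        obtain ⟨H, mH, hH⟩ := hA.exists_flow_variation hp hint (hz n)
        set g : ℝ≥0 → E := fun r =>
          y (stepTime ε y n) - opFlow A (r - stepTime ε y n) (stepState A p ε y n) with hg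
        -- The correction equals `g` before `t` but may have jumped at `t`, when `t` is the next
        -- step time; `J` is the size of that jump.
        set J := ‖stepCorrection A p ε y t - g t‖ with hJ
        refine ne_top_of_le_ne_top ENNReal.ofReal_ne_top (eVariationOn_le_of_norm_sub_le
          (H := fun r => H (r - stepTime ε y n) + if t ≤ r then J else 0) hst ?_)
        intro u v hu huv hv
        have h0 : ∀ r, s ≤ r → r < t → stepCorrection A p ε y r = g r := fun r hr hrt =>
          (hy.stepCorrection_eq hε (hs.trans hr) (hrt.trans_le ht)).2
        have h1 : ‖g v - g u‖ ≤ H (v - stepTime ε y n) - H (u - stepTime ε y n) := by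
          simp only [hg]
          rw [sub_sub_sub_cancel_left, norm_sub_rev]
          exact hH _ _ (tsub_le_tsub_right huv _)
        rcases hv.lt_or_eq with hvt | rfl
        · rw [h0 u hu (huv.trans_lt hvt), h0 v (hu.trans huv) hvt, if_neg (not_le.2 hvt),
            if_neg (not_le.2 (huv.trans_lt hvt))]
          linarith
        · rcases huv.lt_or_eq with huv | rfl
          · rw [h0 u hu huv, if_pos le_rfl, if_neg (not_le.2 huv), ← sub_add_sub_cancel _ (g v)]
            refine (norm_add_le _ _).trans ?_
            linarith
          · simp
      have hstep : ∀ n, eVariationOn (stepCorrection A p ε y) (Icc 0 (stepTime ε y n)) ≠ ⊤ := by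
        intro n
        induction n with
        | zero => simp [stepTime]
        | succ n ih =>
          have h1 := eVariationOn.Icc_add_Icc (stepCorrection A p ε y) (s := univ)
            (zero_le (a := stepTime ε y n)) (hm n.lt_succ_self).le (mem_univ _)
          simp only [univ_inter] at h1
          rw [← h1]
          exact ENNReal.add_ne_top.2 ⟨ih, hpiece n _ _ le_rfl (hm n.lt_succ_self).le le_rfl⟩
      intro t
      obtain ⟨n, hn⟩ := hy.exists_lt_stepTime hε t
      exact ne_top_of_le_ne_top (hstep n) (eVariationOn.mono _ (Icc_subset_Icc_right hn.le))
    intro a b _ _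
    rw [univ_inter]
    exact ne_top_of_le_ne_top (hfin b) (eVariationOn.mono _ (Icc_subset_Icc_left zero_le))

/-- Existence for the deterministic Skorokhod problem, as a limit of solutions driven by step
paths. -/
theorem IsMaximalMonotone.exists_isSkorokhodSolution (hA : IsMaximalMonotone A)
    (hp : IsGeneralizedProjection (closure (opDomain A)) p)
    (hint : (interior (opDomain A)).Nonempty) :
    ∃ ε : ℕ → ℝ, (∀ n, 0 < ε n) ∧ ∀ y : ℝ≥0 → E, IsCadlag y → y 0 ∈ closure (opDomain A) →
      ∃ k, IsSkorokhodSolution A p y (fun t => y t - k t) k ∧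
        ∀ t, Tendsto (fun n => stepCorrection A p (ε n) y t) atTop (𝓝 (k t)) := by
  obtain ⟨ε₀, hε₀, h⟩ := hA.exists_isSkorokhodSolution_of_tendsto hp hint
  have hpos : ∀ n : ℕ, 0 < ε₀ * (1 / ((n : ℝ) + 1)) := fun n => by positivity
  -- The accuracies do not depend on `y`, so for random paths the solution is the limit of a single
  -- sequence of maps.
  refine ⟨fun n => ε₀ * (1 / ((n : ℝ) + 1)), hpos, fun y hy hy0 => ?_⟩
  refine h y _ _ _ hy (fun n => hA.isStepSolution_stepCorrection hp hint hy hy0 (hpos n))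
    (fun n t => hy.norm_stepDriver_sub_le (hpos n) t) (fun n => ?_) ?_
  · refine mul_le_of_le_one_right hε₀.le ?_
    rw [div_le_one (by positivity)]
    linarith [n.cast_nonneg (α := ℝ)]
  · simpa using tendsto_one_div_add_atTop_nhds_zero_nat.const_mul ε₀

end StepConstruction

/-! ### Measurability of the step construction. -/

section Measurability

variable {E : Type*} [NormedAddCommGroup E] [InnerProductSpace ℝ E] [FiniteDimensional ℝ E]
  [MeasurableSpace E] [BorelSpace E] {A : E → Set E} {p : E → E} {ε : ℝ}
  {Ω : Type*} [MeasurableSpace Ω] {Y : ℝ≥0 → Ω → E}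

/-- A process with right continuous paths is jointly measurable. -/
theorem measurable_uncurry_of_isCadlag (hY : ∀ t, Measurable (Y t))
    (hc : ∀ ω, IsCadlag fun t => Y t ω) : Measurable fun q : Ω × ℝ≥0 => Y q.2 q.1 := by
  have hcomp : ∀ (c : ℕ → ℝ≥0) (f : ℝ≥0 → ℕ), Measurable f →
      Measurable fun q : Ω × ℝ≥0 => Y (c (f q.2)) q.1 := by
    intro c f hf
    have h1 : Measurable fun r : Ω × ℕ => Y (c r.2) r.1 :=
      measurable_from_prod_countable_left fun m => hY (c m)
    exact h1.comp (measurable_fst.prodMk (hf.comp measurable_snd))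
  have hm : ∀ n : ℕ, Measurable fun q : Ω × ℝ≥0 =>
      Y (((⌊(2 : ℝ≥0) ^ n * q.2⌋₊ : ℝ≥0) + 1) / 2 ^ n) q.1 := fun n =>
    hcomp (fun m => ((m : ℝ≥0) + 1) / 2 ^ n) (fun t => ⌊(2 : ℝ≥0) ^ n * t⌋₊)
      (Nat.measurable_floor.comp (measurable_id.const_mul _))
  refine measurable_of_tendsto_metrizable hm (tendsto_pi_nhds.2 fun q => ?_)
  exact ((hc q.1).tendsto_right q.2).comp (tendsto_dyadic_right q.2)

/-- By right continuity, a move by more than `ε` before `q` is detected at a countable dense set of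
times. No stopping-time property is needed, since the σ-algebra is fixed. -/
theorem measurable_nextTime (hY : ∀ t, Measurable (Y t)) (hc : ∀ ω, IsCadlag fun t => Y t ω)
    {σ : Ω → ℝ≥0} (hσ : Measurable σ) :
    Measurable fun ω => nextTime ε (fun t => Y t ω) (σ ω) := by
  have hYσ : Measurable fun ω => Y (σ ω) ω :=
    (measurable_uncurry_of_isCadlag hY hc).comp (measurable_id.prodMk hσ)
  obtain ⟨S, hS, hSd⟩ := TopologicalSpace.exists_countable_dense ℝ≥0
  refine measurable_of_Iio fun q => ?_
  have h : (fun ω => nextTime ε (fun t => Y t ω) (σ ω)) ⁻¹' Iio q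
      = (⋃ t ∈ S, ({ω | σ ω < t} ∩ {ω | t < q ∧ ε < ‖Y t ω - Y (σ ω) ω‖}))
        ∪ {ω | σ ω + 1 < q} := by
    ext ω
    rw [mem_preimage, mem_Iio, nextTime_lt_iff]
    refine or_congr ⟨?_, ?_⟩ Iff.rfl
    · rintro ⟨t, h1, h2, h3⟩
      have h4 : ∀ᶠ s in 𝓝[>] t, ε < ‖Y s ω - Y (σ ω) ω‖ :=
        (((hc ω).tendsto_right t).sub_const _).norm.eventually_const_lt h3
      obtain ⟨r, hr, hsub⟩ := mem_nhdsGT_iff_exists_Ioc_subset.1 h4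
      obtain ⟨s, hs, hts, hsr⟩ := hSd.exists_between (lt_min (mem_Ioi.1 hr) h2)
      exact mem_iUnion₂.2 ⟨s, hs, h1.trans hts, hsr.trans_le (min_le_right _ _),
        hsub ⟨hts, (hsr.trans_le (min_le_left _ _)).le⟩⟩
    · intro h
      obtain ⟨t, -, h1, h2, h3⟩ := mem_iUnion₂.1 h
      exact ⟨t, h1, h2, h3⟩
  rw [h]
  refine (MeasurableSet.biUnion hS fun t _ => ?_).union
    (measurableSet_lt (hσ.add_const 1) measurable_const)
  refine (measurableSet_lt hσ measurable_const).inter ?_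
  by_cases htq : t < q
  · simp only [htq, true_and]
    exact measurableSet_lt measurable_const ((hY t).sub hYσ).norm
  · simp [htq]

theorem measurable_stepTime (hY : ∀ t, Measurable (Y t)) (hc : ∀ ω, IsCadlag fun t => Y t ω)
    (n : ℕ) : Measurable fun ω => stepTime ε (fun t => Y t ω) n := by
  induction n with
  | zero => exact measurable_const
  | succ n ih => exact measurable_nextTime hY hc ih

theorem measurable_stepIndex (hY : ∀ t, Measurable (Y t)) (hc : ∀ ω, IsCadlag fun t => Y t ω)
    (hε : 0 < ε) (t : ℝ≥0) : Measurable fun ω => stepIndex ε (fun t => Y t ω) t := by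
  refine measurable_to_countable' fun n => ?_
  have h : (fun ω => stepIndex ε (fun t => Y t ω) t) ⁻¹' {n}
      = {ω | stepTime ε (fun t => Y t ω) n ≤ t} ∩ {ω | t < stepTime ε (fun t => Y t ω) (n + 1)} := by
    ext ω
    constructor
    · intro h
      have h' : stepIndex ε (fun t => Y t ω) t = n := h
      subst h'
      exact ⟨stepTime_stepIndex_le _ _ _, (hc ω).lt_stepTime_stepIndex hε t⟩
    · rintro ⟨h1, h2⟩
      exact (hc ω).stepIndex_eq hε h1 h2
  rw [h]
  exact (measurableSet_le (measurable_stepTime hY hc n) measurable_const).inter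
    (measurableSet_lt measurable_const (measurable_stepTime hY hc (n + 1)))

theorem IsMaximalMonotone.measurable_opFlow (hA : IsMaximalMonotone A)
    (hp : IsGeneralizedProjection (closure (opDomain A)) p) {τ : Ω → ℝ≥0} {Z : Ω → E}
    (hτ : Measurable τ) (hZ : Measurable Z) (hZD : ∀ ω, Z ω ∈ closure (opDomain A)) :
    Measurable fun ω => opFlow A (τ ω) (Z ω) := by
  -- Precomposition with `p` extends the semigroup to the whole space as a jointly continuous map,
  -- without changing it on the closure of the domain.
  have h1 : Continuous fun q : E × ℝ≥0 => opFlow A q.2 (p q.1) := by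
    refine continuous_prod_of_continuous_lipschitzWith _ 1
      (fun x => hA.continuous_opFlow (hp.mem x)) fun t => LipschitzWith.of_dist_le_mul fun x y => ?_
    rw [NNReal.coe_one, one_mul, dist_eq_norm, dist_eq_norm]
    exact (hA.norm_opFlow_sub_le (hp.mem x) (hp.mem y) t).trans (hp.nonexpansive x y)
  have h2 := h1.measurable.comp (hZ.prodMk hτ)
  convert h2 using 2 with ω
  simp only [Function.comp_apply, hp.eq_self _ (hZD ω)]

theorem IsMaximalMonotone.measurable_stepState (hA : IsMaximalMonotone A)
    (hp : IsGeneralizedProjection (closure (opDomain A)) p) (hY : ∀ t, Measurable (Y t))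
    (hc : ∀ ω, IsCadlag fun t => Y t ω) (n : ℕ) :
    Measurable fun ω => stepState A p ε (fun t => Y t ω) n := by
  have hu := measurable_uncurry_of_isCadlag hY hc
  have hYσ : ∀ n, Measurable fun ω => Y (stepTime ε (fun t => Y t ω) n) ω := fun n =>
    hu.comp (measurable_id.prodMk (measurable_stepTime hY hc n))
  induction n with
  | zero => exact hp.continuous.measurable.comp (hY 0)
  | succ n ih =>
    exact hp.continuous.measurable.comp ((hA.measurable_opFlow hp
      ((measurable_stepTime hY hc (n + 1)).sub (measurable_stepTime hY hc n)) ih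
      fun ω => stepState_mem hp _ _ _).add ((hYσ (n + 1)).sub (hYσ n)))

theorem IsMaximalMonotone.measurable_stepCorrection (hA : IsMaximalMonotone A)
    (hp : IsGeneralizedProjection (closure (opDomain A)) p) (hY : ∀ t, Measurable (Y t))
    (hc : ∀ ω, IsCadlag fun t => Y t ω) (hε : 0 < ε) (t : ℝ≥0) :
    Measurable fun ω => stepCorrection A p ε (fun t => Y t ω) t := by
  have hu := measurable_uncurry_of_isCadlag hY hc
  have h1 : Measurable fun q : Ω × ℕ => Y (stepTime ε (fun t => Y t q.1) q.2) q.1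
      - opFlow A (t - stepTime ε (fun t => Y t q.1) q.2)
        (stepState A p ε (fun t => Y t q.1) q.2) :=
    measurable_from_prod_countable_left fun n =>
      (hu.comp (measurable_id.prodMk (measurable_stepTime hY hc n))).sub
        (hA.measurable_opFlow hp (measurable_const.sub (measurable_stepTime hY hc n))
          (hA.measurable_stepState hp hY hc n) fun ω => stepState_mem hp _ _ _)
  exact h1.comp (measurable_id.prodMk (measurable_stepIndex hY hc hε t))

end Measurability

/-! ### Stopped paths and the stochastic problem. -/

theorem IsCadlag.stopped {E : Type*} [NormedAddCommGroup E] [CompleteSpace E] {y : ℝ≥0 → E} (hy : IsCadlag y)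
    (T : ℝ≥0) : IsCadlag fun t => y (min t T) := by
  intro t
  refine ⟨continuousWithinAt_stopped (fun t => (hy t).1) T t, ?_⟩
  rcases le_or_gt t T with h | h
  · obtain ⟨l, hl⟩ := (hy t).2
    refine ⟨l, hl.congr' ?_⟩
    filter_upwards [self_mem_nhdsWithin] with s hs
    rw [min_eq_left ((le_of_lt hs).trans h)]
  · refine ⟨y T, tendsto_const_nhds.congr' ?_⟩
    filter_upwards [Ioo_mem_nhdsLT h] with s hs
    rw [min_eq_right hs.1.le]

theorem mainTheorem8 {d : ℕ} {Ω : Type*} {mΩ : MeasurableSpace Ω}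
    (P : Measure Ω) [IsProbabilityMeasure P] [P.IsComplete]
    (F : Filtration ℝ≥0 mΩ) (hF : ∀ t, ∀ N : Set Ω, P N = 0 → MeasurableSet[F t] N)
    (A : EuclideanSpace ℝ (Fin d) → Set (EuclideanSpace ℝ (Fin d)))
    (hA : IsMaximalMonotone A) (hint : (interior (opDomain A)).Nonempty)
    (p : EuclideanSpace ℝ (Fin d) → EuclideanSpace ℝ (Fin d))
    (hp : IsGeneralizedProjection (closure (opDomain A)) p)
    (Y : ℝ≥0 → Ω → EuclideanSpace ℝ (Fin d)) (hY : Adapted F Y)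
    (hYc : ∀ᵐ ω ∂P, IsCadlag fun t => Y t ω)
    (hY0 : ∀ᵐ ω ∂P, Y 0 ω ∈ closure (opDomain A)) :
    (∃ X K : ℝ≥0 → Ω → EuclideanSpace ℝ (Fin d),
      IsStochasticSkorokhodSolution P F A p Y X K) ∧
    (∀ X K X' K' : ℝ≥0 → Ω → EuclideanSpace ℝ (Fin d),
      IsStochasticSkorokhodSolution P F A p Y X K →
      IsStochasticSkorokhodSolution P F A p Y X' K' →
      ∀ᵐ ω ∂P, ∀ t, X t ω = X' t ω ∧ K t ω = K' t ω) := by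

  constructor
  · obtain ⟨ε, hε, hex⟩ := hA.exists_isSkorokhodSolution hp hint
    obtain ⟨z, hz⟩ := hint.mono interior_subset
    set N : Set Ω := {ω | ¬(IsCadlag (fun t => Y t ω) ∧ Y 0 ω ∈ closure (opDomain A))} with hN
    have hPN : P N = 0 := by
      have h1 : ∀ᵐ ω ∂P, IsCadlag (fun t => Y t ω) ∧ Y 0 ω ∈ closure (opDomain A) := hYc.and hY0
      exact ae_iff.1 h1
    classical
    -- the modification of `Y` which is well behaved everywhere
    set Y' : ℝ≥0 → Ω → EuclideanSpace ℝ (Fin d) := fun t => N.piecewise (fun _ => z) (Y t) with hY'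
    have hYY' : ∀ ω, ω ∉ N → ∀ t, Y' t ω = Y t ω := fun ω hω t => piecewise_eq_of_notMem _ _ _ hω
    have hY'm : ∀ t, Measurable[F t] (Y' t) := fun t =>
      -- The exceptional set is null, hence lies in every `F t`, so the modification stays adapted.
      Measurable.piecewise (hF t N hPN) measurable_const (hY t)
    have hY'z : ∀ ω, ω ∈ N → (fun t => Y' t ω) = fun _ => z := fun ω hω => by
      funext t; exact piecewise_eq_of_mem _ _ _ hω
    have hgood : ∀ ω, ω ∉ N → IsCadlag (fun t => Y t ω) ∧ Y 0 ω ∈ closure (opDomain A) :=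
      fun ω hω => not_not.1 hω
    have hY'c : ∀ ω, IsCadlag fun t => Y' t ω := fun ω => by
      by_cases hω : ω ∈ N
      · rw [hY'z ω hω]
        exact fun t => ⟨continuousWithinAt_const, z, tendsto_const_nhds⟩
      · simp only [hYY' ω hω]
        exact (hgood ω hω).1
    have hY'0 : ∀ ω, Y' 0 ω ∈ closure (opDomain A) := fun ω => by
      by_cases hω : ω ∈ N
      · rw [show Y' 0 ω = z from piecewise_eq_of_mem _ _ _ hω]
        exact subset_closure hz
      · rw [hYY' ω hω]
        exact (hgood ω hω).2
    choose K hK hKlim using fun ω => hex (fun t => Y' t ω) (hY'c ω) (hY'0 ω)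
    -- The path stopped at `T` is entirely `F T`-measurable, hence so is the solution `L` it drives;
    -- uniqueness up to `T` gives `K ω T = L ω T`.
    have hKm : ∀ T, Measurable[F T] fun ω => K ω T := by
      intro T
      have hcad : ∀ ω, IsCadlag fun t => Y' (min t T) ω := fun ω => (hY'c ω).stopped T
      have hmeas : ∀ t, Measurable[F T] (Y' (min t T)) := fun t =>
        (hY'm _).mono (F.mono (min_le_right t T)) le_rfl
      choose L hL hLlim using fun ω => hex (fun t => Y' (min t T) ω) (hcad ω)
        (by rw [min_eq_left zero_le]; exact hY'0 ω)
      have hKL : (fun ω => K ω T) = fun ω => L ω T := by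
        funext ω
        exact (hK ω).eq_of_eq_on hA hp (hL ω) fun t ht => by rw [min_eq_left ht]
      rw [hKL]
      let _ := F T
      exact measurable_of_tendsto_metrizable
        (fun n => hA.measurable_stepCorrection hp hmeas hcad (hε n) T)
        (tendsto_pi_nhds.2 fun ω => hLlim ω T)
    refine ⟨fun t ω => Y' t ω - K ω t, fun t ω => K ω t, fun t => (hY'm t).sub (hKm t), hKm,
      Eventually.of_forall fun ω => (hK ω).cadlag_x, Eventually.of_forall fun ω => (hK ω).cadlag_k,
      ?_⟩
    have hae : ∀ᵐ ω ∂P, ω ∉ N := measure_eq_zero_iff_ae_notMem.1 hPN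
    filter_upwards [hae] with ω hω
    have h1 := hK ω
    rw [show (fun t => Y' t ω) = fun t => Y t ω from funext (hYY' ω hω)] at h1
    simp only [hYY' ω hω] at h1 ⊢
    exact h1
  · intro X K X' K' h h'
    filter_upwards [h.solves, h'.solves] with ω h1 h2 t
    have hk : K t ω = K' t ω := h1.eq_of_eq_on hA hp h2 (T := t) fun _ _ => rfl
    refine ⟨?_, hk⟩
    have e1 := h1.sub_eq t
    have e2 := h2.sub_eq t
    rw [← e1, ← e2, hk]
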